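/- Let $k$ be a field of characteristic $0$ and let $P$ be a $k$-linear symmetric operad. For a vector space $U$ let $P\{U\}=\bigoplus_{r\ge 0}P([r])\otimes_{k[S_r]}U^{\otimes r}$ be the free $P$-algebra on $U$. Let $W=\bigcup_n W_n$ have basis $x_1,x_2,\dots$, where $W_n=k^n$ is the span of $x_1,\dots,x_n$. Put $V_n=P\{W_n\}$ and $V=P\{W\}$. Let $\mathfrak h_n$ be the Lie algebra of all $P$-algebra derivations of $V_n$. Extending a derivation of $V_n$ by $0$ on $x_i$ for $i>n$ makes $\mathfrak h_n$ act on $V$; let $\mathfrak h=\bigcup_n\mathfrak h_n$, which is the Lie algebra of derivations of $V$ killing all but finitely many $x_i$. Each $A\in\mathfrak{gl}_n=\mathfrak{gl}(W_n)$ extends uniquely to a derivation of $V_n$, so that $\mathfrak{gl}_n$ maps to $\mathfrak h_n$ and acts on every $\mathfrak h_n$-module. A *polynomial* $\mathfrak h_n$-module (resp. $\mathfrak h$-module) is a subquotient of a possibly infinite direct sum of tensor powers $V_n^{\otimes d}$ (resp. $V^{\otimes d}$), $d\ge 0$; they form the category $\mathrm{Rep}^{\mathrm{pol}}(\mathfrak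 h_n)$ (resp. $\mathrm{Rep}^{\mathrm{pol}}(\mathfrak h)$). Let $\mathfrak{gl}_{\infty-n}\subset\mathfrak h$ be the Lie algebra of endomorphisms of $W$ that kill all but finitely many $x_i$, kill $x_1,\dots,x_n$, and have image in the span of the $x_i$ with $i>n$. For an $\mathfrak h$-module $N$ put $\Gamma_n(N)=N^{\mathfrak{gl}_{\infty-n}}$; this is an $\mathfrak h_n$-module, since $\mathfrak h_n$ commutes with $\mathfrak{gl}_{\infty-n}$ in $\mathfrak h$. Let $\mathbf S_\lambda$ denote the Schur functor of a partition $\lambda$ and $\ell(\lambda)$ its number of rows. **Proposition.** Let $\lambda$ be a partition with $\ell(\lambda)\le n$. (a) $\mathbf S_\lambda(V_n)$ is generated as an $\mathfrak h_n$-module by (the image of) $\mathbf S_\lambda(W_n)$. (b) For every polynomial $\mathfrak h_n$-module $M$ the restriction map $\mathrm{Hom}_{\mathfrak h_n}(\mathbf S_\lambda(V_n),M)\to\mathrm{Hom}_{\mathfrak{gl}_n}(\mathbf S_\lambda(W_n),M)$ is bijective. (c) The map $\mathbf S_\lambda(V_n)\to\Gamma_n(\mathbf S_\lambda(V))$ induced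 by $V_n\subset V$ is an isomorphism of $\mathfrak h_n$-modules. With this identification, the map $\Gamma_n\colon\mathrm{Hom}_{\mathfrak h}(\mathbf S_\lambda(V),N)\to\mathrm{Hom}_{\mathfrak h_n}(\mathbf S_\lambda(V_n),\Gamma_n(N))$ is bijective for every polynomial $\mathfrak h$-module $N$. (d) $\mathbf S_\lambda(V_n)$ is a projective object of $\mathrm{Rep}^{\mathrm{pol}}(\mathfrak h_n)$. If $P([0])=0$ and $\dim_k P([1])=1$, then it is indecomposable, and every indecomposable projective object of $\mathrm{Rep}^{\mathrm{pol}}(\mathfrak h_n)$ is isomorphic to $\mathbf S_\nu(V_n)$ for some partition $\nu$ with $\ell(\nu)\le n$. (e) Every polynomial $\mathfrak h_n$-module is a quotient of a direct sum of modules $\mathbf S_\nu(V_n)$ with $\ell(\nu)\le n$. -/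

import Mathlib

open scoped TensorProduct DirectSum

universe u

/-- The commutator bracket on endomorphisms. -/
instance endLieRing {k M : Type*} [CommRing k] [AddCommGroup M] [Module k M] :
    LieRing (Module.End k M) :=
  LieRing.ofAssociativeRing

/-- A (symmetric, linear) operad over `k`, in coordinate-free form: a functor `S ↦ P(S)` from finite
sets and bijections to `k`-vector spaces, an identity operation `one ∈ P([1])`, and for every
finite set `S` and every family of finite sets `T s` (`s ∈ S`) a composition
`P(S) × ∏ s, P(T s) → P(⊔ s, T s)` that is linear in each argument, compatible with bijections,
unital and associative.  A decomposition of a finite set into blocks indexed by `S` is the same as a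
bijection with a disjoint union `Σ s, T s`. -/
structure LinearOperad (k : Type u) [Field k] where
  obj : (S : Type) → [Finite S] → Type u
  [instAddCommGroup : ∀ (S : Type) [Finite S], AddCommGroup (obj S)]
  [instModule : ∀ (S : Type) [Finite S], Module k (obj S)]
  map : ∀ {S T : Type} [Finite S] [Finite T], S ≃ T → obj S →ₗ[k] obj T
  one : obj Unit
  comp : ∀ {S : Type} [Finite S] {T : S → Type} [∀ s, Finite (T s)],
    obj S →ₗ[k] MultilinearMap k (fun s => obj (T s)) (obj (Σ s, T s))
  map_refl : ∀ {S : Type} [Finite S] (p : obj S), map (Equiv.refl S) p = p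
  map_trans : ∀ {S T U : Type} [Finite S] [Finite T] [Finite U] (e : S ≃ T) (f : T ≃ U)
    (p : obj S), map (e.trans f) p = map f (map e p)
  comp_map_left : ∀ {S S' : Type} [Finite S] [Finite S'] (e : S ≃ S') {T : S' → Type}
    [∀ s, Finite (T s)] (p : obj S) (q : ∀ s, obj (T s)),
    comp (map e p) q = map (Equiv.sigmaCongrLeft e) (comp p fun s => q (e s))
  comp_map_right : ∀ {S : Type} [Finite S] {T T' : S → Type} [∀ s, Finite (T s)]
    [∀ s, Finite (T' s)] (f : ∀ s, T s ≃ T' s) (p : obj S) (q : ∀ s, obj (T s)),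
    comp p (fun s => map (f s) (q s)) = map (Equiv.sigmaCongrRight f) (comp p q)
  one_comp : ∀ {T : Type} [Finite T] (q : obj T),
    map (Equiv.uniqueSigma fun _ : Unit => T) (comp one fun _ => q) = q
  comp_one : ∀ {S : Type} [Finite S] (p : obj S),
    map (Equiv.sigmaPUnit S) (comp p fun _ => one) = p
  comp_assoc : ∀ {S : Type} [Finite S] {T : S → Type} [∀ s, Finite (T s)]
    {U : ∀ s, T s → Type} [∀ s t, Finite (U s t)] (p : obj S) (q : ∀ s, obj (T s))
    (r : ∀ s t, obj (U s t)),
    map (Equiv.sigmaAssoc U) (comp (comp p q) fun st => r st.1 st.2) =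
      comp p fun s => comp (q s) (r s)

namespace LinearOperad

attribute [instance] instAddCommGroup instModule

/-- An algebra over the operad `P`: every `p ∈ P(S)` acts as a multilinear operation
`A ^ S → A`, linearly in `p`, compatibly with bijections, identity and composition. -/
class Algebra {k : Type u} [Field k] (P : LinearOperad k) (A : Type u) [AddCommGroup A]
    [Module k A] where
  act : ∀ {S : Type} [Finite S], P.obj S →ₗ[k] MultilinearMap k (fun _ : S => A) A
  act_map : ∀ {S T : Type} [Finite S] [Finite T] (e : S ≃ T) (p : P.obj S) (a : T → A),
    act (P.map e p) a = act p fun s => a (e s)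
  act_one : ∀ a : Unit → A, act P.one a = a ()
  act_comp : ∀ {S : Type} [Finite S] {T : S → Type} [∀ s, Finite (T s)] (p : P.obj S)
    (q : ∀ s, P.obj (T s)) (a : (Σ s, T s) → A),
    act (P.comp p q) a = act p fun s => act (q s) fun t => a ⟨s, t⟩

section Leibniz
variable {k : Type*} [Field k] {U A B : Type*} [AddCommGroup U] [Module k U]
  [AddCommGroup A] [Module k A] [AddCommGroup B] [Module k B]
  {ι : Type*} [Fintype ι] [DecidableEq ι]

/-- The multilinear map `a ↦ ∑ i, φ(g a₁, …, f aᵢ, …, g aᵣ)`. -/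
noncomputable def leibniz (g f : U →ₗ[k] A) (φ : MultilinearMap k (fun _ : ι => A) B) :
    MultilinearMap k (fun _ : ι => U) B :=
  ∑ i, φ.compLinearMap (Function.update (fun _ => g) i f)

theorem leibniz_apply (g f : U →ₗ[k] A) (φ : MultilinearMap k (fun _ : ι => A) B) (a : ι → U) :
    leibniz g f φ a = ∑ i, φ (Function.update (fun j => g (a j)) i (f (a i))) := by
  simp only [leibniz, FunLike.coe_sum, Finset.sum_apply, MultilinearMap.compLinearMap_apply]
  refine Finset.sum_congr rfl fun i _ => congrArg φ (funext fun j => ?_)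
  by_cases h : j = i
  · subst h; simp
  · simp [Function.update_of_ne h]

theorem leibniz_bracket (f g : Module.End k A) (φ : MultilinearMap k (fun _ : ι => A) B) :
    leibniz LinearMap.id ⁅f, g⁆ φ = leibniz LinearMap.id g (leibniz LinearMap.id f φ) -
      leibniz LinearMap.id f (leibniz LinearMap.id g φ) := by
  ext a
  simp only [leibniz_apply, sub_apply, LinearMap.id_apply]
  have key : ∀ f g : Module.End k A,
      ∑ j, ∑ i, φ (Function.update (Function.update a j (g (a j))) i
        (f (Function.update a j (g (a j)) i))) =
      ∑ i, φ (Function.update a i (f (g (a i)))) +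
      ∑ j, ∑ i, if i = j then 0 else
        φ (Function.update (Function.update a j (g (a j))) i (f (a i))) := by
    intro f g
    rw [← Finset.sum_add_distrib]
    refine Finset.sum_congr rfl fun j _ => ?_
    rw [← Finset.sum_erase_add _ _ (Finset.mem_univ j), add_comm]
    congr 1
    · simp
    · rw [← Finset.sum_erase_add (Finset.univ : Finset ι) _ (Finset.mem_univ j)]
      simp only [if_true, add_zero]
      refine Finset.sum_congr rfl fun i hi => ?_
      have hij : i ≠ j := Finset.ne_of_mem_erase hi
      rw [if_neg hij, Function.update_of_ne hij]
  have key2 : (∑ j, ∑ i, if i = j then 0 else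
        φ (Function.update (Function.update a j (g (a j))) i (f (a i)))) =
      ∑ j, ∑ i, if i = j then 0 else
        φ (Function.update (Function.update a j (f (a j))) i (g (a i))) := by
    rw [Finset.sum_comm]
    refine Finset.sum_congr rfl fun i _ => Finset.sum_congr rfl fun j _ => ?_
    by_cases h : i = j
    · simp [h]
    · rw [if_neg h, if_neg (Ne.symm h), Function.update_comm h]
  have h1 := key f g
  have h2 := key g f
  rw [h1, h2, key2, add_sub_add_right_eq_sub, ← Finset.sum_sub_distrib]
  refine Finset.sum_congr rfl fun i _ => ?_
  rw [LieRing.of_associative_ring_bracket, LinearMap.sub_apply, Module.End.mul_apply,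
    Module.End.mul_apply, φ.map_update_sub]

end Leibniz

section Derivations
variable {k : Type u} [Field k] (P : LinearOperad k) (A : Type u) [AddCommGroup A] [Module k A]
  [P.Algebra A]

/-- `δ` is a derivation of the `P`-algebra `A`:
`δ(p(a₁, …, aᵣ)) = ∑ i, p(a₁, …, δ aᵢ, …, aᵣ)` for all `p ∈ P([r])`. -/
def IsDerivation (δ : Module.End k A) : Prop :=
  ∀ (r : ℕ) (p : P.obj (Fin r)) (a : Fin r → A),
    δ (Algebra.act p a) = ∑ i, Algebra.act p (Function.update a i (δ (a i)))

theorem isDerivation_iff (δ : Module.End k A) : P.IsDerivation A δ ↔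
    ∀ (r : ℕ) (p : P.obj (Fin r)) (a : Fin r → A),
      δ (Algebra.act p a) = leibniz LinearMap.id δ (Algebra.act p) a := by
  simp [IsDerivation, leibniz_apply]

/-- The Lie algebra of all derivations of a `P`-algebra, under the commutator bracket. -/
def derivations : LieSubalgebra k (Module.End k A) where
  carrier := {δ | P.IsDerivation A δ}
  zero_mem' := by
    intro r p a
    simp
  add_mem' := by
    intro δ ε hδ hε r p a
    simp [hδ r p a, hε r p a, Finset.sum_add_distrib]
  smul_mem' := by
    intro c δ hδ r p a
    simp [hδ r p a, Finset.smul_sum]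
  lie_mem' := by
    intro δ ε hδ hε
    have hδ' := (P.isDerivation_iff A δ).1 hδ
    have hε' := (P.isDerivation_iff A ε).1 hε
    refine (P.isDerivation_iff A _).2 fun r p a => ?_
    rw [leibniz_bracket, LieRing.of_associative_ring_bracket, LinearMap.sub_apply,
      Module.End.mul_apply, Module.End.mul_apply, sub_apply, hδ r p a, hε r p a,
      map_sum, map_sum, leibniz_apply, leibniz_apply]
    simp only [hδ', hε', LinearMap.id_apply]
end Derivations
section Descend

variable {k : Type*} [Field k]

/-- Extension of a function on families of generators to a multilinear map. -/
theorem exists_multilinear_extension {S : Type*} [Finite S] [DecidableEq S] {G A : S → Type*}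
    {B : Type*}
    [∀ s, AddCommGroup (A s)] [∀ s, Module k (A s)] [AddCommGroup B] [Module k B]
    (π : ∀ s, G s → A s) (hπ : ∀ s, Submodule.span k (Set.range (π s)) = ⊤)
    (Φ : (∀ s, G s) → B)
    (hΦ : ∀ (s : S) (g : ∀ s, G s), ∃ L : A s →ₗ[k] B, ∀ x : G s,
      L (π s x) = Φ (Function.update g s x)) :
    ∃ F : MultilinearMap k A B, ∀ g, F (fun s => π s (g s)) = Φ g := by
  classical
  have := Fintype.ofFinite S
  have hb : ∀ s, ∃ (J : Type _) (j : J → G s) (b : Module.Basis J k (A s)),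
      ∀ i, b i = π s (j i) := by
    intro s
    obtain ⟨c, hc, hsp, hli⟩ := exists_linearIndependent k (Set.range (π s))
    choose j hj using fun i : c => hc i.2
    refine ⟨c, j, Module.Basis.mk hli ?_, fun i => ?_⟩
    · rw [Subtype.range_coe, hsp, hπ]
    · rw [Module.Basis.mk_apply, hj]
  choose J j b hb using hb
  let F : MultilinearMap k A B :=
    (MultilinearMap.fromDirectSumEquiv (R := k) (ι := S) (κ := J) (M := fun _ _ => k)
      (fun t => MultilinearMap.mkPiRing k S (Φ fun s => j s (t s)))).compLinearMap
      (fun s => (finsuppLEquivDirectSum k k (J s)).toLinearMap ∘ₗ (b s).repr.toLinearMap)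
  have hF : ∀ t : ∀ s, J s, F (fun s => π s (j s (t s))) = Φ fun s => j s (t s) := by
    intro t
    have h1 : (fun s => ((finsuppLEquivDirectSum k k (J s)).toLinearMap ∘ₗ
        (b s).repr.toLinearMap) (π s (j s (t s)))) =
        fun s => DirectSum.lof k (J s) (fun _ => k) (t s) 1 := by
      funext s
      rw [← hb]
      simp
    simp only [F, MultilinearMap.compLinearMap_apply]
    rw [h1, MultilinearMap.fromDirectSumEquiv_lof]
    simp
  have main : ∀ T : Set S, T.Finite → ∀ g : ∀ s, G s, (∀ s, s ∉ T → g s ∈ Set.range (j s)) →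
      F (fun s => π s (g s)) = Φ g := by
    intro T hT
    induction T, hT using Set.Finite.induction_on with
    | empty =>
      intro g hg
      choose t ht using fun s => hg s (by simp)
      have : g = fun s => j s (t s) := funext fun s => (ht s).symm
      rw [this]
      exact hF t
    | @insert s T hs _ ih =>
      intro g hg
      obtain ⟨L, hL⟩ := hΦ s g
      have e : ∀ x : G s, (fun s' => π s' (Function.update g s x s')) =
          Function.update (fun s' => π s' (g s')) s (π s x) := by
        intro x
        funext s'
        by_cases h : s' = s
        · subst h; simp
        · simp [Function.update_of_ne h]
      have h2 : L = F.toLinearMap (fun s' => π s' (g s')) s := by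
        refine (b s).ext fun i => ?_
        rw [hb, hL, MultilinearMap.toLinearMap_apply, ← e]
        refine (ih _ fun s' hs' => ?_).symm
        by_cases h : s' = s
        · subst h; simp
        · rw [Function.update_of_ne h]
          exact hg s' (by simp [h, hs'])
      have h3 := hL (g s)
      rw [h2, MultilinearMap.toLinearMap_apply, ← e, Function.update_eq_self] at h3
      exact h3
  exact ⟨F, fun g => main Set.univ Set.finite_univ g (by simp)⟩

/-- Two multilinear maps that agree on spanning families are equal. -/
theorem multilinear_ext {S : Type*} [Finite S] {G A : S → Type*} {B : Type*}
    [∀ s, AddCommGroup (A s)] [∀ s, Module k (A s)] [AddCommGroup B] [Module k B]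
    (π : ∀ s, G s → A s) (hπ : ∀ s, Submodule.span k (Set.range (π s)) = ⊤)
    (F F' : MultilinearMap k A B)
    (h : ∀ g : ∀ s, G s, F (fun s => π s (g s)) = F' (fun s => π s (g s))) : F = F' := by
  classical
  have hb : ∀ s, ∃ (J : Type _) (j : J → G s) (b : Module.Basis J k (A s)),
      ∀ i, b i = π s (j i) := by
    intro s
    obtain ⟨c, hc, hsp, hli⟩ := exists_linearIndependent k (Set.range (π s))
    choose j hj using fun i : c => hc i.2
    refine ⟨c, j, Module.Basis.mk hli ?_, fun i => ?_⟩
    · rw [Subtype.range_coe, hsp, hπ]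
    · rw [Module.Basis.mk_apply, hj]
  choose J j b hb using hb
  refine Module.Basis.ext_multilinear b fun t => ?_
  simp only [hb]
  exact h fun s => j s (t s)

end Descend

section Free
variable {k : Type u} [Field k] (P : LinearOperad k) (U : Type u) [AddCommGroup U] [Module k U]

/-- The relations `p·σ ⊗ v = p ⊗ σ·v` that define the tensor product over `k[𝔖_r]`. -/
def coinvariantRel (r : ℕ) : Submodule k (P.obj (Fin r) ⊗[k] (⨂[k] _ : Fin r, U)) :=
  Submodule.span k {x | ∃ (σ : Equiv.Perm (Fin r)) (p : P.obj (Fin r)) (v : Fin r → U),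
    x = P.map σ p ⊗ₜ[k] PiTensorProduct.tprod k v -
      p ⊗ₜ[k] PiTensorProduct.tprod k fun i => v (σ i)}

/-- `P([r]) ⊗_{k[𝔖_r]} U^{⊗ r}`. -/
abbrev FreeComponent (r : ℕ) : Type u :=
  (P.obj (Fin r) ⊗[k] (⨂[k] _ : Fin r, U)) ⧸ P.coinvariantRel U r

/-- The free `P`-algebra `P{U} = ⨁_r P([r]) ⊗_{k[𝔖_r]} U^{⊗ r}` on a vector space `U`. -/
def Free : Type u := ⨁ r : ℕ, P.FreeComponent U r

noncomputable instance : AddCommGroup (P.Free U) :=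
  inferInstanceAs (AddCommGroup (⨁ r : ℕ, P.FreeComponent U r))

noncomputable instance : Module k (P.Free U) :=
  inferInstanceAs (Module k (⨁ r : ℕ, P.FreeComponent U r))

namespace Free
variable {P U}

/-- The underlying vector space of the free algebra. -/
noncomputable def toDirectSum : P.Free U ≃ₗ[k] ⨁ r : ℕ, P.FreeComponent U r :=
  LinearEquiv.refl k _

/-- The inclusion of the degree `r` component. -/
noncomputable def component (r : ℕ) : P.FreeComponent U r →ₗ[k] P.Free U :=
  DirectSum.lof k ℕ (fun r => P.FreeComponent U r) r

/-- The class of `p ⊗ (v₁ ⊗ ⋯ ⊗ vᵣ)`. -/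
noncomputable def cls (r : ℕ) :
    P.obj (Fin r) →ₗ[k] MultilinearMap k (fun _ : Fin r => U) (P.FreeComponent U r) where
  toFun p := ((P.coinvariantRel U r).mkQ ∘ₗ TensorProduct.mk k (P.obj (Fin r))
    (⨂[k] _ : Fin r, U) p).compMultilinearMap (PiTensorProduct.tprod k)
  map_add' p q := by ext v; simp
  map_smul' c p := by ext v; exact congrArg (P.coinvariantRel U r).mkQ (TensorProduct.smul_tmul' c p _).symm

theorem cls_apply (r : ℕ) (p : P.obj (Fin r)) (v : Fin r → U) : cls r p v =
    (P.coinvariantRel U r).mkQ (p ⊗ₜ[k] PiTensorProduct.tprod k v) := rfl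

theorem cls_map (r : ℕ) (σ : Equiv.Perm (Fin r)) (p : P.obj (Fin r)) (v : Fin r → U) :
    cls r (P.map σ p) v = cls r p fun i => v (σ i) := by
  rw [cls_apply, cls_apply, ← sub_eq_zero, ← map_sub, Submodule.mkQ_apply,
    Submodule.Quotient.mk_eq_zero]
  exact Submodule.subset_span ⟨σ, p, v, rfl⟩

/-- The monomial `p(v)` for an operation `p` with finite set of inputs `S`. -/
noncomputable def mk {S : Type} [Finite S] :
    P.obj S →ₗ[k] MultilinearMap k (fun _ : S => U) (P.Free U) where
  toFun p := (component (Nat.card S)).compMultilinearMap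
    ((cls (Nat.card S) (P.map (Finite.equivFin S) p)).domDomCongr (Finite.equivFin S).symm)
  map_add' p q := by ext v; simp
  map_smul' c p := by ext v; simp

theorem mk_eq {S : Type} [Finite S] {r : ℕ} (e : S ≃ Fin r) (p : P.obj S) (v : S → U) :
    mk p v = component r (cls r (P.map e p) fun i => v (e.symm i)) := by
  obtain rfl : r = Nat.card S := by rw [Nat.card_congr e, Nat.card_eq_fintype_card, Fintype.card_fin]
  change component (Nat.card S) (cls (Nat.card S) (P.map (Finite.equivFin S) p)
    fun i => v ((Finite.equivFin S).symm i)) = _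
  congr 1
  have h : (Finite.equivFin S) = e.trans (e.symm.trans (Finite.equivFin S)) := by ext; simp
  conv_lhs => rw [h, P.map_trans]
  rw [cls_map]
  simp

theorem mk_fin {r : ℕ} (p : P.obj (Fin r)) (v : Fin r → U) : mk p v = component r (cls r p v) := by
  rw [mk_eq (Equiv.refl _), P.map_refl]
  rfl

theorem mk_map {S T : Type} [Finite S] [Finite T] (e : S ≃ T) (p : P.obj S) (v : T → U) :
    mk (P.map e p) v = mk p fun s => v (e s) := by
  rw [mk_eq (Finite.equivFin T), mk_eq (e.trans (Finite.equivFin T)), P.map_trans]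
  simp

section lift
variable {B : Type*} [AddCommGroup B] [Module k B]

/-- Linear maps out of `P([r]) ⊗_{k[𝔖_r]} U^{⊗ r}`. -/
noncomputable def componentLift (r : ℕ) (φ : P.obj (Fin r) →ₗ[k] MultilinearMap k (fun _ : Fin r => U) B)
    (hφ : ∀ (σ : Equiv.Perm (Fin r)) (p : P.obj (Fin r)) (v : Fin r → U),
      φ (P.map σ p) v = φ p fun i => v (σ i)) : P.FreeComponent U r →ₗ[k] B :=
  (P.coinvariantRel U r).liftQ
    (TensorProduct.lift ((PiTensorProduct.lift (R := k)).toLinearMap ∘ₗ φ)) (by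
      rw [coinvariantRel, Submodule.span_le]
      rintro _ ⟨σ, p, v, rfl⟩
      simp [hφ])

theorem componentLift_cls (r : ℕ)
    (φ : P.obj (Fin r) →ₗ[k] MultilinearMap k (fun _ : Fin r => U) B)
    (hφ : ∀ (σ : Equiv.Perm (Fin r)) (p : P.obj (Fin r)) (v : Fin r → U),
      φ (P.map σ p) v = φ p fun i => v (σ i)) (p : P.obj (Fin r)) (v : Fin r → U) :
    componentLift r φ hφ (cls r p v) = φ p v := by
  rw [cls_apply, componentLift, Submodule.mkQ_apply, Submodule.liftQ_apply]
  simp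

/-- Linear maps out of the free algebra, defined on monomials `p(v₁, …, vᵣ)`. -/
noncomputable def lift (φ : ∀ r, P.obj (Fin r) →ₗ[k] MultilinearMap k (fun _ : Fin r => U) B)
    (hφ : ∀ r (σ : Equiv.Perm (Fin r)) (p : P.obj (Fin r)) (v : Fin r → U),
      φ r (P.map σ p) v = φ r p fun i => v (σ i)) : P.Free U →ₗ[k] B :=
  DirectSum.toModule k ℕ B fun r => componentLift r (φ r) (hφ r)

theorem lift_component (φ : ∀ r, P.obj (Fin r) →ₗ[k] MultilinearMap k (fun _ : Fin r => U) B)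
    (hφ : ∀ r (σ : Equiv.Perm (Fin r)) (p : P.obj (Fin r)) (v : Fin r → U),
      φ r (P.map σ p) v = φ r p fun i => v (σ i)) (r : ℕ) (x : P.FreeComponent U r) :
    lift φ hφ (component r x) = componentLift r (φ r) (hφ r) x :=
  DirectSum.toModule_lof k r x

theorem lift_mk_fin (φ : ∀ r, P.obj (Fin r) →ₗ[k] MultilinearMap k (fun _ : Fin r => U) B)
    (hφ : ∀ r (σ : Equiv.Perm (Fin r)) (p : P.obj (Fin r)) (v : Fin r → U),
      φ r (P.map σ p) v = φ r p fun i => v (σ i)) {r : ℕ} (p : P.obj (Fin r)) (v : Fin r → U) :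
    lift φ hφ (mk p v) = φ r p v := by
  rw [mk_fin, lift_component, componentLift_cls]

end lift

theorem span_cls (r : ℕ) : Submodule.span k
    (Set.range fun x : P.obj (Fin r) × (Fin r → U) => cls r x.1 x.2) = ⊤ := by
  have h1 : Submodule.span k {t | ∃ (p : P.obj (Fin r)) (y : ⨂[k] _ : Fin r, U), p ⊗ₜ[k] y = t} = ⊤ :=
    TensorProduct.span_tmul_eq_top k _ _
  rw [eq_top_iff, ← Submodule.range_mkQ (P.coinvariantRel U r), LinearMap.range_eq_map, ← h1,
    Submodule.map_span, Submodule.span_le]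
  rintro _ ⟨_, ⟨p, y, rfl⟩, rfl⟩
  have hy : y ∈ Submodule.span k (Set.range (PiTensorProduct.tprod k (s := fun _ : Fin r => U))) := by
    rw [PiTensorProduct.span_tprod_eq_top]; trivial
  induction hy using Submodule.span_induction with
  | mem x hx => obtain ⟨v, rfl⟩ := hx; exact Submodule.subset_span ⟨(p, v), rfl⟩
  | zero => simp
  | add x y _ _ hx hy =>
    rw [TensorProduct.tmul_add, map_add]
    exact Submodule.add_mem _ hx hy
  | smul c x _ hx =>
    rw [TensorProduct.tmul_smul, map_smul]
    exact Submodule.smul_mem _ c hx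

theorem span_mk : Submodule.span k
    (Set.range fun x : Σ r, P.obj (Fin r) × (Fin r → U) => (mk x.2.1 x.2.2 : P.Free U)) = ⊤ := by
  rw [eq_top_iff]
  rintro x -
  induction x using DirectSum.induction_on with
  | zero => exact Submodule.zero_mem _
  | add x y hx hy => exact Submodule.add_mem _ hx hy
  | of r x =>
    change component r x ∈ _
    have hx : x ∈ Submodule.span k
      (Set.range fun x : P.obj (Fin r) × (Fin r → U) => cls r x.1 x.2) := by
      rw [span_cls]; trivial
    have := Submodule.mem_map_of_mem (f := component r) hx
    rw [Submodule.map_span] at this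
    refine Submodule.span_mono ?_ this
    rintro _ ⟨_, ⟨⟨p, v⟩, rfl⟩, rfl⟩
    exact ⟨⟨r, p, v⟩, mk_fin p v⟩

theorem hom_ext {B : Type*} [AddCommGroup B] [Module k B] {f g : P.Free U →ₗ[k] B}
    (h : ∀ (r : ℕ) (p : P.obj (Fin r)) (v : Fin r → U), f (mk p v) = g (mk p v)) : f = g := by
  refine LinearMap.ext_on_range span_mk fun x => h _ _ _

theorem update_uncurry {U : Type*} {S : Type} [DecidableEq S] {T : S → Type} [∀ s, DecidableEq (T s)]
    (v : ∀ s, T s → U) (s : S) (w : T s → U) (t : T s) (a : U) :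
    (fun st : Σ s, T s => Function.update v s (Function.update w t a) st.1 st.2) =
      Function.update (fun st : Σ s, T s => Function.update v s w st.1 st.2) ⟨s, t⟩ a := by
  funext ⟨s', t'⟩
  by_cases h : s' = s
  · subst h
    by_cases h' : t' = t
    · subst h'; simp
    · simp [h']
  · simp [h]

/-- The part of a monomial that depends on one block of its arguments. -/
noncomputable def mkBlock {S : Type} [Finite S] [DecidableEq S] {T : S → Type}
    [∀ s, Finite (T s)] [∀ s, DecidableEq (T s)] (p : P.obj S) (q : ∀ s, P.obj (T s))
    (v : ∀ s, T s → U) (s : S) :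
    P.obj (T s) →ₗ[k] MultilinearMap k (fun _ : T s => U) (P.Free U) where
  toFun x :=
    { toFun := fun w => mk (P.comp p (Function.update q s x))
        fun st => Function.update v s w st.1 st.2
      map_update_add' := by
        intro inst w t a b
        obtain rfl : inst = fun a b => ‹∀ s, DecidableEq (T s)› s a b := Subsingleton.elim _ _
        simp only [update_uncurry, MultilinearMap.map_update_add]
      map_update_smul' := by
        intro inst w t c a
        obtain rfl : inst = fun a b => ‹∀ s, DecidableEq (T s)› s a b := Subsingleton.elim _ _
        simp only [update_uncurry, MultilinearMap.map_update_smul] }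
  map_add' x y := by
    ext w
    simp
  map_smul' c x := by
    ext w
    simp
theorem exists_act {S : Type} [Finite S] (p : P.obj S) :
    ∃ F : MultilinearMap k (fun _ : S => P.Free U) (P.Free U),
      ∀ (ρ : S → ℕ) (q : ∀ s, P.obj (Fin (ρ s))) (v : ∀ s, Fin (ρ s) → U),
        F (fun s => mk (q s) (v s)) = mk (P.comp p q) fun st => v st.1 st.2 := by
  classical
  have h : ∀ ρ : S → ℕ, ∃ F : MultilinearMap k (fun s => P.FreeComponent U (ρ s)) (P.Free U),
      ∀ g : ∀ s, P.obj (Fin (ρ s)) × (Fin (ρ s) → U),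
        F (fun s => cls (ρ s) (g s).1 (g s).2) =
          mk (P.comp p fun s => (g s).1) fun st => (g st.1).2 st.2 := by
    intro ρ
    refine exists_multilinear_extension
      (G := fun s => P.obj (Fin (ρ s)) × (Fin (ρ s) → U))
      (fun s x => cls (ρ s) x.1 x.2) (fun s => span_cls _)
      (fun g => mk (P.comp p fun s => (g s).1) fun st => (g st.1).2 st.2) ?_
    intro s g
    let φ := mkBlock p (fun s => (g s).1) (fun s => (g s).2) s
    have hφ : ∀ (σ : Equiv.Perm (Fin (ρ s))) (q : P.obj (Fin (ρ s))) (v : Fin (ρ s) → U),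
        φ (P.map σ q) v = φ q fun i => v (σ i) := by
      intro σ q v
      let f : ∀ s, Fin (ρ s) ≃ Fin (ρ s) := Function.update (fun _ => Equiv.refl _) s σ
      have h1 : Function.update (fun s => (g s).1) s (P.map σ q) =
          fun s' => P.map (f s') (Function.update (fun s => (g s).1) s q s') := by
        funext s'
        by_cases h : s' = s
        · subst h; simp [f]
        · simp [f, Function.update_of_ne h, P.map_refl]
      change mk (P.comp p (Function.update (fun s => (g s).1) s (P.map σ q))) _ =
        mk (P.comp p (Function.update (fun s => (g s).1) s q)) _
      rw [h1, P.comp_map_right, mk_map]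
      congr 1
      funext ⟨s', t⟩
      by_cases h : s' = s
      · subst h; simp [f, Equiv.sigmaCongrRight]
      · simp [f, Equiv.sigmaCongrRight, Function.update_of_ne h]
    refine ⟨componentLift _ φ hφ, fun x => ?_⟩
    rw [componentLift_cls]
    change mk (P.comp p (Function.update (fun s => (g s).1) s x.1)) _ = _
    congr 1
    · congr 2
      funext s'
      by_cases h : s' = s
      · subst h; simp
      · simp [Function.update_of_ne h]
    · funext ⟨s', t⟩
      by_cases h : s' = s
      · subst h; simp
      · simp [Function.update_of_ne h]
  choose F hF using h
  let D : MultilinearMap k (fun _ : S => ⨁ r : ℕ, P.FreeComponent U r) (P.Free U) :=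
    MultilinearMap.fromDirectSumEquiv (R := k) (ι := S) (κ := fun _ => ℕ)
      (M := fun _ r => P.FreeComponent U r) F
  refine ⟨D.compLinearMap fun _ => toDirectSum.toLinearMap, fun ρ q v => ?_⟩
  rw [← hF ρ fun s => (q s, v s)]
  refine Eq.trans (congrArg D ?_) (MultilinearMap.fromDirectSumEquiv_lof (R := k) F ρ
    fun s => cls (ρ s) (q s) (v s))
  funext s
  exact congrArg toDirectSum (mk_fin (q s) (v s))

theorem multilinear_hom_ext {S : Type} [Finite S] {B : Type*} [AddCommGroup B] [Module k B]
    {F F' : MultilinearMap k (fun _ : S => P.Free U) B}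
    (h : ∀ (ρ : S → ℕ) (q : ∀ s, P.obj (Fin (ρ s))) (v : ∀ s, Fin (ρ s) → U),
      F (fun s => mk (q s) (v s)) = F' fun s => mk (q s) (v s)) : F = F' :=
  multilinear_ext (G := fun _ => Σ r, P.obj (Fin r) × (Fin r → U))
    (fun _ x => mk x.2.1 x.2.2) (fun _ => span_mk) F F'
    fun g => h (fun s => (g s).1) (fun s => (g s).2.1) fun s => (g s).2.2

/-- The action of an operation `p` on the free algebra: the unique multilinear operation with
`p(q_s(v_s))_s = (p ∘ (q_s)_s)(v)`, see `act_mk`. -/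
noncomputable def act {S : Type} [Finite S] :
    P.obj S →ₗ[k] MultilinearMap k (fun _ : S => P.Free U) (P.Free U) where
  toFun p := (exists_act p).choose
  map_add' p q := multilinear_hom_ext fun ρ x v => by
    rw [(exists_act (p + q)).choose_spec, add_apply, (exists_act p).choose_spec,
      (exists_act q).choose_spec, map_add, add_apply, map_add, add_apply]
  map_smul' c p := multilinear_hom_ext fun ρ x v => by
    rw [(exists_act (c • p)).choose_spec, RingHom.id_apply, smul_apply,
      (exists_act p).choose_spec, map_smul, smul_apply, map_smul,
      smul_apply]

theorem act_mk_fin {S : Type} [Finite S] (p : P.obj S) (ρ : S → ℕ)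
    (q : ∀ s, P.obj (Fin (ρ s))) (v : ∀ s, Fin (ρ s) → U) :
    act p (fun s => mk (q s) (v s)) = mk (P.comp p q) fun st => v st.1 st.2 :=
  (exists_act p).choose_spec ρ q v

theorem act_mk {S : Type} [Finite S] {T : S → Type} [∀ s, Finite (T s)] (p : P.obj S)
    (q : ∀ s, P.obj (T s)) (v : (Σ s, T s) → U) :
    act p (fun s => mk (q s) fun t => v ⟨s, t⟩) = mk (P.comp p q) v := by
  have h : ∀ s, (mk (q s) fun t => v ⟨s, t⟩ : P.Free U) =
      mk (P.map (Finite.equivFin (T s)) (q s)) fun i => v ⟨s, (Finite.equivFin (T s)).symm i⟩ := by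
    intro s
    rw [mk_map]
    simp
  simp only [h]
  rw [act_mk_fin p (fun s => Nat.card (T s))
    (fun s => P.map (Finite.equivFin (T s)) (q s))
    (fun s i => v ⟨s, (Finite.equivFin (T s)).symm i⟩), P.comp_map_right, mk_map]
  congr 1
  funext ⟨s, t⟩
  exact congrArg (fun t => v ⟨s, t⟩) ((Finite.equivFin (T s)).symm_apply_apply t)

/-- The free algebra is an algebra over the operad. -/
noncomputable instance : P.Algebra (P.Free U) where
  act := Free.act
  act_map {S T} _ _ e p a := by
    have : Free.act (U := U) (P.map e p) = (Free.act p).domDomCongr e :=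
      multilinear_hom_ext fun ρ q v => by
        rw [act_mk_fin, MultilinearMap.domDomCongr_apply, P.comp_map_left, mk_map,
          act_mk_fin p (fun s => ρ (e s)) (fun s => q (e s)) fun s => v (e s)]
        rfl
    rw [this]
    rfl
  act_one a := by
    have : Free.act P.one = (MultilinearMap.ofSubsingleton k (P.Free U) (P.Free U) ())
        LinearMap.id :=
      multilinear_hom_ext fun ρ q v => by
        rw [act_mk_fin]
        change _ = mk (q ()) (v ())
        rw [← P.one_comp (q ()), mk_map]
        rfl
    rw [this]
    simp
  act_comp {S} _ {T} _ p q a := by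
    have : Free.act (U := U) (P.comp p q) =
        (Free.act p).compMultilinearMap fun s => Free.act (q s) :=
      multilinear_hom_ext fun ρ x v => by
        rw [act_mk_fin]
        change _ = Free.act p fun s => Free.act (q s) fun t => mk (x ⟨s, t⟩) (v ⟨s, t⟩)
        have h : ∀ s, (Free.act (q s) fun t => mk (x ⟨s, t⟩) (v ⟨s, t⟩)) =
            mk (P.comp (q s) fun t => x ⟨s, t⟩) fun tu => v ⟨s, tu.1⟩ tu.2 := fun s =>
          act_mk_fin (q s) (fun t => ρ ⟨s, t⟩) (fun t => x ⟨s, t⟩) fun t => v ⟨s, t⟩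
        simp only [h]
        rw [act_mk p (fun s => P.comp (q s) fun t => x ⟨s, t⟩)
          (fun stu : Σ s, Σ t, Fin (ρ ⟨s, t⟩) => v ⟨stu.1, stu.2.1⟩ stu.2.2),
          ← P.comp_assoc p q fun s t => x ⟨s, t⟩, mk_map]
        rfl
    rw [this]
    rfl

/-- The natural map `U → P{U}`, given by the identity operation. -/
noncomputable def ι : U →ₗ[k] P.Free U where
  toFun u := mk P.one fun _ => u
  map_add' u v := by
    have := (mk (U := U) P.one).map_update_add (fun _ => 0) () u v
    simp only [Function.update_eq_const_of_subsingleton] at this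
    exact this
  map_smul' c u := by
    have := (mk (U := U) P.one).map_update_smul (fun _ => 0) () c u
    simp only [Function.update_eq_const_of_subsingleton] at this
    exact this

theorem act_ι {S : Type} [Finite S] (p : P.obj S) (v : S → U) :
    Algebra.act p (fun s => (ι (v s) : P.Free U)) = mk p v := by
  change Free.act p (fun s => mk P.one fun _ => v s) = _
  rw [act_mk p (fun _ => P.one) fun st => v st.1]
  conv_rhs => rw [← P.comp_one p, mk_map]
  rfl

/-- `p(v₁, …, vᵣ) ↦ p(f v₁, …, f vᵣ)`. -/
noncomputable def monomialMap {U' : Type u} [AddCommGroup U'] [Module k U'] (f : U →ₗ[k] U')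
    (r : ℕ) : P.obj (Fin r) →ₗ[k] MultilinearMap k (fun _ : Fin r => U) (P.Free U') where
  toFun p := (mk p).compLinearMap fun _ => f
  map_add' p q := by rw [map_add]; rfl
  map_smul' c p := by rw [map_smul]; rfl

theorem monomialMap_apply {U' : Type u} [AddCommGroup U'] [Module k U'] (f : U →ₗ[k] U')
    {r : ℕ} (p : P.obj (Fin r)) (v : Fin r → U) :
    monomialMap f r p v = mk p fun i => f (v i) := rfl

/-- The map `P{U} → P{B}` induced by a linear map `U → B`. -/
noncomputable def map {U' : Type u} [AddCommGroup U'] [Module k U'] (f : U →ₗ[k] U') :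
    P.Free U →ₗ[k] P.Free U' :=
  lift (monomialMap f) fun r σ p v => by
    rw [monomialMap_apply, monomialMap_apply, mk_map]

theorem map_mk {U' : Type u} [AddCommGroup U'] [Module k U'] (f : U →ₗ[k] U') {S : Type}
    [Finite S] (p : P.obj S) (v : S → U) : map f (mk p v) = mk p fun s => f (v s) := by
  have h : mk p v = mk (P.map (Finite.equivFin S) p) fun i => v ((Finite.equivFin S).symm i) := by
    rw [mk_map]; simp
  rw [h, map, lift_mk_fin, monomialMap_apply, mk_map]
  simp

theorem map_ι {U' : Type u} [AddCommGroup U'] [Module k U'] (f : U →ₗ[k] U') (u : U) :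
    map f (ι u : P.Free U) = ι (f u) := map_mk f _ _

theorem map_act {U' : Type u} [AddCommGroup U'] [Module k U'] (f : U →ₗ[k] U') {S : Type}
    [Finite S] (p : P.obj S) (a : S → P.Free U) :
    map f (Algebra.act p a) = Algebra.act p fun s => map f (a s) := by
  have : (map f).compMultilinearMap (Free.act p) =
      (Free.act p).compLinearMap fun _ => map f :=
    multilinear_hom_ext fun ρ q v => by
      rw [LinearMap.compMultilinearMap_apply, act_mk_fin, map_mk,
        MultilinearMap.compLinearMap_apply]
      simp only [map_mk]
      rw [act_mk_fin]
  exact DFunLike.congr_fun this a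

/-- The derivation of `P{U}` that extends a linear map `U → P{U}`. -/
noncomputable def derivFun (f : U →ₗ[k] P.Free U) : Module.End k (P.Free U) :=
  lift (fun r =>
    { toFun := fun p => leibniz ι f (Algebra.act p)
      map_add' := fun p q => by ext; simp [leibniz_apply, Finset.sum_add_distrib]
      map_smul' := fun c p => by ext; simp [leibniz_apply, Finset.smul_sum] })
    fun r σ p v => by
      change leibniz ι f (Algebra.act (P.map σ p)) v = leibniz ι f (Algebra.act p) fun i => v (σ i)
      rw [leibniz_apply, leibniz_apply, ← Equiv.sum_comp σ]
      refine Finset.sum_congr rfl fun i _ => ?_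
      rw [Algebra.act_map]
      congr 1
      funext j
      by_cases h : j = i
      · subst h; simp
      · have : σ j ≠ σ i := fun h' => h (σ.injective h')
        simp [Function.update_of_ne h, Function.update_of_ne this]

theorem derivFun_mk (f : U →ₗ[k] P.Free U) {S : Type} [Fintype S] [DecidableEq S]
    (p : P.obj S) (v : S → U) : derivFun f (mk p v) =
      ∑ s, Algebra.act p (Function.update (fun t => (ι (v t) : P.Free U)) s (f (v s))) := by
  have e := Fintype.equivFin S
  have h : mk p v = mk (P.map e p) fun i => v (e.symm i) := by
    rw [mk_map]; simp
  rw [h, derivFun, lift_mk_fin]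
  change leibniz ι f (Algebra.act (P.map e p)) _ = _
  rw [leibniz_apply, ← Equiv.sum_comp e]
  refine Finset.sum_congr rfl fun i _ => ?_
  rw [Algebra.act_map]
  congr 1
  funext j
  by_cases h : j = i
  · subst h; simp
  · have : e j ≠ e i := fun h' => h (e.injective h')
    simp [Function.update_of_ne h, Function.update_of_ne this]

theorem derivFun_ι (f : U →ₗ[k] P.Free U) (u : U) : derivFun f (ι u) = f u := by
  change derivFun f (mk P.one fun _ => u) = _
  rw [derivFun_mk]
  simp [Algebra.act_one]

theorem isDerivation_derivFun (f : U →ₗ[k] P.Free U) :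
    P.IsDerivation (P.Free U) (derivFun f) := by
  rw [isDerivation_iff]
  intro r p a
  have : (derivFun f).compMultilinearMap (Algebra.act p) =
      leibniz LinearMap.id (derivFun f) (Algebra.act (A := P.Free U) p) :=
    multilinear_hom_ext fun ρ q v => by
      rw [LinearMap.compMultilinearMap_apply, leibniz_apply]
      change derivFun f (Free.act p _) = _
      rw [act_mk_fin, derivFun_mk, Fintype.sum_sigma]
      refine Finset.sum_congr rfl fun s _ => ?_
      rw [derivFun_mk, MultilinearMap.map_update_sum]
      refine Finset.sum_congr rfl fun t _ => ?_
      rw [Algebra.act_comp]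
      congr 1
      funext s'
      by_cases h : s' = s
      · subst h
        rw [Function.update_self]
        congr 1
        funext t'
        by_cases h' : t' = t
        · subst h'; simp
        · rw [Function.update_of_ne h', Function.update_of_ne (by simpa using h')]
      · rw [Function.update_of_ne h, LinearMap.id_apply, ← act_ι]
        congr 1
        funext t'
        rw [Function.update_of_ne (by simp [h])]
  exact DFunLike.congr_fun this a

/-- A derivation is determined by generators. -/
theorem derivation_ext {δ ε : Module.End k (P.Free U)} (hδ : P.IsDerivation (P.Free U) δ)
    (hε : P.IsDerivation (P.Free U) ε) (h : ∀ u : U, δ (ι u) = ε (ι u)) : δ = ε := by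
  refine hom_ext fun r p v => ?_
  rw [← act_ι, hδ, hε]
  simp only [h]

end Free
end Free
section Tensor

variable (k : Type*) [Field k] (ι : Type*) [Fintype ι] [DecidableEq ι] {M M' : Type*}
  [AddCommGroup M] [Module k M] [AddCommGroup M'] [Module k M']

/-- The action of an endomorphism on a tensor power by the Leibniz rule:
`a₁ ⊗ ⋯ ⊗ aᵣ ↦ ∑ i, a₁ ⊗ ⋯ ⊗ f aᵢ ⊗ ⋯ ⊗ aᵣ`. -/
noncomputable def tensorEnd (f : Module.End k M) : Module.End k (⨂[k] _ : ι, M) :=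
  PiTensorProduct.lift (leibniz LinearMap.id f (PiTensorProduct.tprod k))

variable {k}

theorem tensorEnd_tprod (f : Module.End k M) (a : ι → M) :
    tensorEnd k ι f (PiTensorProduct.tprod k a) =
      ∑ i, PiTensorProduct.tprod k (Function.update a i (f (a i))) := by
  simp [tensorEnd, leibniz_apply]

theorem tensorEnd_add (f g : Module.End k M) :
    tensorEnd k ι (f + g) = tensorEnd k ι f + tensorEnd k ι g := by
  ext a
  simp [tensorEnd_tprod, Finset.sum_add_distrib]

theorem tensorEnd_smul (c : k) (f : Module.End k M) :
    tensorEnd k ι (c • f) = c • tensorEnd k ι f := by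
  ext a
  simp [tensorEnd_tprod, Finset.smul_sum]

theorem tensorEnd_lie (f g : Module.End k M) :
    tensorEnd k ι ⁅f, g⁆ = ⁅tensorEnd k ι f, tensorEnd k ι g⁆ := by
  ext a
  have h : ∀ f : Module.End k M, ∀ a : ι → M, tensorEnd k ι f (PiTensorProduct.tprod k a) =
      leibniz LinearMap.id f (PiTensorProduct.tprod k) a := fun f a => by simp [tensorEnd]
  rw [LinearMap.compMultilinearMap_apply, LinearMap.compMultilinearMap_apply, h, leibniz_bracket,
    LieRing.of_associative_ring_bracket, LinearMap.sub_apply, Module.End.mul_apply,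
    Module.End.mul_apply, sub_apply, tensorEnd_tprod, tensorEnd_tprod, map_sum, map_sum,
    leibniz_apply, leibniz_apply]
  simp only [h, LinearMap.id_apply]

theorem tensorEnd_map (f : M →ₗ[k] M') (a : Module.End k M) (b : Module.End k M')
    (h : ∀ m, f (a m) = b (f m)) (t : ⨂[k] _ : ι, M) :
    PiTensorProduct.map (fun _ => f) (tensorEnd k ι a t) =
      tensorEnd k ι b (PiTensorProduct.map (fun _ => f) t) := by
  have : PiTensorProduct.map (fun _ : ι => f) ∘ₗ tensorEnd k ι a =
      tensorEnd k ι b ∘ₗ PiTensorProduct.map (fun _ => f) := by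
    ext v
    simp only [LinearMap.compMultilinearMap_apply, LinearMap.comp_apply, tensorEnd_tprod,
      PiTensorProduct.map_tprod, map_sum]
    refine Finset.sum_congr rfl fun i _ => congrArg _ (funext fun j => ?_)
    by_cases hj : j = i
    · subst hj; simp [h]
    · simp [Function.update_of_ne hj]
  exact LinearMap.congr_fun this t

variable {ι}
variable {L : Type*} [LieRing L] [LieAlgebra k L] [LieRingModule L M] [LieModule k L M]
  [LieRingModule L M'] [LieModule k L M']

/-- Tensor powers of a representation of a Lie algebra. -/
noncomputable instance tensorLieRingModule : LieRingModule L (⨂[k] _ : ι, M) where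
  bracket x t := tensorEnd k ι (LieModule.toEnd k L M x) t
  add_lie x y t := by
    change tensorEnd k ι (LieModule.toEnd k L M (x + y)) t = _
    rw [map_add, tensorEnd_add]
    rfl
  lie_add x s t := map_add (tensorEnd k ι (LieModule.toEnd k L M x)) s t
  leibniz_lie x y t := by
    change tensorEnd k ι (LieModule.toEnd k L M x) (tensorEnd k ι (LieModule.toEnd k L M y) t) =
      tensorEnd k ι (LieModule.toEnd k L M ⁅x, y⁆) t +
        tensorEnd k ι (LieModule.toEnd k L M y) (tensorEnd k ι (LieModule.toEnd k L M x) t)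
    rw [LieHom.map_lie, tensorEnd_lie, LieRing.of_associative_ring_bracket]
    simp

theorem tensor_lie_def (x : L) (t : ⨂[k] _ : ι, M) :
    ⁅x, t⁆ = tensorEnd k ι (LieModule.toEnd k L M x) t := rfl

noncomputable instance tensorLieModule : LieModule k L (⨂[k] _ : ι, M) where
  smul_lie c x t := by
    rw [tensor_lie_def, map_smul, tensorEnd_smul]
    rfl
  lie_smul c x t := map_smul (tensorEnd k ι (LieModule.toEnd k L M x)) c t

end Tensor

section Schur

variable (k : Type*) [Field k] (μ : YoungDiagram)

/-- The permutations of the cells of `μ` that preserve every row. -/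
def rowPerms : Finset (Equiv.Perm μ.cells) :=
  Finset.univ.filter fun σ => ∀ c, (σ c).1.1 = c.1.1

/-- The permutations of the cells of `μ` that preserve every column. -/
def colPerms : Finset (Equiv.Perm μ.cells) :=
  Finset.univ.filter fun τ => ∀ c, (τ c).1.2 = c.1.2

variable (M : Type*) {M' : Type*} [AddCommGroup M] [Module k M] [AddCommGroup M'] [Module k M']

/-- The Young symmetrizer `∑ sgn(τ) σ τ` (`σ` in the row group, `τ` in the column group), acting on
the tensor power of `M` whose factors are indexed by the cells of `μ`. -/
noncomputable def youngSymmetrizer : Module.End k (⨂[k] _ : μ.cells, M) :=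
  ∑ σ ∈ rowPerms μ, ∑ τ ∈ colPerms μ, ((Equiv.Perm.sign τ : ℤ) : k) •
    ((PiTensorProduct.reindex k (fun _ => M) σ).toLinearMap ∘ₗ
      (PiTensorProduct.reindex k (fun _ => M) τ).toLinearMap)

/-- The Schur functor `S_μ(M)`: the image of the Young symmetrizer on the tensor power of `M`. -/
def Schur : Type _ := LinearMap.range (youngSymmetrizer k μ M)

noncomputable instance : AddCommGroup (Schur k μ M) :=
  inferInstanceAs (AddCommGroup (LinearMap.range (youngSymmetrizer k μ M)))

noncomputable instance : Module k (Schur k μ M) :=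
  inferInstanceAs (Module k (LinearMap.range (youngSymmetrizer k μ M)))

variable {M}

/-- The inclusion of the Schur functor into the tensor power. -/
noncomputable def Schur.incl : Schur k μ M →ₗ[k] ⨂[k] _ : μ.cells, M :=
  (LinearMap.range (youngSymmetrizer k μ M)).subtype

theorem Schur.incl_injective : Function.Injective (Schur.incl k μ (M := M)) :=
  Subtype.val_injective

theorem youngSymmetrizer_tprod (a : μ.cells → M) :
    youngSymmetrizer k μ M (PiTensorProduct.tprod k a) =
      ∑ σ ∈ rowPerms μ, ∑ τ ∈ colPerms μ, ((Equiv.Perm.sign τ : ℤ) : k) •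
        PiTensorProduct.tprod k fun c => a (τ.symm (σ.symm c)) := by
  simp only [youngSymmetrizer, LinearMap.sum_apply, LinearMap.smul_apply, LinearMap.comp_apply,
    LinearEquiv.coe_coe]
  refine Finset.sum_congr rfl fun σ _ => Finset.sum_congr rfl fun τ _ => ?_
  rw [PiTensorProduct.reindex_tprod, PiTensorProduct.reindex_tprod]

theorem map_youngSymmetrizer (f : M →ₗ[k] M') (t : ⨂[k] _ : μ.cells, M) :
    PiTensorProduct.map (fun _ => f) (youngSymmetrizer k μ M t) =
      youngSymmetrizer k μ M' (PiTensorProduct.map (fun _ => f) t) := by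
  have : PiTensorProduct.map (fun _ : μ.cells => f) ∘ₗ youngSymmetrizer k μ M =
      youngSymmetrizer k μ M' ∘ₗ PiTensorProduct.map (fun _ => f) := by
    ext v
    simp only [LinearMap.compMultilinearMap_apply, LinearMap.comp_apply, youngSymmetrizer_tprod,
      PiTensorProduct.map_tprod, map_sum, map_smul]
  exact LinearMap.congr_fun this t

theorem tensorEnd_youngSymmetrizer (f : Module.End k M) (t : ⨂[k] _ : μ.cells, M) :
    tensorEnd k μ.cells f (youngSymmetrizer k μ M t) =
      youngSymmetrizer k μ M (tensorEnd k μ.cells f t) := by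
  have : tensorEnd k μ.cells f ∘ₗ youngSymmetrizer k μ M =
      youngSymmetrizer k μ M ∘ₗ tensorEnd k μ.cells f := by
    ext v
    simp only [LinearMap.compMultilinearMap_apply, LinearMap.comp_apply, youngSymmetrizer_tprod,
      tensorEnd_tprod, map_sum, map_smul]
    conv_rhs => rw [Finset.sum_comm]
    refine Finset.sum_congr rfl fun σ _ => ?_
    conv_rhs => rw [Finset.sum_comm]
    refine Finset.sum_congr rfl fun τ _ => ?_
    rw [← Finset.smul_sum, ← Equiv.sum_comp (τ.trans σ)]
    congr 1
    refine Finset.sum_congr rfl fun c _ => congrArg (PiTensorProduct.tprod k) (funext fun d => ?_)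
    by_cases hd : d = σ (τ c)
    · subst hd
      have e1 : τ.symm (σ.symm (σ (τ c))) = c :=
        (congrArg τ.symm (σ.symm_apply_apply (τ c))).trans (τ.symm_apply_apply c)
      have e2 : (τ.trans σ) c = σ (τ c) := rfl
      rw [e1, e2, Function.update_self, Function.update_self]
      exact congrArg (fun c => f (v c)) e1
    · have : τ.symm (σ.symm d) ≠ c := fun h => hd (by rw [← h]; simp)
      simp [Function.update_of_ne this, hd]
  exact LinearMap.congr_fun this t

/-- The linear map `S_μ(f)` induced by a linear map `f`. -/
noncomputable def Schur.map (f : M →ₗ[k] M') : Schur k μ M →ₗ[k] Schur k μ M' :=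
  (PiTensorProduct.map fun _ => f).restrict (p := LinearMap.range (youngSymmetrizer k μ M))
    (q := LinearMap.range (youngSymmetrizer k μ M')) (by
    rintro _ ⟨t, rfl⟩
    exact ⟨PiTensorProduct.map (fun _ => f) t, (map_youngSymmetrizer k μ f t).symm⟩)

theorem Schur.incl_map (f : M →ₗ[k] M') (t : Schur k μ M) :
    Schur.incl k μ (Schur.map k μ f t) = PiTensorProduct.map (fun _ => f) (Schur.incl k μ t) := rfl

variable {k μ}
variable {L : Type*} [LieRing L] [LieAlgebra k L] [LieRingModule L M] [LieModule k L M]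

theorem lie_mem_range_youngSymmetrizer (x : L) {t : ⨂[k] _ : μ.cells, M}
    (ht : t ∈ LinearMap.range (youngSymmetrizer k μ M)) :
    ⁅x, t⁆ ∈ LinearMap.range (youngSymmetrizer k μ M) := by
  obtain ⟨s, rfl⟩ := ht
  exact ⟨⁅x, s⁆, (tensorEnd_youngSymmetrizer k μ _ s).symm⟩

/-- `S_μ(M)` as a subrepresentation of the tensor power of `M`. -/
noncomputable instance : LieRingModule L (Schur k μ M) where
  bracket x t := ⟨⁅x, Schur.incl k μ t⁆, lie_mem_range_youngSymmetrizer x t.2⟩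
  add_lie x y t := Subtype.ext (add_lie x y (Schur.incl k μ t))
  lie_add x s t := Subtype.ext (lie_add x (Schur.incl k μ s) (Schur.incl k μ t))
  leibniz_lie x y t := Subtype.ext (leibniz_lie x y (Schur.incl k μ t))

theorem Schur.incl_lie (x : L) (t : Schur k μ M) :
    Schur.incl k μ ⁅x, t⁆ = ⁅x, Schur.incl k μ t⁆ := rfl

noncomputable instance : LieModule k L (Schur k μ M) where
  smul_lie c x t := Subtype.ext (smul_lie c x (Schur.incl k μ t))
  lie_smul c x t := Subtype.ext (lie_smul c x (Schur.incl k μ t))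

theorem Schur.map_lie {L' : Type*} [LieRing L'] [LieAlgebra k L'] [LieRingModule L' M']
    [LieModule k L' M'] (f : M →ₗ[k] M') (x : L) (y : L') (h : ∀ m, f ⁅x, m⁆ = ⁅y, f m⁆)
    (t : Schur k μ M) : Schur.map k μ f ⁅x, t⁆ = ⁅y, Schur.map k μ f t⁆ :=
  Schur.incl_injective k μ (tensorEnd_map μ.cells f _ _ h _)

end Schur

section RepPol

variable (k : Type u) [Field k] (L : Type u) [LieRing L] [LieAlgebra k L]
  (V : Type u) [AddCommGroup V] [Module k V] [LieRingModule L V] [LieModule k L V]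

/-- `M` is a polynomial representation of `L` with respect to the standard representation `V`: it is
a subquotient of a (possibly infinite) direct sum of tensor powers of `V`. -/
def IsPolynomialRep (M : Type u) [AddCommGroup M] [Module k M] [LieRingModule L M]
    [LieModule k L M] : Prop :=
  ∃ (I : Type u) (d : I → ℕ) (A : LieSubmodule k L (⨁ i, ⨂[k] _ : Fin (d i), V))
    (π : A →ₗ⁅k, L⁆ M), Function.Surjective π

/-- `Q` is a projective object of the category of polynomial representations of `L`.  (This category
is closed under subquotients, so its epimorphisms are the surjective maps.) -/
def IsProjectiveRep (Q : Type u) [AddCommGroup Q] [Module k Q] [LieRingModule L Q]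
    [LieModule k L Q] : Prop :=
  IsPolynomialRep k L V Q ∧
  ∀ (M N : Type u) [AddCommGroup M] [Module k M] [LieRingModule L M] [LieModule k L M]
    [AddCommGroup N] [Module k N] [LieRingModule L N] [LieModule k L N],
    IsPolynomialRep k L V M → IsPolynomialRep k L V N →
    ∀ (f : M →ₗ⁅k, L⁆ N) (g : Q →ₗ⁅k, L⁆ N), Function.Surjective f →
      ∃ h : Q →ₗ⁅k, L⁆ M, f.comp h = g

/-- `Q` is nonzero and not the direct sum of two nonzero subrepresentations. -/
def IsIndecomposableRep (Q : Type u) [AddCommGroup Q] [Module k Q] [LieRingModule L Q]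
    [LieModule k L Q] : Prop :=
  Nontrivial Q ∧ ∀ A B : LieSubmodule k L Q, IsCompl A B → A = ⊥ ∨ B = ⊥

end RepPol

section Setup

variable {k : Type u} [Field k] (P : LinearOperad k) (n : ℕ)

/-- `V_n`: the free `P`-algebra on `W_n = k^n`. -/
abbrev V : Type u := P.Free (Fin n →₀ k)

/-- `V`: the free `P`-algebra on `W = ⋃ W_n`, a vector space with basis `x_0, x_1, …`. -/
abbrev VInf : Type u := P.Free (ℕ →₀ k)

/-- `h_n`: the Lie algebra of all derivations of `V_n`. -/
noncomputable abbrev h : LieSubalgebra k (Module.End k (P.V n)) := P.derivations (P.V n)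

/-- `h = ⋃ h_n`: the derivations of `V` that kill all but finitely many of the generators `x_i`. -/
noncomputable def hInf : LieSubalgebra k (Module.End k P.VInf) where
  carrier := {δ | P.IsDerivation P.VInf δ ∧
    {i : ℕ | δ (Free.ι (Finsupp.single i 1)) ≠ 0}.Finite}
  zero_mem' := ⟨(P.derivations P.VInf).zero_mem, by simp⟩
  add_mem' := fun {δ ε} hδ hε => ⟨(P.derivations P.VInf).add_mem hδ.1 hε.1,
    (hδ.2.union hε.2).subset fun i hi => by
      by_contra h
      simp only [Set.mem_union, Set.mem_ofPred_eq, not_or, not_not] at h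
      exact hi (by rw [LinearMap.add_apply, h.1, h.2, add_zero])⟩
  smul_mem' := fun c δ hδ => ⟨(P.derivations P.VInf).smul_mem c hδ.1,
    hδ.2.subset fun i hi => by
      simp only [Set.mem_ofPred_eq, LinearMap.smul_apply] at hi ⊢
      exact fun h => hi (by rw [h, smul_zero])⟩
  lie_mem' := fun {δ ε} hδ hε => ⟨(P.derivations P.VInf).lie_mem hδ.1 hε.1,
    (hδ.2.union hε.2).subset fun i hi => by
      by_contra h
      simp only [Set.mem_union, Set.mem_ofPred_eq, not_or, not_not] at h
      exact hi (by rw [LieRing.of_associative_ring_bracket, LinearMap.sub_apply,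
        Module.End.mul_apply, Module.End.mul_apply, h.1, h.2, map_zero, map_zero, sub_zero])⟩

/-- The action of `gl(U)` on `P{U}` by derivations: `A` extends uniquely to a derivation.  For
`U = W_n` this is the map `gl_n → h_n`. -/
noncomputable def glDeriv (U : Type u) [AddCommGroup U] [Module k U] :
    Module.End k U →ₗ⁅k⁆ P.derivations (P.Free U) where
  toFun A := ⟨Free.derivFun (Free.ι ∘ₗ A), Free.isDerivation_derivFun _⟩
  map_add' A B := Subtype.ext <| Free.derivation_ext (Free.isDerivation_derivFun _)
    ((P.derivations (P.Free U)).add_mem (Free.isDerivation_derivFun _)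
      (Free.isDerivation_derivFun _)) fun u => by
    simp [Free.derivFun_ι]
  map_smul' c A := Subtype.ext <| Free.derivation_ext (Free.isDerivation_derivFun _)
    ((P.derivations (P.Free U)).smul_mem c (Free.isDerivation_derivFun _)) fun u => by
    simp [Free.derivFun_ι]
  map_lie' {A B} := Subtype.ext <| Free.derivation_ext (Free.isDerivation_derivFun _)
    ((P.derivations (P.Free U)).lie_mem (Free.isDerivation_derivFun _)
      (Free.isDerivation_derivFun _)) fun u => by
    simp [Free.derivFun_ι, LieRing.of_associative_ring_bracket]

theorem glDeriv_ι {U : Type u} [AddCommGroup U] [Module k U] (A : Module.End k U) (u : U) :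
    (P.glDeriv U A : Module.End k (P.Free U)) (Free.ι u) = Free.ι (A u) :=
  Free.derivFun_ι _ u

/-- `Hom_{gl(U)}(E, M)` for a representation `E` of `gl(U)` and a representation `M` of the
derivations of `P{U}`, on which `gl(U)` acts through `glDeriv`. -/
noncomputable def glHom {U : Type u} [AddCommGroup U] [Module k U] (E M : Type u)
    [AddCommGroup E] [Module k E] [LieRingModule (Module.End k U) E] [LieModule k (Module.End k U) E]
    [AddCommGroup M] [Module k M] [LieRingModule (P.derivations (P.Free U)) M]
    [LieModule k (P.derivations (P.Free U)) M] : Submodule k (E →ₗ[k] M) where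
  carrier := {φ | ∀ (A : Module.End k U) (x : E), φ ⁅A, x⁆ = ⁅P.glDeriv U A, φ x⁆}
  zero_mem' A x := by simp
  add_mem' hφ hψ A x := by simp [hφ A x, hψ A x]
  smul_mem' c φ hφ A x := by simp [hφ A x]

theorem Schur.map_ι_lie {U : Type u} [AddCommGroup U] [Module k U] (μ : YoungDiagram)
    (A : Module.End k U) (x : Schur k μ U) :
    Schur.map k μ (Free.ι (P := P)) ⁅A, x⁆ = ⁅P.glDeriv U A, Schur.map k μ (Free.ι (P := P)) x⁆ :=
  Schur.map_lie (Free.ι (P := P)) A (P.glDeriv U A) (fun u => (P.glDeriv_ι A u).symm) x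

/-- The restriction map `Hom_{h_n}(S_μ(V_n), M) → Hom_{gl_n}(S_μ(W_n), M)`, along the map
`S_μ(W_n) → S_μ(V_n)` induced by `W_n → V_n`. -/
noncomputable def restrictHom (μ : YoungDiagram) (M : Type u) [AddCommGroup M] [Module k M]
    [LieRingModule (P.h n) M] [LieModule k (P.h n) M] :
    (Schur k μ (P.V n) →ₗ⁅k, P.h n⁆ M) →ₗ[k]
      P.glHom (U := Fin n →₀ k) (Schur k μ (Fin n →₀ k)) M where
  toFun Φ := ⟨(Φ : Schur k μ (P.V n) →ₗ[k] M) ∘ₗ Schur.map k μ Free.ι, fun A x =>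
    (congrArg Φ (Schur.map_ι_lie P μ A x)).trans (Φ.map_lie _ _)⟩
  map_add' _ _ := rfl
  map_smul' _ _ := rfl

/-- The inclusion `W_n ⊂ W`. -/
noncomputable def inclW : (Fin n →₀ k) →ₗ[k] (ℕ →₀ k) := Finsupp.lmapDomain k k Fin.val

/-- The projection `W → W_n` that kills `x_i` for `i ≥ n`. -/
noncomputable def projW : (ℕ →₀ k) →ₗ[k] (Fin n →₀ k) :=
  Finsupp.lcomapDomain Fin.val Fin.val_injective

theorem inclW_single (i : Fin n) (c : k) :
    inclW n (Finsupp.single i c) = Finsupp.single (i : ℕ) c := Finsupp.mapDomain_single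

theorem projW_inclW (w : Fin n →₀ k) : projW n (inclW n w) = w :=
  Finsupp.comapDomain_mapDomain _ Fin.val_injective w

theorem projW_single_of_le {i : ℕ} (hi : n ≤ i) (c : k) :
    projW n (Finsupp.single i c) = 0 := by
  ext j
  have : i ≠ j := by omega
  simp [projW, Finsupp.lcomapDomain, this]

/-- The inclusion `V_n ⊂ V`. -/
noncomputable def inclV : P.V n →ₗ[k] P.VInf := Free.map (inclW n)

theorem inclV_ι (w : Fin n →₀ k) : P.inclV n (Free.ι w) = Free.ι (inclW n w) := Free.map_ι _ _

/-- The extension of a derivation of `V_n` to `V`: it agrees with `δ` on `x_i` for `i < n` and kills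
`x_i` for `i ≥ n`. -/
noncomputable def extendDeriv (δ : Module.End k (P.V n)) : Module.End k P.VInf :=
  Free.derivFun (P.inclV n ∘ₗ δ ∘ₗ Free.ι ∘ₗ projW n)

theorem extendDeriv_ι (δ : Module.End k (P.V n)) (w : ℕ →₀ k) :
    P.extendDeriv n δ (Free.ι w) = P.inclV n (δ (Free.ι (projW n w))) :=
  Free.derivFun_ι _ _

theorem extendDeriv_mem (δ : Module.End k (P.V n)) : P.extendDeriv n δ ∈ P.hInf :=
  ⟨Free.isDerivation_derivFun _, (Set.finite_lt_nat n).subset fun i hi => by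
    by_contra h
    refine hi ?_
    rw [extendDeriv_ι, projW_single_of_le n (not_lt.1 h), map_zero, map_zero, map_zero]⟩

theorem extendDeriv_inclV {δ : Module.End k (P.V n)} (hδ : P.IsDerivation (P.V n) δ) (x : P.V n) :
    P.extendDeriv n δ (P.inclV n x) = P.inclV n (δ x) := by
  have : P.extendDeriv n δ ∘ₗ P.inclV n = P.inclV n ∘ₗ δ := by
    refine Free.hom_ext fun r p v => ?_
    rw [LinearMap.comp_apply, LinearMap.comp_apply, inclV, Free.map_mk, ← Free.act_ι, ← Free.act_ι,
      hδ, (P.extendDeriv_mem n δ).1, map_sum]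
    refine Finset.sum_congr rfl fun i _ => ?_
    rw [Free.map_act]
    congr 1
    funext j
    by_cases h : j = i
    · subst h
      rw [Function.update_self, Function.update_self]
      exact (P.extendDeriv_ι n δ _).trans (by rw [projW_inclW]; rfl)
    · rw [Function.update_of_ne h, Function.update_of_ne h, Free.map_ι]
  exact LinearMap.congr_fun this x

/-- The inclusion `h_n ⊂ h`. -/
noncomputable def extend : P.h n →ₗ⁅k⁆ P.hInf where
  toFun δ := ⟨P.extendDeriv n δ, P.extendDeriv_mem n δ⟩
  map_add' δ ε := Subtype.ext <| Free.derivation_ext (P.extendDeriv_mem n _).1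
    (P.hInf.add_mem (P.extendDeriv_mem n δ) (P.extendDeriv_mem n ε)).1 fun u => by
    simp [extendDeriv_ι]
  map_smul' c δ := Subtype.ext <| Free.derivation_ext (P.extendDeriv_mem n _).1
    (P.hInf.smul_mem c (P.extendDeriv_mem n δ)).1 fun u => by
    simp [extendDeriv_ι]
  map_lie' {δ ε} := Subtype.ext <| Free.derivation_ext (P.extendDeriv_mem n _).1
    (P.hInf.lie_mem (P.extendDeriv_mem n δ) (P.extendDeriv_mem n ε)).1 fun u => by
    change P.extendDeriv n ⁅δ.1, ε.1⁆ (Free.ι u) =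
      ⁅P.extendDeriv n δ.1, P.extendDeriv n ε.1⁆ (Free.ι u)
    rw [LieRing.of_associative_ring_bracket, LieRing.of_associative_ring_bracket,
      LinearMap.sub_apply, Module.End.mul_apply,
      Module.End.mul_apply, extendDeriv_ι, extendDeriv_ι, extendDeriv_ι,
      P.extendDeriv_inclV n δ.2, P.extendDeriv_inclV n ε.2, ← map_sub]
    rfl

/-- `gl_{∞-n}`: finitary endomorphisms of `W` supported on the block of indices `≥ n`. -/
def glCompl (k : Type u) [Field k] (n : ℕ) : Set (Module.End k (ℕ →₀ k)) :=
  {A | (∀ i < n, A (Finsupp.single i 1) = 0) ∧ (∀ (i : ℕ), ∀ j < n, A (Finsupp.single i 1) j = 0) ∧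
    {i : ℕ | A (Finsupp.single i 1) ≠ 0}.Finite}

/-- The inclusion of `gl_{∞-n}` in `h`. -/
noncomputable def glComplDeriv (A : glCompl k n) : P.hInf :=
  ⟨P.glDeriv (ℕ →₀ k) A.1, (P.glDeriv (ℕ →₀ k) A.1).2, A.2.2.2.subset fun i hi h =>
    hi (by rw [glDeriv_ι, h, map_zero])⟩

theorem glCompl_inclW (A : glCompl k n) (w : Fin n →₀ k) : A.1 (inclW n w) = 0 := by
  have : A.1 ∘ₗ inclW n = 0 := by
    ext i : 2
    simp [inclW_single, A.2.1 i i.2]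
  exact LinearMap.congr_fun this w

theorem derivFun_inclV (A : Module.End k (ℕ →₀ k)) (hA : ∀ w, A (inclW n w) = 0) (x : P.V n) :
    Free.derivFun (Free.ι ∘ₗ A) (P.inclV n x) = 0 := by
  have : Free.derivFun (Free.ι ∘ₗ A) ∘ₗ P.inclV n = 0 := by
    refine Free.hom_ext fun r p v => ?_
    rw [LinearMap.comp_apply, inclV, Free.map_mk, Free.derivFun_mk]
    refine Finset.sum_eq_zero fun i _ => ?_
    refine (Algebra.act p).map_coord_zero i ?_
    rw [Function.update_self, LinearMap.comp_apply, hA, map_zero]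
  exact LinearMap.congr_fun this x

theorem lie_extend_glComplDeriv (A : glCompl k n) (δ : P.h n) :
    ⁅P.glComplDeriv n A, P.extend n δ⁆ = 0 := by
  have hp : ∀ w, projW n (A.1 w) = 0 := fun w => by
    have : projW n ∘ₗ A.1 = 0 := by
      ext i j
      simpa [projW, Finsupp.lcomapDomain] using A.2.2.1 i j j.2
    exact LinearMap.congr_fun this w
  refine Subtype.ext <| Free.derivation_ext (⁅P.glComplDeriv n A, P.extend n δ⁆ : P.hInf).2.1
    (P.hInf.zero_mem).1 fun u => ?_
  change ⁅Free.derivFun (Free.ι ∘ₗ A.1), P.extendDeriv n δ.1⁆ (Free.ι u) = 0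
  rw [LieRing.of_associative_ring_bracket, LinearMap.sub_apply, Module.End.mul_apply,
    Module.End.mul_apply, Free.derivFun_ι, LinearMap.comp_apply, extendDeriv_ι, extendDeriv_ι, hp,
    P.derivFun_inclV n A.1 (glCompl_inclW n A), map_zero, map_zero, map_zero, sub_zero]

/-- The specialization `Γ_n(N)`: the invariants of `gl_{∞-n}` in the `h`-module `N`. -/
def Gamma (N : Type u) [AddCommGroup N] [Module k N] [LieRingModule P.hInf N]
    [LieModule k P.hInf N] : Submodule k N where
  carrier := {m | ∀ A : glCompl k n, ⁅P.glComplDeriv n A, m⁆ = 0}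
  zero_mem' A := by simp
  add_mem' hx hy A := by rw [lie_add, hx A, hy A, add_zero]
  smul_mem' c x hx A := by rw [lie_smul, hx A, smul_zero]

end Setup
section Spec
variable {k : Type u} [Field k] (P : LinearOperad k) (n : ℕ)

section
variable {N N' : Type u} [AddCommGroup N] [Module k N] [LieRingModule P.hInf N]
  [LieModule k P.hInf N] [AddCommGroup N'] [Module k N'] [LieRingModule P.hInf N']
  [LieModule k P.hInf N']

theorem extend_lie_mem_Gamma (δ : P.h n) {m : N} (hm : m ∈ P.Gamma n N) :
    ⁅P.extend n δ, m⁆ ∈ P.Gamma n N := fun A => by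
  rw [leibniz_lie, lie_extend_glComplDeriv, zero_lie, hm A, lie_zero, add_zero]

/-- `h_n` commutes with `gl_{∞-n}` in `h`, and so acts on `Γ_n(N)`. -/
noncomputable instance : LieRingModule (P.h n) (P.Gamma n N) where
  bracket δ m := ⟨⁅P.extend n δ, (m : N)⁆, P.extend_lie_mem_Gamma n δ m.2⟩
  add_lie δ ε m := Subtype.ext (by
    change ⁅P.extend n (δ + ε), (m : N)⁆ = ⁅P.extend n δ, (m : N)⁆ + ⁅P.extend n ε, (m : N)⁆
    rw [map_add, add_lie])
  lie_add δ m m' := Subtype.ext (lie_add (P.extend n δ) (m : N) (m' : N))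
  leibniz_lie δ ε m := Subtype.ext (by
    change ⁅P.extend n δ, ⁅P.extend n ε, (m : N)⁆⁆ =
      ⁅P.extend n ⁅δ, ε⁆, (m : N)⁆ + ⁅P.extend n ε, ⁅P.extend n δ, (m : N)⁆⁆
    rw [LieHom.map_lie, leibniz_lie])

theorem Gamma_coe_lie (δ : P.h n) (m : P.Gamma n N) :
    ((⁅δ, m⁆ : P.Gamma n N) : N) = ⁅P.extend n δ, (m : N)⁆ := rfl

noncomputable instance : LieModule k (P.h n) (P.Gamma n N) where
  smul_lie c δ m := Subtype.ext (by
    change ⁅P.extend n (c • δ), (m : N)⁆ = c • ⁅P.extend n δ, (m : N)⁆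
    rw [map_smul, smul_lie])
  lie_smul c δ m := Subtype.ext (lie_smul c (P.extend n δ) (m : N))

/-- The functor `Γ_n` on morphisms. -/
noncomputable def GammaMap (f : N →ₗ⁅k, P.hInf⁆ N') : P.Gamma n N →ₗ⁅k, P.h n⁆ P.Gamma n N' where
  toLinearMap := (f : N →ₗ[k] N').restrict fun m hm A => by
    change ⁅P.glComplDeriv n A, f m⁆ = 0
    rw [← f.map_lie, hm A]
    exact map_zero (f : N →ₗ[k] N')
  map_lie' {δ m} := Subtype.ext (f.map_lie (P.extend n δ) (m : N))
end

variable (μ : YoungDiagram)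

theorem SchurMap_mem_Gamma (x : Schur k μ (P.V n)) :
    Schur.map k μ (P.inclV n) x ∈ P.Gamma n (Schur k μ P.VInf) := fun A => by
  have h0 : ∀ m, P.inclV n ((0 : Module.End k (P.V n)) m) =
      (LieModule.toEnd k P.hInf P.VInf (P.glComplDeriv n A)) (P.inclV n m) := fun m => by
    rw [LinearMap.zero_apply, map_zero]
    exact (P.derivFun_inclV n A.1 (glCompl_inclW n A) m).symm
  refine Schur.incl_injective k μ ?_
  have h2 := tensorEnd_map μ.cells (P.inclV n) _ _ h0 (Schur.incl k μ x)
  have h3 : tensorEnd k μ.cells (0 : Module.End k (P.V n)) = 0 := by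
    simpa using tensorEnd_smul (k := k) μ.cells (0 : k) (0 : Module.End k (P.V n))
  rw [h3, LinearMap.zero_apply, map_zero] at h2
  rw [map_zero]
  exact h2.symm

/-- The natural map `S_μ(V_n) → Γ_n(S_μ(V))` induced by `V_n ⊂ V`. -/
noncomputable def SchurToGamma :
    Schur k μ (P.V n) →ₗ⁅k, P.h n⁆ P.Gamma n (Schur k μ P.VInf) where
  toLinearMap := (Schur.map k μ (P.inclV n)).codRestrict _ (P.SchurMap_mem_Gamma n μ)
  map_lie' {δ x} := Subtype.ext (Schur.map_lie (P.inclV n) δ (P.extend n δ)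
    (fun m => (P.extendDeriv_inclV n δ.2 m).symm) x)

/-- The map `Γ_n : Hom_h(S_μ(V), N) → Hom_{h_n}(S_μ(V_n), Γ_n(N))`, where `S_μ(V_n)` is identified
with `Γ_n(S_μ(V))` by `SchurToGamma`. -/
noncomputable def GammaHom (N : Type u) [AddCommGroup N] [Module k N] [LieRingModule P.hInf N]
    [LieModule k P.hInf N] :
    (Schur k μ P.VInf →ₗ⁅k, P.hInf⁆ N) →ₗ[k] (Schur k μ (P.V n) →ₗ⁅k, P.h n⁆ P.Gamma n N) where
  toFun f := (P.GammaMap n f).comp (P.SchurToGamma n μ)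
  map_add' _ _ := rfl
  map_smul' _ _ := rfl

end Spec
end LinearOperad

/-! Write `W = k^n`, let `a` and `b` be the row sum and the signed column sum of `μ`, `c = ab` the
Young symmetrizer, and `e` the basis tensor whose factor at a cell is the basis vector indexed by
the row of that cell. The highest weight tensor is `v = c e`, and its image in `S_μ(V_n)` is the
generator on which everything rests. Elements of the enveloping algebra of `gl_n` are replaced by
noncommutative polynomials `w` in endomorphisms of `W` (`freeAct`), so that one and the same `w` can
act on several modules.

Generation. Let `j : W → V` be a linear map such that every linear `f : W → V` is `D f ∘ j` for some
derivation `D f`. By the Leibniz rule, and division by integers, these derivations turn the map of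
tensor powers induced by `j` into every symmetrized tensor product of linear maps `W → V`
(`normalOrdered_mem`). Symmetrized rank-one maps send `e` to `a s` for an arbitrary tensor `s` and
commute with permutations, so they send `v` to `a b a s`. The identity `a b a y a b = a b` for a
suitable `y` then reaches every `c t` (`range_youngSymmetrizer_le`). The identity itself comes from
positivity of `z ↦ z z*` on a rational group algebra together with Maschke's theorem.

Lifting. Let `x` be an element of a direct sum of tensor powers of `V_n`. A polynomial in the Euler
operator isolates its part of degree `|μ|`. This part is a combination of values of natural
operations, built from the operad, at tensors of basis vectors of `W`. A further element of `gl_n`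
fixes `v` and maps the tensor power of `W` into the span of the permutations of `v`. So some `w`
satisfies `w v = v` and `w x = Φ(v)`, with `Φ` natural and commuting with all derivations
(`exists_freeAct_eq_naturalOp`). Since `v` generates, `Φ` carries `S_μ(V_n)` into any submodule
containing `x`. Hence for each `m` in a polynomial module there is a homomorphism with value `w m`
at the generator (`exists_hom_generator`). When `m` is the image of `v` under a `gl_n`-map, `w m =
m`, which gives the universal property. Projectivity follows in the same way, since `w` fixes the
generator.

Specialization. A diagonal element of `gl_{∞-n}` counts the variables of index at least `n` that
occur in a given tensor. A polynomial in it with value `1` at `0` fixes invariants and moves tensors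
on `V` to tensors on `V_n`. Invariants of a polynomial `h`-module therefore lift to tensors on
`V_n`, where the lifting argument applies, and `Φ` passes to `V` by naturality.

Generators and indecomposables. A nonzero polynomial module has a highest weight vector, and its
weight is the list of row lengths of a diagram. If `w` fixes the highest weight tensor of the same
weight, it cannot kill that vector (`IsHighestWeight.eq_zero_of_freeAct_eq_zero`). So the lifted
homomorphisms detect every nonzero quotient. When `P([0]) = 0` and `P([1])` is a line, the part of
degree `|μ|` of `S_μ(V_n)` is the simple `gl_n`-module `S_μ(W)`, in which the weight of `v` has
multiplicity one. This forces indecomposability. An indecomposable projective retracts onto the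
`S_ν(V_n)` that is detected by a vector of least degree. -/

/-! ### Positivity and regularity in rational group algebras -/

section GroupAlgebra

/-- The anti-involution `g ↦ g⁻¹` of a group algebra. -/
noncomputable def groupAlgebraStar (R G : Type*) [CommRing R] [Group G] :
    MonoidAlgebra R G →ₐ[R] (MonoidAlgebra R G)ᵐᵒᵖ :=
  MonoidAlgebra.lift R (MonoidAlgebra R G)ᵐᵒᵖ G
    { toFun := fun g => MulOpposite.op (MonoidAlgebra.of R G g⁻¹)
      map_one' := by simp [MonoidAlgebra.one_def]
      map_mul' := fun g h => by rw [← MulOpposite.op_mul, ← map_mul, mul_inv_rev] }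

theorem groupAlgebraStar_of {R G : Type*} [CommRing R] [Group G] (g : G) :
    groupAlgebraStar R G (MonoidAlgebra.of R G g) =
      MulOpposite.op (MonoidAlgebra.of R G g⁻¹) := by
  rw [groupAlgebraStar, MonoidAlgebra.lift_of]; rfl

/-- The coefficient of `z z*` at the identity is the sum of the squares of the coefficients of `z`.
The order on `ℚ` is essential here. -/
theorem eq_zero_of_mul_star_eq_zero {G : Type*} [Group G] (z : MonoidAlgebra ℚ G)
    (h : z * (groupAlgebraStar ℚ G z).unop = 0) : z = 0 := by
  classical
  have h1 : ∀ y : MonoidAlgebra ℚ G, (z * (groupAlgebraStar ℚ G y).unop).coeff 1 =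
      y.coeff.sum fun g c => z.coeff g * c := by
    intro y
    induction y using MonoidAlgebra.induction_linear with
    | zero => simp
    | add x y hx hy =>
      rw [map_add, MulOpposite.unop_add, mul_add, MonoidAlgebra.coeff_add, Finsupp.add_apply,
        hx, hy, MonoidAlgebra.coeff_add]
      exact (Finsupp.sum_add_index' (by simp) (by intros; ring)).symm
    | single g c =>
      have : MonoidAlgebra.single g c = c • MonoidAlgebra.of ℚ G g := by simp
      rw [this, map_smul, groupAlgebraStar_of]
      simp [mul_comm]
  have h2 := h1 z
  rw [h, MonoidAlgebra.coeff_zero, Finsupp.zero_apply, Finsupp.sum,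
    eq_comm, Finset.sum_eq_zero_iff_of_nonneg fun g _ => mul_self_nonneg _] at h2
  ext g
  by_cases hg : g ∈ z.coeff.support
  · exact mul_self_eq_zero.1 (h2 g hg)
  · simpa using hg

/-- By Maschke's theorem the group algebra is von Neumann regular; applied to `v v*` this gives the
claim multiplied by `v*` on the right, and positivity cancels that factor. -/
theorem exists_mul_star_regular {G : Type*} [Group G] [Finite G] (v : MonoidAlgebra ℚ G) :
    ∃ x, v * (groupAlgebraStar ℚ G v).unop * x * v = v := by
  have reg : ∀ r : MonoidAlgebra ℚ G, ∃ x, r * x * r = r := by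
    intro r
    have : NeZero (Nat.card G : ℚ) := ⟨by simp [Nat.card_pos.ne']⟩
    obtain ⟨q, hq⟩ := exists_isCompl (Ideal.span {r} : Ideal (MonoidAlgebra ℚ G))
    have h1 : (1 : MonoidAlgebra ℚ G) ∈ Ideal.span {r} ⊔ q := by rw [hq.sup_eq_top]; trivial
    obtain ⟨y, hy, z, hz, hyz⟩ := Submodule.mem_sup.1 h1
    obtain ⟨x, rfl⟩ := Ideal.mem_span_singleton'.1 hy
    refine ⟨x, ?_⟩
    -- With `1 = x r + z` and `z` in the complement of the left ideal of `r`, the element `r z` lies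
    -- in both summands.
    have h2 : r - r * x * r = r * z := by
      rw [eq_sub_of_add_eq' hyz, mul_sub, mul_one, mul_assoc]
    have h3 : r * z ∈ Ideal.span {r} := by
      rw [← h2]
      exact Ideal.mem_span_singleton'.2 ⟨1 - r * x, by rw [sub_mul, one_mul]⟩
    have h4 : r * z = 0 := by
      have := hq.inf_eq_bot
      rw [← Submodule.mem_bot (MonoidAlgebra ℚ G), ← this]
      exact ⟨h3, q.smul_mem r hz⟩
    rw [h4, sub_eq_zero] at h2
    exact h2.symm
  set s := (groupAlgebraStar ℚ G v).unop with hs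
  obtain ⟨x, hx⟩ := reg (v * s)
  refine ⟨x, ?_⟩
  have h0 : (v - v * s * x * v) * s = 0 := by
    rw [sub_mul, sub_eq_zero]
    simpa only [mul_assoc] using hx.symm
  -- The difference is `u = (1 - v s x) v`, so `u*` begins with the factor `s`, and `u s = 0` gives
  -- `u u* = 0`.
  have h1 := eq_zero_of_mul_star_eq_zero (v - v * s * x * v) (by
    have : v - v * s * x * v = (1 - v * s * x) * v := by rw [sub_mul, one_mul]
    conv_lhs => rw [this, map_mul, MulOpposite.unop_mul, ← hs, ← mul_assoc, ← this, h0, zero_mul])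
  exact (sub_eq_zero.1 h1).symm

end GroupAlgebra

namespace LinearOperad

/-! ### The Young symmetrizer in the group algebra -/

section Young
variable (R : Type*) [CommRing R] (μ : YoungDiagram)

/-- The sum of the row group. -/
noncomputable def rowSum : MonoidAlgebra R (Equiv.Perm μ.cells) :=
  ∑ σ ∈ rowPerms μ, MonoidAlgebra.of R _ σ

/-- The signed sum of the column group. -/
noncomputable def colSum : MonoidAlgebra R (Equiv.Perm μ.cells) :=
  ∑ τ ∈ colPerms μ, ((Equiv.Perm.sign τ : ℤ) : R) • MonoidAlgebra.of R _ τ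

variable {μ}

theorem mem_rowPerms {σ : Equiv.Perm μ.cells} : σ ∈ rowPerms μ ↔ ∀ c, (σ c).1.1 = c.1.1 := by
  simp [rowPerms]

theorem mem_colPerms {σ : Equiv.Perm μ.cells} : σ ∈ colPerms μ ↔ ∀ c, (σ c).1.2 = c.1.2 := by
  simp [colPerms]

theorem inv_mem_rowPerms {σ : Equiv.Perm μ.cells} (h : σ ∈ rowPerms μ) : σ⁻¹ ∈ rowPerms μ := by
  rw [mem_rowPerms] at *
  intro c
  rw [← h (σ⁻¹ c)]
  simp

theorem inv_mem_colPerms {σ : Equiv.Perm μ.cells} (h : σ ∈ colPerms μ) : σ⁻¹ ∈ colPerms μ := by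
  rw [mem_colPerms] at *
  intro c
  rw [← h (σ⁻¹ c)]
  simp

theorem mul_mem_rowPerms {σ τ : Equiv.Perm μ.cells} (h : σ ∈ rowPerms μ) (h' : τ ∈ rowPerms μ) :
    σ * τ ∈ rowPerms μ := by
  rw [mem_rowPerms] at *
  intro c
  rw [Equiv.Perm.mul_apply, h, h']

theorem mul_mem_colPerms {σ τ : Equiv.Perm μ.cells} (h : σ ∈ colPerms μ) (h' : τ ∈ colPerms μ) :
    σ * τ ∈ colPerms μ := by
  rw [mem_colPerms] at *
  intro c
  rw [Equiv.Perm.mul_apply, h, h']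

theorem eq_one_of_mem_rowPerms_of_mem_colPerms {σ : Equiv.Perm μ.cells} (h : σ ∈ rowPerms μ)
    (h' : σ ∈ colPerms μ) : σ = 1 :=
  Equiv.ext fun c => Subtype.ext (Prod.ext (mem_rowPerms.1 h c) (mem_colPerms.1 h' c))

variable {R}

theorem of_mul_rowSum {σ : Equiv.Perm μ.cells} (h : σ ∈ rowPerms μ) :
    MonoidAlgebra.of R _ σ * rowSum R μ = rowSum R μ := by
  rw [rowSum, Finset.mul_sum]
  refine Finset.sum_bij' (fun τ _ => σ * τ) (fun τ _ => σ⁻¹ * τ)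
    (fun τ hτ => mul_mem_rowPerms h hτ) (fun τ hτ => mul_mem_rowPerms (inv_mem_rowPerms h) hτ)
    (by simp) (by simp) fun τ _ => by rw [map_mul]

theorem colSum_mul_of {σ : Equiv.Perm μ.cells} (h : σ ∈ colPerms μ) :
    colSum R μ * MonoidAlgebra.of R _ σ = ((Equiv.Perm.sign σ : ℤ) : R) • colSum R μ := by
  rw [colSum, Finset.sum_mul, Finset.smul_sum]
  refine Finset.sum_bij' (fun τ _ => τ * σ) (fun τ _ => τ * σ⁻¹)
    (fun τ hτ => mul_mem_colPerms hτ h) (fun τ hτ => mul_mem_colPerms hτ (inv_mem_colPerms h))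
    (by simp) (by simp) fun τ _ => ?_
  rw [smul_mul_assoc, ← map_mul, smul_smul, Equiv.Perm.sign_mul, Units.val_mul, Int.cast_mul,
    mul_comm ((Equiv.Perm.sign τ : ℤ) : R), ← mul_assoc, ← Int.cast_mul, ← Units.val_mul,
    Int.units_mul_self, Units.val_one, Int.cast_one, one_mul]

theorem colSum_mul_colSum : colSum R μ * colSum R μ = ((colPerms μ).card : R) • colSum R μ := by
  conv_lhs => enter [2]; rw [colSum]
  rw [Finset.mul_sum, Nat.cast_smul_eq_nsmul, ← Finset.sum_const]
  refine Finset.sum_congr rfl fun σ hσ => ?_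
  rw [mul_smul_comm, colSum_mul_of hσ, smul_smul, ← Int.cast_mul, ← Units.val_mul,
    Int.units_mul_self, Units.val_one, Int.cast_one, one_smul]

theorem unop_groupAlgebraStar_rowSum :
    (groupAlgebraStar R _ (rowSum R μ)).unop = rowSum R μ := by
  rw [rowSum, map_sum, Finset.unop_sum]
  refine Finset.sum_bij' (fun τ _ => τ⁻¹) (fun τ _ => τ⁻¹) (fun τ hτ => inv_mem_rowPerms hτ)
    (fun τ hτ => inv_mem_rowPerms hτ) (by simp) (by simp) fun τ _ => ?_
  rw [groupAlgebraStar_of, MulOpposite.unop_op]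

theorem unop_groupAlgebraStar_colSum :
    (groupAlgebraStar R _ (colSum R μ)).unop = colSum R μ := by
  rw [colSum, map_sum, Finset.unop_sum]
  refine Finset.sum_bij' (fun τ _ => τ⁻¹) (fun τ _ => τ⁻¹) (fun τ hτ => inv_mem_colPerms hτ)
    (fun τ hτ => inv_mem_colPerms hτ) (by simp) (by simp) fun τ _ => ?_
  rw [map_smul, groupAlgebraStar_of, MulOpposite.unop_smul, MulOpposite.unop_op,
    Equiv.Perm.sign_inv]

theorem mapRingHom_rowSum {S : Type*} [CommRing S] (f : R →+* S) :
    MonoidAlgebra.mapRingHom _ f (rowSum R μ) = rowSum S μ := by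
  simp [rowSum, map_sum]

theorem mapRingHom_colSum {S : Type*} [CommRing S] (f : R →+* S) :
    MonoidAlgebra.mapRingHom _ f (colSum R μ) = colSum S μ := by
  simp [colSum, map_sum]

/-- A regularity property of the Young symmetrizer. -/
theorem exists_youngSymmetrizer_regular (k : Type*) [Field k] [CharZero k] (μ : YoungDiagram) :
    ∃ y : MonoidAlgebra k (Equiv.Perm μ.cells),
      rowSum k μ * colSum k μ * rowSum k μ * y * (rowSum k μ * colSum k μ) =
        rowSum k μ * colSum k μ := by
  -- For `c = ab` one has `c* = ba`, and `b b` is the order of the column group times `b`; so `c c*`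
  -- is that multiple of `a b a`, which explains the scalar in the witness below. The work is done
  -- over `ℚ`, where positivity is available, and then carried to `k`.
  obtain ⟨x, hx⟩ := exists_mul_star_regular (rowSum ℚ μ * colSum ℚ μ)
  rw [map_mul, MulOpposite.unop_mul, unop_groupAlgebraStar_rowSum,
    unop_groupAlgebraStar_colSum] at hx
  refine ⟨MonoidAlgebra.mapRingHom _ (algebraMap ℚ k) (((colPerms μ).card : ℚ) • x), ?_⟩
  have h : rowSum ℚ μ * colSum ℚ μ * rowSum ℚ μ * (((colPerms μ).card : ℚ) • x) *
      (rowSum ℚ μ * colSum ℚ μ) = rowSum ℚ μ * colSum ℚ μ := by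
    conv_rhs => rw [← hx]
    calc _ = rowSum ℚ μ * (((colPerms μ).card : ℚ) • colSum ℚ μ) * rowSum ℚ μ * x *
          (rowSum ℚ μ * colSum ℚ μ) := by simp only [mul_smul_comm, smul_mul_assoc]
      _ = _ := by rw [← colSum_mul_colSum]; simp only [mul_assoc]
  have h' := congrArg (MonoidAlgebra.mapRingHom _ (algebraMap ℚ k)) h
  rwa [map_mul, map_mul, map_mul, map_mul, mapRingHom_rowSum, mapRingHom_colSum] at h'

end Young

/-! ### Permutations of the factors of a tensor power -/

section PermAct
variable (k : Type*) [Field k] (C : Type*)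
  (M : Type*) {M' : Type*} [AddCommGroup M] [Module k M] [AddCommGroup M'] [Module k M']

/-- The action of the group algebra of the permutations of the factors on a tensor power. -/
noncomputable def permAct :
    MonoidAlgebra k (Equiv.Perm C) →ₐ[k] Module.End k (⨂[k] _ : C, M) :=
  MonoidAlgebra.lift k _ _
    { toFun := fun σ => (PiTensorProduct.reindex k (fun _ => M) σ).toLinearMap
      map_one' := by rw [Equiv.Perm.one_def, PiTensorProduct.reindex_refl]; rfl
      map_mul' := fun σ τ => by
        rw [Equiv.Perm.mul_def, ← PiTensorProduct.reindex_trans]; rfl }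

variable {k C M}

theorem permAct_of (σ : Equiv.Perm C) : permAct k C M (MonoidAlgebra.of k _ σ) =
    (PiTensorProduct.reindex k (fun _ => M) σ).toLinearMap := by
  rw [permAct, MonoidAlgebra.lift_of]; rfl

/-- A linear map between tensor powers commutes with the permutations of the factors. -/
def IsPermEquivariant (θ : (⨂[k] _ : C, M) →ₗ[k] ⨂[k] _ : C, M') : Prop :=
  ∀ (σ : Equiv.Perm C) (t : ⨂[k] _ : C, M),
    θ (PiTensorProduct.reindex k (fun _ => M) σ t) = PiTensorProduct.reindex k (fun _ => M') σ (θ t)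

theorem IsPermEquivariant.map_permAct {θ : (⨂[k] _ : C, M) →ₗ[k] ⨂[k] _ : C, M'}
    (h : IsPermEquivariant θ) (z : MonoidAlgebra k (Equiv.Perm C)) (t : ⨂[k] _ : C, M) :
    θ (permAct k C M z t) = permAct k C M' z (θ t) := by
  induction z using MonoidAlgebra.induction_on with
  | of σ => rw [permAct_of, permAct_of]; exact h σ t
  | add x y hx hy => simp only [map_add, LinearMap.add_apply, hx, hy]
  | smul c x hx => simp only [map_smul, LinearMap.smul_apply, hx]

theorem isPermEquivariant_map (f : M →ₗ[k] M') :
    IsPermEquivariant (PiTensorProduct.map (fun _ : C => f)) := fun σ t =>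
  PiTensorProduct.map_reindex (fun _ => f) σ t

theorem isPermEquivariant_tensorEnd [Fintype C] [DecidableEq C] (f : Module.End k M) :
    IsPermEquivariant (tensorEnd k C f) := by
  intro σ t
  have : tensorEnd k C f ∘ₗ (PiTensorProduct.reindex k (fun _ => M) σ).toLinearMap =
      (PiTensorProduct.reindex k (fun _ => M) σ).toLinearMap ∘ₗ tensorEnd k C f := by
    ext v
    simp only [LinearMap.compMultilinearMap_apply, LinearMap.comp_apply, LinearEquiv.coe_coe,
      tensorEnd_tprod, map_sum, PiTensorProduct.reindex_tprod]
    rw [← Equiv.sum_comp σ]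
    refine Finset.sum_congr rfl fun c _ => congrArg _ (funext fun d => ?_)
    by_cases hd : d = σ c
    · subst hd
      rw [Function.update_self, Equiv.symm_apply_apply, Function.update_self]
    · have : σ.symm d ≠ c := fun h => hd (by rw [← h]; simp)
      simp [Function.update_of_ne this, hd]
  exact LinearMap.congr_fun this t

theorem youngSymmetrizer_eq_permAct (μ : YoungDiagram) : youngSymmetrizer k μ M =
    permAct k μ.cells M (rowSum k μ * colSum k μ) := by
  rw [youngSymmetrizer, rowSum, colSum, Finset.sum_mul_sum, map_sum]
  refine Finset.sum_congr rfl fun σ _ => ?_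
  rw [map_sum]
  refine Finset.sum_congr rfl fun τ _ => ?_
  rw [mul_smul_comm, map_smul, map_mul, permAct_of, permAct_of]
  rfl

end PermAct
end LinearOperad

namespace LinearOperad

/-! ### Symmetrized tensor products of linear maps -/

section NormalOrdered
variable {k : Type*} [Field k] {C : Type*} [Fintype C] [DecidableEq C]
  {W V : Type*} [AddCommGroup W] [Module k W] [AddCommGroup V] [Module k V]

/-- The symmetrization of `F₁ ⊗ ⋯ ⊗ F_r` as a map of tensor powers. -/
noncomputable def normalOrdered (F : C → W →ₗ[k] V) : (⨂[k] _ : C, W) →ₗ[k] ⨂[k] _ : C, V :=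
  ∑ g : Equiv.Perm C, PiTensorProduct.map fun c => F (g c)

theorem normalOrdered_tprod (F : C → W →ₗ[k] V) (w : C → W) :
    normalOrdered F (PiTensorProduct.tprod k w) =
      ∑ g : Equiv.Perm C, PiTensorProduct.tprod k fun c => F (g c) (w c) := by
  simp [normalOrdered, LinearMap.sum_apply]

theorem normalOrdered_comp_perm (F : C → W →ₗ[k] V) (h : Equiv.Perm C) :
    normalOrdered (fun c => F (h c)) = normalOrdered F :=
  (Equiv.sum_comp (Equiv.mulLeft h) fun g : Equiv.Perm C =>
    (PiTensorProduct.map fun c => F (g c) : (⨂[k] _ : C, W) →ₗ[k] ⨂[k] _ : C, V))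

theorem isPermEquivariant_normalOrdered (F : C → W →ₗ[k] V) :
    IsPermEquivariant (normalOrdered F) := by
  intro σ t
  have : normalOrdered F ∘ₗ (PiTensorProduct.reindex k (fun _ => W) σ).toLinearMap =
      (PiTensorProduct.reindex k (fun _ => V) σ).toLinearMap ∘ₗ normalOrdered F := by
    ext w
    simp only [LinearMap.compMultilinearMap_apply, LinearMap.comp_apply, LinearEquiv.coe_coe,
      PiTensorProduct.reindex_tprod, normalOrdered_tprod, map_sum]
    rw [← Equiv.sum_comp (Equiv.mulRight σ⁻¹)]
    rfl
  exact LinearMap.congr_fun this t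

theorem tensorEnd_comp_map (E : Module.End k V) (F : C → W →ₗ[k] V) :
    tensorEnd k C E ∘ₗ PiTensorProduct.map F =
      ∑ c, PiTensorProduct.map (Function.update F c (E ∘ₗ F c)) := by
  ext w
  simp only [LinearMap.compMultilinearMap_apply, LinearMap.comp_apply, PiTensorProduct.map_tprod,
    tensorEnd_tprod, LinearMap.sum_apply]
  refine Finset.sum_congr rfl fun c _ => congrArg _ (funext fun d => ?_)
  by_cases h : d = c
  · subst h; simp
  · simp [Function.update_of_ne h]

theorem tensorEnd_comp_normalOrdered (E : Module.End k V) (F : C → W →ₗ[k] V) :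
    tensorEnd k C E ∘ₗ normalOrdered F =
      ∑ c, normalOrdered (Function.update F c (E ∘ₗ F c)) := by
  have h1 : tensorEnd k C E ∘ₗ normalOrdered F = ∑ g : Equiv.Perm C,
      tensorEnd k C E ∘ₗ PiTensorProduct.map fun c => F (g c) := by
    ext; simp [normalOrdered]
  rw [h1]
  simp only [normalOrdered]
  rw [Finset.sum_comm]
  refine Finset.sum_congr rfl fun g _ => ?_
  rw [tensorEnd_comp_map]
  conv_rhs => rw [← Equiv.sum_comp g]
  refine Finset.sum_congr rfl fun c _ => congrArg _ (funext fun d => ?_)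
  by_cases h : d = c
  · subst h; simp
  · rw [Function.update_of_ne h, Function.update_of_ne fun h' => h (g.injective h')]

variable [CharZero k] {j : W →ₗ[k] V} {D : (W →ₗ[k] V) → Module.End k V}

/-- A space of maps between tensor powers that contains the map induced by `j` and is stable under
the derivations that extend linear maps `W → V` contains all symmetrized tensors. -/
theorem normalOrdered_mem (hD : ∀ f, D f ∘ₗ j = f)
    (K : Submodule k ((⨂[k] _ : C, W) →ₗ[k] ⨂[k] _ : C, V))
    (hj : PiTensorProduct.map (fun _ => j) ∈ K)
    (hK : ∀ f, ∀ φ ∈ K, tensorEnd k C (D f) ∘ₗ φ ∈ K) (F : C → W →ₗ[k] V) :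
    normalOrdered F ∈ K := by
  have main : ∀ (m : ℕ) (S : Finset C) (F : C → W →ₗ[k] V), S.card = m → (∀ c, c ∉ S → F c = j) →
      normalOrdered F ∈ K := by
    intro m
    induction m with
    | zero =>
      intro S F hS hF
      have : F = fun _ => j := funext fun c => hF c (by simp [Finset.card_eq_zero.1 hS])
      rw [this, normalOrdered, Finset.sum_const]
      exact K.nsmul_mem hj _
    | succ m ih =>
      intro S F hS hF
      obtain ⟨c₀, hc₀⟩ : S.Nonempty := Finset.card_pos.1 (by omega)
      -- The induction is on the number of slots that may differ from `j`. One such slot is reset to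
      -- `j`, and the derivation extending the removed map `F c₀` is then applied. The Leibniz terms
      -- at the slots of `S.erase c₀` are covered by the induction hypothesis.
      set F' := Function.update F c₀ j with hF'
      have hcard : (S.erase c₀).card = m := by rw [Finset.card_erase_of_mem hc₀, hS]; rfl
      have hF'j : ∀ c, c ∉ S.erase c₀ → F' c = j := by
        intro c hc
        by_cases h : c = c₀
        · subst h; simp [hF']
        · rw [hF', Function.update_of_ne h]
          exact hF c fun h' => hc (Finset.mem_erase.2 ⟨h, h'⟩)
      have h1 := hK (F c₀) _ (ih (S.erase c₀) F' hcard hF'j)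
      rw [tensorEnd_comp_normalOrdered, ← Finset.sum_add_sum_compl (S.erase c₀)] at h1
      have h2 : ∑ c ∈ S.erase c₀, normalOrdered (Function.update F' c (D (F c₀) ∘ₗ F' c)) ∈ K := by
        refine K.sum_mem fun c hc => ih (S.erase c₀) _ hcard fun d hd => ?_
        rw [Function.update_of_ne fun h => hd (by rw [h]; exact hc)]
        exact hF'j d hd
      have h3 := (K.add_mem_iff_right h2).1 h1
      -- Every other slot holds `j`, so the derivation restores `F c₀` there, up to the exchange of
      -- two labels that symmetrization ignores. These terms are all equal, and their number is
      -- nonzero in `k`.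
      have h4 : ∀ c ∈ (S.erase c₀)ᶜ,
          normalOrdered (Function.update F' c (D (F c₀) ∘ₗ F' c)) = normalOrdered F := by
        intro c hc
        rw [hF'j c (Finset.mem_compl.1 hc), hD, ← normalOrdered_comp_perm F (Equiv.swap c c₀)]
        congr 1
        funext d
        by_cases h : d = c
        · subst h; simp
        · rw [Function.update_of_ne h]
          by_cases h' : d = c₀
          · subst h'
            rw [hF', Function.update_self, Equiv.swap_apply_right]
            by_cases hcS : c ∈ S
            · exact absurd (Finset.mem_erase.2 ⟨Ne.symm h, hcS⟩) (Finset.mem_compl.1 hc)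
            · exact (hF c hcS).symm
          · rw [hF', Function.update_of_ne h', Equiv.swap_apply_of_ne_of_ne h h']
      rw [Finset.sum_congr rfl h4, Finset.sum_const, ← Nat.cast_smul_eq_nsmul k] at h3
      have h5 : ((S.erase c₀)ᶜ.card : k) ≠ 0 := by
        rw [Nat.cast_ne_zero]
        exact (Finset.card_pos.2 ⟨c₀, by simp⟩).ne'
      exact (K.smul_mem_iff h5).1 h3
  exact main _ Finset.univ F rfl (by simp)

end NormalOrdered

/-! ### Row tensors and symmetrized rank-one maps -/

section RowTensor
variable {k : Type*} [Field k] {n : ℕ} {μ : YoungDiagram} (hμ : μ.colLen 0 ≤ n)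

/-- The row of a cell. -/
def rowIdx (c : μ.cells) : Fin n :=
  ⟨c.1.1, (YoungDiagram.mem_iff_lt_colLen.1
    (μ.up_left_mem le_rfl (Nat.zero_le c.1.2) ((YoungDiagram.mem_cells _).1 c.2))).trans_le hμ⟩

theorem mem_rowPerms_iff_rowIdx {σ : Equiv.Perm μ.cells} :
    σ ∈ rowPerms μ ↔ ∀ c, rowIdx hμ (σ c) = rowIdx hμ c := by
  simp [mem_rowPerms, rowIdx]

variable (k)

/-- A basis tensor of a tensor power of `k^n`. -/
noncomputable def basisTensor {C : Type*} {B : Type*} (f : C → B) : ⨂[k] _ : C, (B →₀ k) :=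
  PiTensorProduct.tprod k fun c => Finsupp.single (f c) 1

theorem reindex_basisTensor {C B : Type*} (f : C → B) (σ : Equiv.Perm C) :
    PiTensorProduct.reindex k (fun _ => B →₀ k) σ (basisTensor k f) =
      basisTensor k fun c => f (σ.symm c) :=
  PiTensorProduct.reindex_tprod _ _

theorem span_basisTensor {C B : Type*} [Finite C] :
    Submodule.span k (Set.range (basisTensor k : (C → B) → _)) = ⊤ := by
  rw [← (Basis.piTensorProduct fun _ : C => Finsupp.basisSingleOne (R := k) (ι := B)).span_eq]
  congr 2
  funext f
  rw [Basis.piTensorProduct_apply]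
  simp [basisTensor]

theorem linearMap_ext_basisTensor {C B : Type*} [Finite C] {X : Type*} [AddCommGroup X] [Module k X]
    {θ θ' : (⨂[k] _ : C, (B →₀ k)) →ₗ[k] X}
    (h : ∀ f : C → B, θ (basisTensor k f) = θ' (basisTensor k f)) : θ = θ' :=
  LinearMap.ext_on_range (span_basisTensor k) h

/-- A coordinate on a tensor power of `k^n`. -/
noncomputable def basisTensorCoord {C B : Type*} [Fintype C] (f : C → B) :
    (⨂[k] _ : C, (B →₀ k)) →ₗ[k] k :=
  PiTensorProduct.lift ((MultilinearMap.mkPiAlgebra k C k).compLinearMap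
    fun c => Finsupp.lapply (f c))

theorem basisTensorCoord_basisTensor {C B : Type*} [Fintype C] [DecidableEq (C → B)]
    (f g : C → B) : basisTensorCoord k f (basisTensor k g) = if f = g then 1 else 0 := by
  classical
  simp only [basisTensorCoord, basisTensor, PiTensorProduct.lift.tprod,
    MultilinearMap.compLinearMap_apply, MultilinearMap.mkPiAlgebra_apply, Finsupp.lapply_apply,
    Finsupp.single_apply]
  split_ifs with h
  · subst h; simp
  · obtain ⟨c, hc⟩ := Function.ne_iff.1 h
    exact Finset.prod_eq_zero (Finset.mem_univ c) (if_neg fun h => hc h.symm)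

theorem exists_basisTensorCoord_ne_zero {C B : Type*} [Fintype C] {t : ⨂[k] _ : C, (B →₀ k)}
    (ht : t ≠ 0) : ∃ f, basisTensorCoord k f t ≠ 0 := by
  classical
  set b := Basis.piTensorProduct fun _ : C => Finsupp.basisSingleOne (R := k) (ι := B)
  by_contra! h
  refine ht (b.repr.map_eq_zero_iff.1 (Finsupp.ext fun f => ?_))
  have : basisTensorCoord k f = b.coord f := by
    refine linearMap_ext_basisTensor k fun g => ?_
    have hg : b g = basisTensor k g := by
      simp [b, Basis.piTensorProduct_apply, basisTensor]
    rw [basisTensorCoord_basisTensor, ← hg, b.coord_apply, b.repr_self, Finsupp.single_apply]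
    simp only [eq_comm]
  rw [Finsupp.zero_apply, ← h f, this, b.coord_apply]

theorem normalOrdered_basisTensor {V : Type*} [AddCommGroup V] [Module k V]
    {C B : Type*} [Fintype C] [DecidableEq C] [DecidableEq B] (f g : C → B) (s : C → V) :
    normalOrdered (fun c => LinearMap.toSpanSingleton k V (s c) ∘ₗ Finsupp.lapply (f c))
      (basisTensor k g) = ∑ h : Equiv.Perm C, if (fun c => f (h c)) = g then
        PiTensorProduct.tprod k (fun c => s (h c)) else 0 := by
  rw [basisTensor, normalOrdered_tprod]
  refine Finset.sum_congr rfl fun h _ => ?_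
  split_ifs with hg
  · subst hg; simp
  · obtain ⟨c, hc⟩ := Function.ne_iff.1 hg
    refine (PiTensorProduct.tprod k).map_coord_zero c ?_
    simp [Ne.symm hc]

/-- The highest weight vector before symmetrization. -/
noncomputable def rowTensor : ⨂[k] _ : μ.cells, (Fin n →₀ k) := basisTensor k (rowIdx hμ)

/-- For a pure tensor `s`, symmetrize the rank-one maps that send the basis vector of the row of `c`
to `s c` and kill the other basis vectors. On a basis tensor only the permutations matching the row
labels survive; for the row tensor these form the row group, which produces the row sum. -/
theorem exists_normalOrdered_rowTensor {V : Type*} [AddCommGroup V] [Module k V]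
    (s : ⨂[k] _ : μ.cells, V) :
    ∃ θ ∈ Submodule.span k (Set.range (normalOrdered (W := Fin n →₀ k) (V := V) (k := k)
        (C := μ.cells))), IsPermEquivariant θ ∧
      θ (rowTensor k hμ) = permAct k μ.cells V (rowSum k μ) s ∧
      ∀ f : μ.cells → Fin n, (∀ g : Equiv.Perm μ.cells, f ≠ fun c => rowIdx hμ (g c)) →
        θ (basisTensor k f) = 0 := by
  induction s using PiTensorProduct.induction_on' with
  | add x y hx hy =>
    obtain ⟨θ, h1, h2, h3, h4⟩ := hx
    obtain ⟨θ', h1', h2', h3', h4'⟩ := hy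
    refine ⟨θ + θ', Submodule.add_mem _ h1 h1', fun σ t => ?_, ?_, fun f hf => ?_⟩
    · simp [h2 σ t, h2' σ t]
    · simp [h3, h3']
    · simp [h4 f hf, h4' f hf]
  | tprodCoeff r s =>
    refine ⟨r • normalOrdered
      (fun c => LinearMap.toSpanSingleton k V (s c) ∘ₗ Finsupp.lapply (rowIdx hμ c)),
      Submodule.smul_mem _ _ (Submodule.subset_span ⟨_, rfl⟩), fun σ t => ?_, ?_, fun f hf => ?_⟩
    · simp [isPermEquivariant_normalOrdered _ σ t]
    · rw [LinearMap.smul_apply, rowTensor, normalOrdered_basisTensor,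
        PiTensorProduct.tprodCoeff_eq_smul_tprod, map_smul, rowSum, map_sum, LinearMap.sum_apply,
        ← Finset.sum_filter]
      congr 1
      refine Finset.sum_bij' (fun g _ => g⁻¹) (fun g _ => g⁻¹) (fun g hg => ?_) (fun g hg => ?_)
        (by simp) (by simp) fun g _ => ?_
      · exact inv_mem_rowPerms ((mem_rowPerms_iff_rowIdx hμ).2 (congrFun (by simpa using hg)))
      · simpa using funext ((mem_rowPerms_iff_rowIdx hμ).1 (inv_mem_rowPerms hg))
      · rw [permAct_of, LinearEquiv.coe_coe, PiTensorProduct.reindex_tprod]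
        rfl
    · rw [LinearMap.smul_apply, normalOrdered_basisTensor, Finset.sum_eq_zero, smul_zero]
      exact fun g _ => if_neg fun h => hf g h.symm

end RowTensor
end LinearOperad

namespace LinearOperad

/-! ### Noncommutative polynomials in `gl_n` and highest weight vectors -/

section FreeAct
variable {k : Type*} [Field k] {G M M' : Type*} [AddCommGroup M] [Module k M]
  [AddCommGroup M'] [Module k M']

/-- Noncommutative polynomials in the elements of `G` acting through a map `G → End(M)`. -/
noncomputable def freeAct (ρ : G → Module.End k M) : FreeAlgebra k G →ₐ[k] Module.End k M :=
  FreeAlgebra.lift k ρ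

theorem freeAct_ι (ρ : G → Module.End k M) (A : G) : freeAct ρ (FreeAlgebra.ι k A) = ρ A :=
  FreeAlgebra.lift_ι_apply _ _

theorem freeAct_map {ρ : G → Module.End k M} {ρ' : G → Module.End k M'} {f : M →ₗ[k] M'}
    (h : ∀ A m, f (ρ A m) = ρ' A (f m)) (w : FreeAlgebra k G) (m : M) :
    f (freeAct ρ w m) = freeAct ρ' w (f m) := by
  induction w using FreeAlgebra.induction generalizing m with
  | grade0 c => simp [Module.algebraMap_end_apply]
  | grade1 A => rw [freeAct_ι, freeAct_ι, h]
  | mul x y hx hy => rw [map_mul, map_mul, Module.End.mul_apply, Module.End.mul_apply, hx, hy]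
  | add x y hx hy => rw [map_add, map_add, LinearMap.add_apply, LinearMap.add_apply, map_add, hx, hy]

theorem freeAct_mem {ρ : G → Module.End k M} {K : Submodule k M} (h : ∀ A, ∀ m ∈ K, ρ A m ∈ K)
    (w : FreeAlgebra k G) {m : M} (hm : m ∈ K) : freeAct ρ w m ∈ K := by
  induction w using FreeAlgebra.induction generalizing m with
  | grade0 c => simpa [Module.algebraMap_end_apply] using K.smul_mem c hm
  | grade1 A => rw [freeAct_ι]; exact h A m hm
  | mul x y hx hy => rw [map_mul, Module.End.mul_apply]; exact hx (hy hm)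
  | add x y hx hy => rw [map_add, LinearMap.add_apply]; exact K.add_mem (hx hm) (hy hm)

theorem freeAct_prod (ρ : G → Module.End k M) (ρ' : G → Module.End k M') (w : FreeAlgebra k G)
    (m : M) (m' : M') : freeAct (fun A => (ρ A).prodMap (ρ' A)) w (m, m') =
      (freeAct ρ w m, freeAct ρ' w m') :=
  Prod.ext
    (freeAct_map (f := LinearMap.fst k M M')
      (ρ := fun A => (ρ A).prodMap (ρ' A)) (ρ' := ρ) (fun _ _ => rfl) w (m, m'))
    (freeAct_map (f := LinearMap.snd k M M')
      (ρ := fun A => (ρ A).prodMap (ρ' A)) (ρ' := ρ') (fun _ _ => rfl) w (m, m'))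

end FreeAct

theorem end_lie_apply {k M : Type*} [CommRing k] [AddCommGroup M] [Module k M]
    (f g : Module.End k M) (x : M) : ⁅f, g⁆ x = f (g x) - g (f x) := rfl

section ElemEnd
variable (k : Type*) [Field k] {B : Type*}

/-- The matrix unit `E_{ij}`, which maps `x_j` to `x_i`. -/
noncomputable def elemEnd (i j : B) : Module.End k (B →₀ k) :=
  LinearMap.toSpanSingleton k _ (Finsupp.single i 1) ∘ₗ Finsupp.lapply j

theorem elemEnd_single [DecidableEq B] (i j l : B) :
    elemEnd k i j (Finsupp.single l 1) = if l = j then Finsupp.single i 1 else 0 := by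
  simp only [elemEnd, LinearMap.comp_apply, Finsupp.lapply_apply, Finsupp.single_apply,
    LinearMap.toSpanSingleton_apply]
  split_ifs <;> simp

theorem eq_sum_elemEnd {n : ℕ} (A : Module.End k (Fin n →₀ k)) :
    A = ∑ i, ∑ j, A (Finsupp.single j 1) i • elemEnd k i j := by
  ext l i
  simp [elemEnd_single]

/-- The endomorphism with `x_i ↦ α_i x_i`. -/
noncomputable def diagEnd (α : B → k) : Module.End k (B →₀ k) :=
  Finsupp.linearCombination k fun b => Finsupp.single b (α b)

theorem diagEnd_single (α : B → k) (b : B) :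
    diagEnd k α (Finsupp.single b 1) = α b • Finsupp.single b 1 := by
  simp [diagEnd]

theorem diagEnd_eq_sum {n : ℕ} (α : Fin n → k) : diagEnd k α = ∑ i, α i • elemEnd k i i := by
  ext l i
  simp [elemEnd_single, diagEnd_single, Finsupp.single_apply]

theorem elemEnd_self [DecidableEq B] (i : B) : elemEnd k i i = diagEnd k (Pi.single i 1) := by
  ext l : 2
  simp [elemEnd_single, diagEnd_single, Pi.single_apply]
  split_ifs with h
  · rw [h]
  · rfl

theorem lie_diagEnd_elemEnd (α : B → k) (i j : B) :
    ⁅diagEnd k α, elemEnd k i j⁆ = (α i - α j) • elemEnd k i j := by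
  classical
  ext l : 2
  simp only [LinearMap.comp_apply, Finsupp.lsingle_apply, end_lie_apply, elemEnd_single,
    diagEnd_single, map_smul, LinearMap.smul_apply]
  split_ifs with h
  · rw [h, diagEnd_single, sub_smul]
  · simp

theorem lie_elemEnd_swap [DecidableEq B] (i j : B) :
    ⁅elemEnd k i j, elemEnd k j i⁆ + elemEnd k j j = elemEnd k i i := by
  ext l : 2
  simp only [LinearMap.comp_apply, Finsupp.lsingle_apply, end_lie_apply, LinearMap.add_apply,
    elemEnd_single]
  split_ifs <;> simp_all [elemEnd_single]

end ElemEnd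

section HighestWeight
variable {k : Type*} [Field k] {n : ℕ} {M : Type*} [AddCommGroup M] [Module k M]
  (ρ : Module.End k (Fin n →₀ k) →ₗ⁅k⁆ Module.End k M)

/-- `v` is annihilated by the raising operators and has weight `κ`. -/
structure IsHighestWeight (κ : Fin n → k) (v : M) : Prop where
  weight : ∀ i, ρ (elemEnd k i i) v = κ i • v
  raise : ∀ i j, i < j → ρ (elemEnd k i j) v = 0

variable {ρ}

theorem map_diagEnd_of_weight {κ : Fin n → k} {v : M} (h : ∀ i, ρ (elemEnd k i i) v = κ i • v)
    (α : Fin n → k) : ρ (diagEnd k α) v = (∑ i, α i * κ i) • v := by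
  rw [diagEnd_eq_sum, map_sum, LinearMap.sum_apply, Finset.sum_smul]
  refine Finset.sum_congr rfl fun i _ => ?_
  rw [map_smul, LinearMap.smul_apply, h, smul_smul]

theorem elemEnd_mem_eigenspace {α : Fin n → k} {s : k} {v : M}
    (hv : v ∈ (ρ (diagEnd k α)).eigenspace s) (i j : Fin n) :
    ρ (elemEnd k i j) v ∈ (ρ (diagEnd k α)).eigenspace (s + (α i - α j)) := by
  rw [Module.End.mem_eigenspace_iff] at *
  have h := LinearMap.congr_fun (ρ.map_lie (diagEnd k α) (elemEnd k i j)) v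
  rw [lie_diagEnd_elemEnd, map_smul, end_lie_apply, hv, map_smul, eq_sub_iff_add_eq] at h
  rw [← h, LinearMap.smul_apply, add_smul, add_comm]

/-- The submodule generated by a highest weight vector is reached by lowering operators alone, and
these strictly lower the eigenvalue of a suitable diagonal element, so the top eigenspace contains
only multiples of `v`. A minimality argument replaces the Poincaré–Birkhoff–Witt theorem. -/
theorem IsHighestWeight.eq_smul [CharZero k] {κ : Fin n → k} {v : M} (hv : IsHighestWeight ρ κ v)
    (w : FreeAlgebra k (Module.End k (Fin n →₀ k)))
    (hw : ∀ i, ρ (elemEnd k i i) (freeAct ρ w v) = κ i • freeAct ρ w v) :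
    ∃ c : k, freeAct ρ w v = c • v := by
  -- With these entries the matrix unit `E_{ij}`, `j < i`, shifts the eigenvalue of the diagonal
  -- element by the negative integer `j - i`.
  set α : Fin n → k := fun i => -(i.1 : k) with hα
  set Z := ρ (diagEnd k α) with hZ
  set ζ := ∑ i, α i * κ i
  set N₁ : Submodule k M := ⨆ l : ℕ, Z.eigenspace (ζ - (l + 1)) with hN₁
  have hlow : ∀ i j : Fin n, j < i → ∃ l : ℕ, α i - α j = -((l : k) + 1) := by
    intro i j hij
    refine ⟨i.1 - j.1 - 1, ?_⟩
    have : i.1 = (i.1 - j.1 - 1) + 1 + j.1 := by have : j.1 < i.1 := hij; omega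
    simp only [hα]
    rw [this]
    push_cast
    ring_nf
    simp
  have hvζ : v ∈ Z.eigenspace ζ := Module.End.mem_eigenspace_iff.2 (map_diagEnd_of_weight hv.weight α)
  let S : Set (Submodule k M) := {K | v ∈ K ∧ ∀ i j : Fin n, j < i → ∀ x ∈ K, ρ (elemEnd k i j) x ∈ K}
  set N := sInf S with hN
  have hvN : v ∈ N := Submodule.mem_sInf.2 fun K hK => hK.1
  have hNlow : ∀ i j : Fin n, j < i → ∀ x ∈ N, ρ (elemEnd k i j) x ∈ N := fun i j hij x hx =>
    Submodule.mem_sInf.2 fun K hK => hK.2 i j hij x (Submodule.mem_sInf.1 hx K hK)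
  have hNle : N ≤ k ∙ v ⊔ N₁ := by
    refine sInf_le ⟨Submodule.mem_sup_left (Submodule.mem_span_singleton_self v), ?_⟩
    intro i j hij x hx
    obtain ⟨l, hl⟩ := hlow i j hij
    obtain ⟨y, hy, z, hz, rfl⟩ := Submodule.mem_sup.1 hx
    obtain ⟨c, rfl⟩ := Submodule.mem_span_singleton.1 hy
    refine Submodule.mem_sup_right ?_
    rw [map_add, map_smul]
    refine N₁.add_mem (N₁.smul_mem c (Submodule.mem_iSup_of_mem l ?_)) ?_
    · have := elemEnd_mem_eigenspace hvζ i j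
      rwa [hl, ← sub_eq_add_neg] at this
    · have : N₁ ≤ N₁.comap (ρ (elemEnd k i j)) := by
        conv_lhs => rw [hN₁]
        refine iSup_le fun m y hy => Submodule.mem_comap.2 (Submodule.mem_iSup_of_mem (m + l + 1) ?_)
        have := elemEnd_mem_eigenspace hy i j
        rw [hl] at this
        convert this using 2
        push_cast
        ring
      exact this hz
  -- The vectors of `N` that all of `gl_n` maps into `N` include `v`, and they are stable under
  -- lowering operators because `A E = [A, E] + E A`. By minimality they are all of `N`.
  have hNst : ∀ A, ∀ x ∈ N, ρ A x ∈ N := by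
    have : N ≤ N ⊓ ⨅ A, N.comap (ρ A) := by
      refine sInf_le ⟨⟨hvN, Submodule.mem_iInf _ |>.2 fun A => ?_⟩, ?_⟩
      · rw [Submodule.mem_comap, eq_sum_elemEnd k A]
        simp only [map_sum, LinearMap.sum_apply, map_smul, LinearMap.smul_apply]
        refine N.sum_mem fun i _ => N.sum_mem fun j _ => N.smul_mem _ ?_
        rcases lt_trichotomy i j with h | h | h
        · rw [hv.raise i j h]; exact N.zero_mem
        · rw [h, hv.weight]; exact N.smul_mem _ hvN
        · exact hNlow i j h v hvN
      · rintro i j hij x ⟨hx, hx'⟩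
        refine ⟨hNlow i j hij x hx, Submodule.mem_iInf _ |>.2 fun A => ?_⟩
        have h := LinearMap.congr_fun (ρ.map_lie A (elemEnd k i j)) x
        rw [end_lie_apply, eq_sub_iff_add_eq] at h
        rw [Submodule.mem_comap, ← h]
        exact N.add_mem ((Submodule.mem_iInf _).1 hx' _)
          (hNlow i j hij _ ((Submodule.mem_iInf _).1 hx' A))
    exact fun A x hx => (Submodule.mem_iInf _).1 (this hx).2 A
  obtain ⟨y, hy, z, hz, hyz⟩ := Submodule.mem_sup.1 (hNle (freeAct_mem hNst w hvN))
  obtain ⟨c, rfl⟩ := Submodule.mem_span_singleton.1 hy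
  refine ⟨c, ?_⟩
  have h1 : z ∈ Z.eigenspace ζ := by
    have : z = freeAct ρ w v - c • v := by rw [← hyz]; simp
    rw [this]
    exact Submodule.sub_mem _
      (Module.End.mem_eigenspace_iff.2 (map_diagEnd_of_weight hw α)) (Submodule.smul_mem _ c hvζ)
  -- The error term has eigenvalue `ζ` but also lies in the sum of the eigenspaces for `ζ - (l +
  -- 1)`. These values differ from `ζ` in characteristic zero, so independence of eigenspaces kills
  -- it.
  have h2 : z ∈ ⨆ s, ⨆ (_ : s ≠ ζ), Z.eigenspace s := by
    refine (iSup_le fun l => ?_ : N₁ ≤ _) hz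
    refine le_iSup₂_of_le (ζ - (l + 1)) (fun h => ?_) le_rfl
    rw [sub_eq_self] at h
    exact Nat.cast_add_one_ne_zero l h
  have h3 := Submodule.disjoint_def.1 (Module.End.eigenspaces_iSupIndep Z ζ) z h1 h2
  rw [← hyz, h3, add_zero]

end HighestWeight
end LinearOperad

namespace LinearOperad

/-! ### The highest weight tensor and simplicity of `S_μ(k^n)` -/

section TensorWeights
variable (k : Type*) [Field k] (C : Type*) [Fintype C] [DecidableEq C]

/-- The action on tensor powers as a homomorphism of Lie algebras. -/
noncomputable def tensorEndHom (M : Type*) [AddCommGroup M] [Module k M] :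
    Module.End k M →ₗ⁅k⁆ Module.End k (⨂[k] _ : C, M) where
  toFun := tensorEnd k C
  map_add' := tensorEnd_add C
  map_smul' := tensorEnd_smul C
  map_lie' := tensorEnd_lie C _ _

/-- The action of noncommutative polynomials in endomorphisms on tensor powers. -/
noncomputable abbrev tensorAct (W : Type*) [AddCommGroup W] [Module k W] :
    FreeAlgebra k (Module.End k W) →ₐ[k] Module.End k (⨂[k] _ : C, W) :=
  freeAct (tensorEnd k C)

variable {k C}

theorem tensorEnd_diagEnd_basisTensor {B : Type*} (α : B → k) (f : C → B) :
    tensorEnd k C (diagEnd k α) (basisTensor k f) = (∑ c, α (f c)) • basisTensor k f := by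
  rw [basisTensor, tensorEnd_tprod, Finset.sum_smul]
  refine Finset.sum_congr rfl fun c _ => ?_
  rw [diagEnd_single, MultilinearMap.map_update_smul, Function.update_eq_self]

theorem tensorEnd_diagEnd_permAct {B : Type*} (α : B → k) (f : C → B)
    (z : MonoidAlgebra k (Equiv.Perm C)) :
    tensorEnd k C (diagEnd k α) (permAct k C _ z (basisTensor k f)) =
      (∑ c, α (f c)) • permAct k C _ z (basisTensor k f) := by
  rw [(isPermEquivariant_tensorEnd _).map_permAct, tensorEnd_diagEnd_basisTensor, map_smul]

/-- A half of Schur–Weyl duality: the operators coming from `gl(W)` contain the identity and are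
stable under left multiplication by `gl(W)`, so `normalOrdered_mem` applies with the identity as
`j`. -/
theorem exists_freeAct_eq_of_mem_span_normalOrdered [CharZero k] {W : Type*} [AddCommGroup W]
    [Module k W] {θ : (⨂[k] _ : C, W) →ₗ[k] ⨂[k] _ : C, W}
    (hθ : θ ∈ Submodule.span k (Set.range (normalOrdered (W := W) (V := W) (k := k) (C := C)))) :
    ∃ w, tensorAct k C W w = θ := by
  have : Submodule.span k (Set.range (normalOrdered (W := W) (V := W) (k := k) (C := C))) ≤
      LinearMap.range (tensorAct k C W).toLinearMap := by
    rw [Submodule.span_le]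
    rintro _ ⟨F, rfl⟩
    refine normalOrdered_mem (j := LinearMap.id) (D := fun f => f) (fun f => rfl) (LinearMap.range
      (tensorAct k C W).toLinearMap) (LinearMap.mem_range.2 ⟨1, ?_⟩) ?_ F
    · rw [PiTensorProduct.map_id, AlgHom.toLinearMap_apply, map_one]; rfl
    · rintro f _ ⟨w, rfl⟩
      refine ⟨FreeAlgebra.ι k f * w, ?_⟩
      rw [AlgHom.toLinearMap_apply, map_mul, freeAct_ι]
      rfl
  exact this hθ

end TensorWeights

section HWTensor
variable (k : Type*) [Field k] {n : ℕ} {μ : YoungDiagram} (hμ : μ.colLen 0 ≤ n)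

/-- The highest weight vector of `S_μ(k^n)`. -/
noncomputable def hwTensor : ⨂[k] _ : μ.cells, (Fin n →₀ k) :=
  youngSymmetrizer k μ _ (rowTensor k hμ)

theorem hwTensor_eq : hwTensor k hμ =
    permAct k μ.cells _ (rowSum k μ * colSum k μ) (rowTensor k hμ) := by
  rw [hwTensor, youngSymmetrizer_eq_permAct]

variable {k}

theorem reindex_youngSymmetrizer {M : Type*} [AddCommGroup M] [Module k M]
    {σ : Equiv.Perm μ.cells} (hσ : σ ∈ rowPerms μ)
    (t : ⨂[k] _ : μ.cells, M) : PiTensorProduct.reindex k (fun _ => M) σ (youngSymmetrizer k μ M t) =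
      youngSymmetrizer k μ M t := by
  rw [youngSymmetrizer_eq_permAct, ← LinearEquiv.coe_coe, ← permAct_of, ← Module.End.mul_apply,
    ← map_mul, ← mul_assoc, of_mul_rowSum hσ]

variable (k) in
theorem card_rowPerms_ne_zero [CharZero k] : ((rowPerms μ).card : k) ≠ 0 :=
  Nat.cast_ne_zero.2 (Finset.card_pos.2 ⟨1, mem_rowPerms.2 fun _ => rfl⟩).ne'

variable (k) in
-- The coordinate at the row tensor is the order of the row group: a term `σ τ` contributes only if
-- `τ` also preserves rows, and then `τ = 1`.
theorem hwTensor_ne_zero [CharZero k] : hwTensor k hμ ≠ 0 := by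
  classical
  intro h
  have h1 := congrArg (basisTensorCoord k (rowIdx hμ)) h
  rw [hwTensor, rowTensor, basisTensor, youngSymmetrizer_tprod, map_zero, map_sum] at h1
  refine card_rowPerms_ne_zero k (μ := μ) ?_
  rw [← h1, ← nsmul_one, ← Finset.sum_const]
  refine Finset.sum_congr rfl fun σ hσ => ?_
  rw [map_sum, Finset.sum_eq_single 1]
  · rw [map_smul]
    change 1 = _ • basisTensorCoord k (rowIdx hμ) (basisTensor k fun c => rowIdx hμ (σ.symm c))
    have h2 : (fun c => rowIdx hμ (σ.symm c)) = rowIdx hμ :=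
      funext ((mem_rowPerms_iff_rowIdx hμ).1 (inv_mem_rowPerms hσ))
    rw [h2, basisTensorCoord_basisTensor, if_pos rfl]
    simp
  · intro τ hτ hτ1
    rw [map_smul]
    change _ • basisTensorCoord k (rowIdx hμ)
      (basisTensor k fun c => rowIdx hμ (τ.symm (σ.symm c))) = 0
    rw [basisTensorCoord_basisTensor, if_neg, smul_zero]
    intro h2
    refine hτ1 (eq_one_of_mem_rowPerms_of_mem_colPerms ((mem_rowPerms_iff_rowIdx hμ).2 fun c => ?_) hτ)
    have h3 := congrFun h2 (σ (τ c))
    rw [Equiv.symm_apply_apply, Equiv.symm_apply_apply,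
      (mem_rowPerms_iff_rowIdx hμ).1 hσ] at h3
    exact h3
  · exact fun h => absurd (mem_colPerms.2 fun _ => rfl) h

/-- The weight of the highest weight vector: the row lengths. -/
noncomputable def rowWeight (i : Fin n) : ℕ := (Finset.univ.filter fun c => rowIdx hμ c = i).card

theorem tensorEnd_diagEnd_permAct_rowTensor (α : Fin n → k)
    (z : MonoidAlgebra k (Equiv.Perm μ.cells)) :
    tensorEnd k μ.cells (diagEnd k α) (permAct k μ.cells _ z (rowTensor k hμ)) =
      (∑ c, α (rowIdx hμ c)) • permAct k μ.cells _ z (rowTensor k hμ) :=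
  tensorEnd_diagEnd_permAct α _ z

theorem tensorEnd_elemEnd_permAct_rowTensor (i : Fin n)
    (z : MonoidAlgebra k (Equiv.Perm μ.cells)) :
    tensorEnd k μ.cells (elemEnd k i i) (permAct k μ.cells _ z (rowTensor k hμ)) =
      (rowWeight hμ i : k) • permAct k μ.cells _ z (rowTensor k hμ) := by
  rw [elemEnd_self, tensorEnd_diagEnd_permAct_rowTensor, rowWeight]
  simp [Pi.single_apply, Finset.sum_boole]

variable (k)

/-- A raising operator turns the entry of a cell `c` in row `j` into `x_i` with `i < j`. The cell of
row `i` in the same column already carries `x_i`, so the new tensor is invariant under the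
transposition of these two cells, and the signed column sum annihilates it. -/
theorem isHighestWeight_hwTensor [CharZero k] : IsHighestWeight (tensorEndHom k μ.cells (Fin n →₀ k))
    (fun i => (rowWeight hμ i : k)) (hwTensor k hμ) where
  weight i := by
    rw [hwTensor_eq]
    exact tensorEnd_elemEnd_permAct_rowTensor hμ i _
  raise i j hij := by
    change tensorEnd k μ.cells _ _ = 0
    rw [hwTensor_eq, (isPermEquivariant_tensorEnd _).map_permAct, map_mul, Module.End.mul_apply,
      rowTensor, basisTensor, tensorEnd_tprod, map_sum, Finset.sum_eq_zero, map_zero]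
    intro c _
    rw [elemEnd_single]
    split_ifs with hc
    · have hi : (i.1, c.1.2) ∈ μ.cells := by
        refine (YoungDiagram.mem_cells _).2 (μ.up_left_mem ?_ le_rfl ((YoungDiagram.mem_cells _).1 c.2))
        have : c.1.1 = j.1 := congrArg Fin.val hc
        rw [this]
        exact hij.le
      set c' : μ.cells := ⟨(i.1, c.1.2), hi⟩ with hc'
      have hne : c' ≠ c := by
        intro h
        have : i.1 = c.1.1 := congrArg (fun x : μ.cells => x.1.1) h
        have h2 : c.1.1 = j.1 := congrArg Fin.val hc
        have h3 : i.1 < j.1 := hij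
        omega
      set t : ⨂[k] _ : μ.cells, (Fin n →₀ k) := PiTensorProduct.tprod k
        (Function.update (fun c => Finsupp.single (rowIdx hμ c) 1) c (Finsupp.single i 1)) with ht
      have hswap : Equiv.swap c' c ∈ colPerms μ := by
        rw [mem_colPerms]
        intro d
        rcases Equiv.swap_apply_eq_iff.1 (rfl : Equiv.swap c' c d = _) with h
        by_cases h1 : d = c'
        · subst h1; rw [Equiv.swap_apply_left]
        · by_cases h2 : d = c
          · subst h2; rw [Equiv.swap_apply_right]
          · rw [Equiv.swap_apply_of_ne_of_ne h1 h2]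
      have h1 : permAct k μ.cells _ (MonoidAlgebra.of k _ (Equiv.swap c' c)) t = t := by
        rw [permAct_of, LinearEquiv.coe_coe, ht, PiTensorProduct.reindex_tprod]
        congr 1
        funext d
        rw [Equiv.symm_swap]
        have hrow : rowIdx hμ c' = i := rfl
        by_cases h1 : d = c'
        · rw [h1, Equiv.swap_apply_left, Function.update_self, Function.update_of_ne hne, hrow]
        · by_cases h2 : d = c
          · rw [h2, Equiv.swap_apply_right, Function.update_self, Function.update_of_ne hne, hrow]
          · rw [Equiv.swap_apply_of_ne_of_ne h1 h2]
      have h2 : colSum k μ * MonoidAlgebra.of k _ (Equiv.swap c' c) + colSum k μ = 0 := by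
        rw [colSum_mul_of hswap, Equiv.Perm.sign_swap hne, Units.val_neg, Units.val_one,
          Int.cast_neg, Int.cast_one, neg_smul, one_smul, neg_add_cancel]
      have h3 : (2 : k) • permAct k μ.cells (Fin n →₀ k) (colSum k μ) t = 0 := by
        have := LinearMap.congr_fun (congrArg (permAct k μ.cells (Fin n →₀ k)) h2) t
        rw [map_add, map_mul, LinearMap.add_apply, Module.End.mul_apply, h1, map_zero] at this
        rw [two_smul]
        exact this
      exact (smul_eq_zero.1 h3).resolve_left two_ne_zero
    · rw [(PiTensorProduct.tprod k).map_coord_zero c (Function.update_self _ _ _), map_zero]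

variable {k} [CharZero k]

/-- A space of tensors that is stable under the derivations extending linear maps `W → V` and
contains the highest weight vector contains the image of the Young symmetrizer. -/
theorem range_youngSymmetrizer_le {V : Type*} [AddCommGroup V] [Module k V]
    {j : (Fin n →₀ k) →ₗ[k] V} {D : ((Fin n →₀ k) →ₗ[k] V) → Module.End k V}
    (hD : ∀ f, D f ∘ₗ j = f) (K : Submodule k (⨂[k] _ : μ.cells, V))
    (hj : PiTensorProduct.map (fun _ => j) (hwTensor k hμ) ∈ K)
    (hK : ∀ f, ∀ t ∈ K, tensorEnd k μ.cells (D f) t ∈ K) :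
    LinearMap.range (youngSymmetrizer k μ V) ≤ K := by
  rintro _ ⟨t, rfl⟩
  obtain ⟨y, hy⟩ := exists_youngSymmetrizer_regular k μ
  -- The tensor fed in is `y a b t`: equivariance gives `θ v = a b θ(e) = a b a y a b t`, and this
  -- is `a b t` by the choice of `y`.
  obtain ⟨θ, hθ, he, hr, -⟩ := exists_normalOrdered_rowTensor (k := k) hμ
    (permAct k μ.cells V (y * (rowSum k μ * colSum k μ)) t)
  have h1 : θ (hwTensor k hμ) ∈ K := by
    have : Submodule.span k (Set.range (normalOrdered (W := Fin n →₀ k) (V := V) (k := k)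
        (C := μ.cells))) ≤ K.comap (LinearMap.applyₗ (hwTensor k hμ)) := by
      rw [Submodule.span_le]
      rintro _ ⟨F, rfl⟩
      exact normalOrdered_mem hD _ hj (fun f φ hφ => hK f _ hφ) F
    exact this hθ
  rw [hwTensor_eq, he.map_permAct, hr, ← Module.End.mul_apply, ← map_mul, ← Module.End.mul_apply,
    ← map_mul] at h1
  simp only [mul_assoc] at h1 hy
  rwa [hy, ← youngSymmetrizer_eq_permAct] at h1

theorem exists_freeAct_hwTensor_eq {t : ⨂[k] _ : μ.cells, (Fin n →₀ k)}
    (ht : t ∈ LinearMap.range (youngSymmetrizer k μ (Fin n →₀ k))) :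
    ∃ w, tensorAct k μ.cells (Fin n →₀ k) w (hwTensor k hμ) = t := by
  let K : Submodule k (⨂[k] _ : μ.cells, (Fin n →₀ k)) := LinearMap.range
    (LinearMap.applyₗ (hwTensor k hμ) ∘ₗ (tensorAct k μ.cells (Fin n →₀ k)).toLinearMap)
  refine range_youngSymmetrizer_le hμ (j := LinearMap.id) (D := fun f => f) (fun f => rfl) K
    ⟨1, ?_⟩ ?_ ht
  · simp
  · rintro f _ ⟨w, rfl⟩
    refine ⟨FreeAlgebra.ι k f * w, ?_⟩
    simp [freeAct_ι]

variable (k) in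
/-- The projection to the span of the permutations of the highest weight vector is given by the
action of `gl_n`. -/
theorem exists_freeAct_projection :
    ∃ w, tensorAct k μ.cells (Fin n →₀ k) w (hwTensor k hμ) = hwTensor k hμ ∧
      ∀ t, ∃ z, tensorAct k μ.cells (Fin n →₀ k) w t = permAct k μ.cells _ z (hwTensor k hμ) := by
  obtain ⟨y, hy⟩ := exists_youngSymmetrizer_regular k μ
  -- With `y v` fed in, `θ v = a b a y a b e = v`. A permuted row tensor `g e` goes to `g a y v`,
  -- and the remaining basis tensors go to zero.
  obtain ⟨θ, hθ, he, hr, h0⟩ := exists_normalOrdered_rowTensor (k := k) hμ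
    (permAct k μ.cells (Fin n →₀ k) y (hwTensor k hμ))
  obtain ⟨w, hw⟩ := exists_freeAct_eq_of_mem_span_normalOrdered hθ
  refine ⟨w, ?_, fun t => ?_⟩
  · rw [hw]
    conv_lhs => rw [hwTensor_eq]
    rw [he.map_permAct, hr, hwTensor_eq, ← Module.End.mul_apply, ← map_mul, ← Module.End.mul_apply,
      ← map_mul, ← Module.End.mul_apply, ← map_mul]
    simp only [mul_assoc] at hy ⊢
    rw [hy]
  · rw [hw]
    have : t ∈ Submodule.span k (Set.range (basisTensor k : (μ.cells → Fin n) → _)) := by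
      rw [span_basisTensor]; trivial
    induction this using Submodule.span_induction with
    | mem t ht =>
      obtain ⟨f, rfl⟩ := ht
      by_cases hf : ∃ g : Equiv.Perm μ.cells, f = fun c => rowIdx hμ (g c)
      · obtain ⟨g, rfl⟩ := hf
        refine ⟨MonoidAlgebra.of k _ g⁻¹ * rowSum k μ * y, ?_⟩
        have h1 := he g⁻¹ (rowTensor k hμ)
        rw [rowTensor, reindex_basisTensor, ← rowTensor, hr] at h1
        refine Eq.trans h1 ?_
        rw [map_mul, map_mul, permAct_of]
        rfl
      · push Not at hf
        exact ⟨0, by rw [h0 f hf]; simp⟩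
    | zero => exact ⟨0, by simp⟩
    | add x y _ _ hx hy =>
      obtain ⟨z, hz⟩ := hx
      obtain ⟨z', hz'⟩ := hy
      exact ⟨z + z', by rw [map_add, hz, hz', map_add]; rfl⟩
    | smul c x _ hx =>
      obtain ⟨z, hz⟩ := hx
      exact ⟨c • z, by rw [map_smul, hz, map_smul]; rfl⟩

/-- Multiplicity one of the top weight: `gl_n` produces the tensor from the highest weight tensor,
so `IsHighestWeight.eq_smul` applies. -/
theorem exists_smul_hwTensor_of_weight {t : ⨂[k] _ : μ.cells, (Fin n →₀ k)}
    (ht : t ∈ LinearMap.range (youngSymmetrizer k μ (Fin n →₀ k)))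
    (h : ∀ i, tensorEnd k μ.cells (elemEnd k i i) t = (rowWeight hμ i : k) • t) :
    ∃ c : k, t = c • hwTensor k hμ := by
  obtain ⟨w, rfl⟩ := exists_freeAct_hwTensor_eq hμ ht
  exact (isHighestWeight_hwTensor k hμ).eq_smul w h

/-- The representation `S_μ(k^n)` of `gl_n` is simple. -/
theorem exists_freeAct_eq_hwTensor {t : ⨂[k] _ : μ.cells, (Fin n →₀ k)}
    (ht : t ∈ LinearMap.range (youngSymmetrizer k μ (Fin n →₀ k))) (h0 : t ≠ 0) :
    ∃ w, tensorAct k μ.cells (Fin n →₀ k) w t = hwTensor k hμ := by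
  classical
  obtain ⟨f, hf⟩ := exists_basisTensorCoord_ne_zero k h0
  -- For a nonzero coordinate `f` of `t`, these rank-one maps relabel `f` to the row function. The
  -- symmetrization sends `t` to a combination of permuted row tensors, all of the highest weight,
  -- and it preserves the image of the Young symmetrizer; so it produces a multiple of the highest
  -- weight tensor.
  set F : μ.cells → (Fin n →₀ k) →ₗ[k] (Fin n →₀ k) := fun c =>
    LinearMap.toSpanSingleton k _ (Finsupp.single (rowIdx hμ c) 1) ∘ₗ Finsupp.lapply (f c) with hF
  have h1 : ∀ t, normalOrdered F t = ∑ h : Equiv.Perm μ.cells,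
      basisTensorCoord k (fun c => f (h c)) t •
        basisTensor k fun c => rowIdx hμ (h c) := by
    intro t
    have : normalOrdered F = ∑ h : Equiv.Perm μ.cells,
        LinearMap.toSpanSingleton k _ (basisTensor k fun c => rowIdx hμ (h c)) ∘ₗ
          basisTensorCoord k (fun c => f (h c)) := by
      refine LinearMap.ext_on_range (span_basisTensor k) fun g => ?_
      rw [hF, normalOrdered_basisTensor]
      simp only [LinearMap.sum_apply, LinearMap.comp_apply, basisTensorCoord_basisTensor,
        LinearMap.toSpanSingleton_apply, ite_smul, one_smul, zero_smul]
      rfl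
    rw [this]
    simp [LinearMap.sum_apply]
  have h2 : ∃ z, normalOrdered F t = permAct k μ.cells _ z (rowTensor k hμ) := by
    refine ⟨∑ h : Equiv.Perm μ.cells,
      basisTensorCoord k (fun c => f (h c)) t • MonoidAlgebra.of k _ h⁻¹, ?_⟩
    rw [h1, map_sum, LinearMap.sum_apply]
    refine Finset.sum_congr rfl fun h _ => ?_
    rw [map_smul, LinearMap.smul_apply, permAct_of, LinearEquiv.coe_coe, rowTensor,
      reindex_basisTensor]
    rfl
  have hcoord : ∀ h ∈ rowPerms μ, basisTensorCoord k (fun c => f (h c)) t =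
      basisTensorCoord k f t := by
    intro h hh
    obtain ⟨s, rfl⟩ := ht
    conv_rhs => rw [← reindex_youngSymmetrizer hh s]
    have : basisTensorCoord k (fun c => f (h c)) = basisTensorCoord k f ∘ₗ
        (PiTensorProduct.reindex k (fun _ => Fin n →₀ k) h).toLinearMap := by
      refine linearMap_ext_basisTensor k fun g => ?_
      rw [LinearMap.comp_apply, LinearEquiv.coe_coe, reindex_basisTensor,
        basisTensorCoord_basisTensor, basisTensorCoord_basisTensor]
      congr 1
      refine propext ⟨fun e => ?_, fun e => ?_⟩
      · rw [← e]; simp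
      · rw [e]; simp
    rw [this]
    rfl
  -- The coordinate at the row tensor sums the coordinates of `t` at `f ∘ h` over the row group.
  -- They are all equal because `t` is invariant under that group, so the sum is the order of the
  -- group times a nonzero number.
  have h3 : normalOrdered F t ≠ 0 := by
    intro h
    have h4 := congrArg (basisTensorCoord k (rowIdx hμ)) h
    rw [h1, map_sum, map_zero] at h4
    simp only [map_smul, basisTensorCoord_basisTensor, smul_eq_mul, mul_ite, mul_one,
      mul_zero] at h4
    rw [← Finset.sum_filter] at h4
    have h5 : (Finset.univ.filter fun h : Equiv.Perm μ.cells =>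
        rowIdx hμ = fun c => rowIdx hμ (h c)) = rowPerms μ := by
      ext h
      rw [Finset.mem_filter, mem_rowPerms_iff_rowIdx hμ, funext_iff]
      simp [eq_comm]
    rw [h5, Finset.sum_congr rfl hcoord, Finset.sum_const, ← Nat.cast_smul_eq_nsmul k,
      smul_eq_mul] at h4
    exact mul_ne_zero (card_rowPerms_ne_zero k) hf h4
  obtain ⟨w, hw⟩ := exists_freeAct_eq_of_mem_span_normalOrdered
    (Submodule.subset_span (Set.mem_range_self F))
  have h4 : normalOrdered F t ∈ LinearMap.range (youngSymmetrizer k μ (Fin n →₀ k)) := by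
    obtain ⟨s, rfl⟩ := ht
    rw [youngSymmetrizer_eq_permAct, (isPermEquivariant_normalOrdered F).map_permAct]
    exact ⟨_, rfl⟩
  obtain ⟨c, hc⟩ := exists_smul_hwTensor_of_weight hμ h4 fun i => by
    obtain ⟨z, hz⟩ := h2
    rw [hz, tensorEnd_elemEnd_permAct_rowTensor]
  have hc0 : c ≠ 0 := by
    rintro rfl
    exact h3 (by rw [hc, zero_smul])
  refine ⟨c⁻¹ • w, ?_⟩
  rw [map_smul, LinearMap.smul_apply, hw, hc, smul_smul, inv_mul_cancel₀ hc0, one_smul]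

end HWTensor
end LinearOperad

namespace LinearOperad

/-! ### Natural weights and existence of dominant highest weight vectors -/

section LocallyNatSplit
variable {k : Type*} [Field k] {M M' : Type*} [AddCommGroup M] [Module k M]
  [AddCommGroup M'] [Module k M']

theorem aeval_map_apply {f : Module.End k M} {f' : Module.End k M'} {g : M →ₗ[k] M'}
    (h : ∀ m, g (f m) = f' (g m)) (p : Polynomial k) (m : M) :
    g (Polynomial.aeval f p m) = Polynomial.aeval f' p (g m) := by
  induction p using Polynomial.induction_on generalizing m with
  | C a => simp [Module.algebraMap_end_apply]
  | add p q hp hq => simp [hp, hq]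
  | monomial l a ih =>
    rw [pow_succ, ← mul_assoc, map_mul _ _ Polynomial.X, map_mul _ _ Polynomial.X, Polynomial.aeval_X, Polynomial.aeval_X,
      Module.End.mul_apply, Module.End.mul_apply, ih, h]

theorem aeval_apply_eigenvector {f : Module.End k M} {m : M} {c : k} (h : f m = c • m)
    (p : Polynomial k) : Polynomial.aeval f p m = p.eval c • m := by
  induction p using Polynomial.induction_on with
  | C a => simp [Module.algebraMap_end_apply]
  | add p q hp hq => simp [hp, hq, add_smul]
  | monomial l a ih =>
    rw [pow_succ, ← mul_assoc, map_mul _ _ Polynomial.X, Polynomial.aeval_X, Module.End.mul_apply, h, map_smul, ih,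
      Polynomial.eval_mul (q := Polynomial.X), Polynomial.eval_X, smul_smul, mul_comm]

/-- Every vector is annihilated by a product of distinct factors `f - s` with `s ∈ ℕ`. -/
def LocallyNatSplit (f : Module.End k M) : Prop :=
  ∀ m, ∃ S : Finset ℕ,
    Polynomial.aeval f (∏ s ∈ S, (Polynomial.X - Polynomial.C (s : k))) m = 0

theorem locallyNatSplit_of_span {f : Module.End k M} {s : Set M} (hs : Submodule.span k s = ⊤)
    (h : ∀ x ∈ s, ∃ c : ℕ, f x = (c : k) • x) : LocallyNatSplit f := by
  classical
  intro m
  have hm : m ∈ Submodule.span k s := by rw [hs]; trivial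
  have mono : ∀ {S T : Finset ℕ} {m : M}, S ⊆ T →
      Polynomial.aeval f (∏ s ∈ S, (Polynomial.X - Polynomial.C (s : k))) m = 0 →
      Polynomial.aeval f (∏ s ∈ T, (Polynomial.X - Polynomial.C (s : k))) m = 0 := by
    intro S T m hST h
    rw [← Finset.prod_sdiff hST, map_mul, Module.End.mul_apply, h, map_zero]
  induction hm using Submodule.span_induction with
  | mem x hx =>
    obtain ⟨c, hc⟩ := h x hx
    exact ⟨{c}, by
      rw [Finset.prod_singleton, aeval_apply_eigenvector hc]
      simp⟩
  | zero => exact ⟨∅, by simp⟩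
  | add x y _ _ hx hy =>
    obtain ⟨S, hS⟩ := hx
    obtain ⟨T, hT⟩ := hy
    exact ⟨S ∪ T, by rw [map_add, mono Finset.subset_union_left hS,
      mono Finset.subset_union_right hT, add_zero]⟩
  | smul c x _ hx =>
    obtain ⟨S, hS⟩ := hx
    exact ⟨S, by rw [map_smul, hS, smul_zero]⟩

theorem LocallyNatSplit.of_injective {f : Module.End k M} {f' : Module.End k M'}
    (h : LocallyNatSplit f') (g : M →ₗ[k] M') (hg : Function.Injective g)
    (hfg : ∀ m, g (f m) = f' (g m)) : LocallyNatSplit f := fun m => by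
  obtain ⟨S, hS⟩ := h (g m)
  exact ⟨S, hg (by rw [aeval_map_apply hfg, hS, map_zero])⟩

theorem LocallyNatSplit.of_surjective {f : Module.End k M} {f' : Module.End k M'}
    (h : LocallyNatSplit f) (g : M →ₗ[k] M') (hg : Function.Surjective g)
    (hfg : ∀ m, g (f m) = f' (g m)) : LocallyNatSplit f' := fun m' => by
  obtain ⟨m, rfl⟩ := hg m'
  obtain ⟨S, hS⟩ := h m
  exact ⟨S, by rw [← aeval_map_apply hfg, hS, map_zero]⟩

theorem LocallyNatSplit.exists_nat {f : Module.End k M} (h : LocallyNatSplit f) {m : M} {c : k}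
    (hm : m ≠ 0) (hc : f m = c • m) : ∃ s : ℕ, c = s := by
  obtain ⟨S, hS⟩ := h m
  rw [aeval_apply_eigenvector hc, smul_eq_zero, or_iff_left hm, Polynomial.eval_prod,
    Finset.prod_eq_zero_iff] at hS
  obtain ⟨s, -, hs⟩ := hS
  exact ⟨s, by simpa [sub_eq_zero] using hs⟩

/-- Remove factors from the annihilating product until it no longer kills `m`. The eigenvector is a
polynomial in `f` applied to `m`, so eigenvectors of operators commuting with `f` remain
eigenvectors; joint diagonalization depends on this. -/
theorem LocallyNatSplit.exists_eigenvector {f : Module.End k M} (h : LocallyNatSplit f) {m : M}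
    (hm : m ≠ 0) : ∃ (p : Polynomial k) (s : ℕ), Polynomial.aeval f p m ≠ 0 ∧
      f (Polynomial.aeval f p m) = (s : k) • Polynomial.aeval f p m := by
  classical
  obtain ⟨S, hS⟩ := h m
  induction S using Finset.induction_on with
  | empty => simp [hm] at hS
  | insert s S hs ih =>
    by_cases h0 : Polynomial.aeval f (∏ s ∈ S, (Polynomial.X - Polynomial.C (s : k))) m = 0
    · exact ih h0
    · refine ⟨_, s, h0, ?_⟩
      rw [Finset.prod_insert hs, map_mul, Module.End.mul_apply] at hS
      rwa [map_sub, Polynomial.aeval_X, Polynomial.aeval_C, LinearMap.sub_apply,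
        Module.algebraMap_end_apply, sub_eq_zero] at hS

theorem exists_joint_eigenvector {ι : Type*} {H : ι → Module.End k M}
    (hH : ∀ i, LocallyNatSplit (H i)) (hc : ∀ i j m, H i (H j m) = H j (H i m)) (T : Finset ι)
    {m : M} (hm : m ≠ 0) : ∃ v, v ≠ 0 ∧ ∀ i ∈ T, ∃ s : ℕ, H i v = (s : k) • v := by
  classical
  induction T using Finset.induction_on with
  | empty => exact ⟨m, hm, by simp⟩
  | insert i T _ ih =>
    obtain ⟨v, hv, hT⟩ := ih
    obtain ⟨p, s, h0, hs⟩ := (hH i).exists_eigenvector hv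
    refine ⟨_, h0, fun j hj => ?_⟩
    rcases Finset.mem_insert.1 hj with rfl | hj
    · exact ⟨s, hs⟩
    · obtain ⟨s', hs'⟩ := hT j hj
      exact ⟨s', by rw [aeval_map_apply (hc j i), hs', map_smul]⟩

end LocallyNatSplit

section ExistsHighestWeight
variable {k : Type*} [Field k] [CharZero k] {n : ℕ} {M : Type*} [AddCommGroup M] [Module k M]
  {ρ : Module.End k (Fin n →₀ k) →ₗ⁅k⁆ Module.End k M}

theorem elemEnd_weight {κ : Fin n → k} {v : M} (h : ∀ i, ρ (elemEnd k i i) v = κ i • v)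
    (i j l : Fin n) : ρ (elemEnd k l l) (ρ (elemEnd k i j) v) =
      (κ l + ((Pi.single l 1 : Fin n → k) i - (Pi.single l 1 : Fin n → k) j)) • ρ (elemEnd k i j) v := by
  have h1 : v ∈ (ρ (diagEnd k (Pi.single l 1))).eigenspace (κ l) := by
    rw [Module.End.mem_eigenspace_iff, ← elemEnd_self, h]
  have := Module.End.mem_eigenspace_iff.1 (elemEnd_mem_eigenspace h1 i j)
  rwa [← elemEnd_self] at this

/-- Raising operators applied to a joint eigenvector must stop: the weights stay natural with a
fixed sum `d`, while `∑ (n - i) κ_i` strictly increases and is at most `n d`. The induction is on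
the gap to this bound. -/
theorem exists_isHighestWeight [Nontrivial M] (h : ∀ i, LocallyNatSplit (ρ (elemEnd k i i))) :
    ∃ (κ : Fin n → ℕ) (v : M), v ≠ 0 ∧ IsHighestWeight ρ (fun i => (κ i : k)) v := by
  have main : ∀ (N d : ℕ) (κ : Fin n → ℕ) (v : M), v ≠ 0 →
      (∀ i, ρ (elemEnd k i i) v = (κ i : k) • v) → ∑ i, κ i = d →
      n * d - ∑ i : Fin n, (n - i) * κ i = N →
      ∃ (κ : Fin n → ℕ) (v : M), v ≠ 0 ∧ IsHighestWeight ρ (fun i => (κ i : k)) v := by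
    intro N
    induction N using Nat.strong_induction_on with
    | _ N ih =>
    intro d κ v hv hκ hd hN
    by_cases hr : ∀ i j, i < j → ρ (elemEnd k i j) v = 0
    · exact ⟨κ, v, hv, hκ, hr⟩
    push Not at hr
    obtain ⟨i, j, hij, hne⟩ := hr
    have h1 : ∀ l, ∃ s : ℕ, (κ l + ((Pi.single l 1 : Fin n → k) i - (Pi.single l 1 : Fin n → k) j)) = s := fun l =>
      (h l).exists_nat hne (elemEnd_weight hκ i j l)
    choose κ' hκ' using h1
    -- The relation `κ' = κ + ε_i - ε_j`, paired with a test function and written without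
    -- subtraction so that it descends from `k` to `ℕ`.
    have hsum : ∀ f : Fin n → ℕ, ∑ l, f l * κ' l + f j = ∑ l, f l * κ l + f i := by
      intro f
      have : ((∑ l, f l * κ' l + f j : ℕ) : k) = ((∑ l, f l * κ l + f i : ℕ) : k) := by
        push_cast
        simp only [← hκ', mul_add, mul_sub, Finset.sum_add_distrib, Finset.sum_sub_distrib]
        simp [Pi.single_apply, add_assoc]
      exact_mod_cast this
    have hd' : ∑ l, κ' l = d := by
      have := hsum fun _ => 1
      simp only [one_mul] at this
      omega
    have hf := hsum fun l => n - l
    have hbound : ∑ l : Fin n, (n - l) * κ' l ≤ n * d := by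
      rw [← hd', Finset.mul_sum]
      exact Finset.sum_le_sum fun l _ => Nat.mul_le_mul_right _ (Nat.sub_le _ _)
    have hij' : i.1 < j.1 := hij
    have hj := j.2
    refine ih _ ?_ d κ' _ hne (fun l => ?_) hd' rfl
    · omega
    · rw [elemEnd_weight hκ i j l, hκ']
  obtain ⟨m, hm⟩ := exists_ne (0 : M)
  obtain ⟨v, hv, hT⟩ := exists_joint_eigenvector h (fun i j m => by
    have h1 : ⁅elemEnd k i i, elemEnd k j j⁆ = 0 := by
      rw [elemEnd_self k i, lie_diagEnd_elemEnd, sub_self, zero_smul]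
    have h2 := LinearMap.congr_fun (ρ.map_lie (elemEnd k i i) (elemEnd k j j)) m
    rw [h1, end_lie_apply, map_zero, LinearMap.zero_apply] at h2
    exact (sub_eq_zero.1 h2.symm)) Finset.univ hm
  choose κ hκ using fun i => hT i (Finset.mem_univ i)
  exact main _ _ κ v hv hκ rfl rfl

/-- The `sl_2` computation: with `E = E_{ij}` and `F = E_{ji}`, `E F^{m+1} v = (m + 1)(κ_i - κ_j -
m) F^m v`. At the first `m` with `F^{m+1} v = 0` the coefficient must vanish, so `κ_i - κ_j = m`. -/
theorem IsHighestWeight.antitone {κ : Fin n → ℕ} {v : M}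
    (hv : IsHighestWeight ρ (fun i => (κ i : k)) v) (hv0 : v ≠ 0)
    (h : ∀ i, LocallyNatSplit (ρ (elemEnd k i i))) : Antitone κ := by
  intro i j hij
  rcases hij.eq_or_lt with rfl | hij
  · exact le_rfl
  set F := ρ (elemEnd k j i) with hF
  have hw : ∀ (m : ℕ) (l : Fin n), ρ (elemEnd k l l) ((F ^ m) v) =
      ((κ l : k) + m * ((Pi.single l 1 : Fin n → k) j - (Pi.single l 1 : Fin n → k) i)) • (F ^ m) v := by
    intro m
    induction m with
    | zero => intro l; simp [hv.weight l]
    | succ m ih =>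
      intro l
      rw [pow_succ', Module.End.mul_apply, elemEnd_weight ih]
      congr 1
      push_cast
      ring
  have hE : ∀ m : ℕ, ρ (elemEnd k i j) ((F ^ (m + 1)) v) =
      ((m + 1 : k) * ((κ i : k) - κ j - m)) • (F ^ m) v := by
    have hne : i ≠ j := hij.ne
    have hstep : ∀ x, ρ (elemEnd k i j) (F x) =
        F (ρ (elemEnd k i j) x) + (ρ (elemEnd k i i) x - ρ (elemEnd k j j) x) := by
      intro x
      have h1 := LinearMap.congr_fun (congrArg ρ (lie_elemEnd_swap k i j)) x
      rw [map_add, LieHom.map_lie, LinearMap.add_apply, end_lie_apply] at h1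
      rw [← h1]
      abel
    intro m
    induction m with
    | zero =>
      rw [zero_add, pow_one, hstep, hv.raise i j hij, map_zero, zero_add, hv.weight, hv.weight,
        ← sub_smul]
      simp
    | succ m ih =>
      rw [pow_succ', Module.End.mul_apply, hstep, ih, map_smul, ← Module.End.mul_apply, ← pow_succ',
        hw, hw, ← sub_smul, ← add_smul]
      congr 1
      simp [Pi.single_apply, hne, hne.symm]
      ring
  have hex : ∃ m, (F ^ (m + 1)) v = 0 := by
    -- Each application of `F` lowers the weight at `i` by one; a nonzero vector after `κ i + 1`
    -- applications would have weight `-1` there.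
    refine ⟨κ i, ?_⟩
    by_contra hne
    obtain ⟨s, hs⟩ := (h i).exists_nat hne (hw _ i)
    have hij' : j ≠ i := hij.ne'
    rw [Pi.single_apply, Pi.single_apply, if_neg hij', if_pos rfl] at hs
    push_cast at hs
    have : ((s + 1 : ℕ) : k) = 0 := by
      push_cast
      rw [← hs]
      ring
    exact Nat.succ_ne_zero s (Nat.cast_eq_zero.1 this)
  classical
  have h0 := Nat.find_spec hex
  have h1 : (F ^ (Nat.find hex)) v ≠ 0 := by
    rcases Nat.eq_zero_or_pos (Nat.find hex) with h2 | h2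
    · rw [h2]; simpa using hv0
    · obtain ⟨m, hm⟩ := Nat.exists_eq_add_of_lt h2
      rw [zero_add] at hm
      rw [hm]
      exact Nat.find_min hex (by omega)
  have h2 := hE (Nat.find hex)
  rw [h0, map_zero, eq_comm, smul_eq_zero, or_iff_left h1, mul_eq_zero, sub_sub, sub_eq_zero] at h2
  have h3 : (κ i : k) = κ j + Nat.find hex :=
    h2.resolve_left (Nat.cast_add_one_ne_zero _)
  have h4 : κ i = κ j + Nat.find hex := by exact_mod_cast h3
  omega

/-- The Young diagram with prescribed row lengths. -/
def diagramOfWeight (κ : Fin n → ℕ) (hκ : Antitone κ) : YoungDiagram where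
  cells := Finset.univ.biUnion fun i : Fin n => (Finset.range (κ i)).image fun j => (i.1, j)
  isLowerSet := by
    rintro ⟨a, b⟩ ⟨a', b'⟩ ⟨ha, hb⟩ h
    simp only [Finset.coe_biUnion, Finset.coe_univ, Set.mem_univ, Set.iUnion_true, Set.mem_iUnion,
      Finset.coe_image, Set.mem_image, Finset.coe_range, Set.mem_Iio, Prod.mk.injEq] at h ⊢
    obtain ⟨i, j, hj, rfl, rfl⟩ := h
    refine ⟨⟨a', lt_of_le_of_lt ha i.2⟩, b', ?_, rfl, rfl⟩
    exact lt_of_le_of_lt hb (lt_of_lt_of_le hj (hκ (show (⟨a', _⟩ : Fin n) ≤ i from ha)))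

theorem mem_diagramOfWeight {κ : Fin n → ℕ} {hκ : Antitone κ} {c : ℕ × ℕ} :
    c ∈ (diagramOfWeight κ hκ).cells ↔ ∃ i : Fin n, i.1 = c.1 ∧ c.2 < κ i := by
  simp [diagramOfWeight, Prod.ext_iff]
  aesop

theorem colLen_diagramOfWeight (κ : Fin n → ℕ) (hκ : Antitone κ) :
    (diagramOfWeight κ hκ).colLen 0 ≤ n := by
  by_contra! h
  obtain ⟨i, hi, -⟩ := mem_diagramOfWeight.1
    ((YoungDiagram.mem_cells _).2 (YoungDiagram.mem_iff_lt_colLen.2 h))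
  exact absurd i.2 (by rw [hi]; simp)

theorem rowWeight_diagramOfWeight (κ : Fin n → ℕ) (hκ : Antitone κ) (i : Fin n) :
    rowWeight (colLen_diagramOfWeight κ hκ) i = κ i := by
  rw [← Finset.card_range (κ i), rowWeight]
  refine Finset.card_bij' (fun c _ => c.1.2)
    (fun j hj => ⟨(i.1, j), mem_diagramOfWeight.2 ⟨i, rfl, Finset.mem_range.1 hj⟩⟩) ?_ ?_ ?_ ?_
  · intro c hc
    obtain ⟨i', hi', hc'⟩ := mem_diagramOfWeight.1 c.2
    have : i' = i := Fin.ext (hi'.trans (congrArg Fin.val (Finset.mem_filter.1 hc).2))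
    rw [this] at hc'
    exact Finset.mem_range.2 hc'
  · intro j hj
    exact Finset.mem_filter.2 ⟨Finset.mem_univ _, rfl⟩
  · intro c hc
    exact Subtype.ext (Prod.ext (congrArg Fin.val (Finset.mem_filter.1 hc).2).symm rfl)
  · intro j hj
    rfl

end ExistsHighestWeight
theorem multilinear_mem_of_span {k : Type*} [Field k] {S : Type*} [Finite S] {G A : S → Type*}
    {B : Type*} [∀ s, AddCommGroup (A s)] [∀ s, Module k (A s)] [AddCommGroup B] [Module k B]
    (π : ∀ s, G s → A s) (hπ : ∀ s, Submodule.span k (Set.range (π s)) = ⊤)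
    (F : MultilinearMap k A B) (K : Submodule k B) (h : ∀ g : ∀ s, G s, F (fun s => π s (g s)) ∈ K)
    (a : ∀ s, A s) : F a ∈ K := by
  have : K.mkQ.compMultilinearMap F = 0 := multilinear_ext π hπ _ _ fun g => by
    simpa using h g
  simpa using DFunLike.congr_fun this a

/-! ### Tensors of monomials and projection to a degree -/

section Monomials
variable {k : Type u} [Field k] (P : LinearOperad k) {B : Type} {C : Type*}

/-- A monomial in basis vectors in the free algebra. -/
noncomputable def basisMonomial (g : Σ r, P.obj (Fin r) × (Fin r → B)) : P.Free (B →₀ k) :=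
  Free.mk g.2.1 fun t => Finsupp.single (g.2.2 t) 1

theorem span_basisMonomial :
    Submodule.span k (Set.range (P.basisMonomial (B := B))) = ⊤ := by
  rw [eq_top_iff, ← Free.span_mk, Submodule.span_le]
  rintro _ ⟨⟨r, p, v⟩, rfl⟩
  refine multilinear_mem_of_span (G := fun _ => B) (fun _ b => Finsupp.single b (1 : k))
    (fun _ => ?_) (Free.mk p) (Submodule.span k (Set.range P.basisMonomial))
    (fun f => Submodule.subset_span ⟨⟨r, p, f⟩, rfl⟩) v
  exact (Finsupp.basisSingleOne (R := k) (ι := B)).span_eq ▸ by simp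

/-- A tensor of monomials. -/
noncomputable def tensorMonomial (g : C → Σ r, P.obj (Fin r) × (Fin r → B)) :
    ⨂[k] _ : C, P.Free (B →₀ k) :=
  PiTensorProduct.tprod k fun c => P.basisMonomial (g c)

theorem span_tensorMonomial [Finite C] :
    Submodule.span k (Set.range (P.tensorMonomial (B := B) (C := C))) = ⊤ := by
  rw [eq_top_iff, ← PiTensorProduct.span_tprod_eq_top, Submodule.span_le]
  rintro _ ⟨v, rfl⟩
  exact multilinear_mem_of_span (fun _ => P.basisMonomial) (fun _ => P.span_basisMonomial)
    (PiTensorProduct.tprod k) (Submodule.span k (Set.range P.tensorMonomial))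
    (fun g => Submodule.subset_span ⟨g, rfl⟩) v

theorem derivFun_diagEnd_basisMonomial (α : B → k) (g : Σ r, P.obj (Fin r) × (Fin r → B)) :
    Free.derivFun (Free.ι ∘ₗ diagEnd k α) (P.basisMonomial g) =
      (∑ t, α (g.2.2 t)) • P.basisMonomial g := by
  rw [basisMonomial, Free.derivFun_mk, Finset.sum_smul]
  refine Finset.sum_congr rfl fun t _ => ?_
  rw [LinearMap.comp_apply, diagEnd_single, map_smul, MultilinearMap.map_update_smul,
    Function.update_eq_self, Free.act_ι]

theorem tensorEnd_tprod_of_eigen {M : Type*} [AddCommGroup M] [Module k M] [Fintype C]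
    [DecidableEq C] {f : Module.End k M} {v : C → M} {s : C → k} (h : ∀ c, f (v c) = s c • v c) :
    tensorEnd k C f (PiTensorProduct.tprod k v) = (∑ c, s c) • PiTensorProduct.tprod k v := by
  rw [tensorEnd_tprod, Finset.sum_smul]
  refine Finset.sum_congr rfl fun c _ => ?_
  rw [h, MultilinearMap.map_update_smul, Function.update_eq_self]

theorem tensorEnd_diagEnd_tensorMonomial [Fintype C] [DecidableEq C] (α : B → k)
    (g : C → Σ r, P.obj (Fin r) × (Fin r → B)) :
    tensorEnd k C (Free.derivFun (Free.ι ∘ₗ diagEnd k α)) (P.tensorMonomial g) =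
      (∑ c, ∑ t, α ((g c).2.2 t)) • P.tensorMonomial g :=
  tensorEnd_tprod_of_eigen fun c => P.derivFun_diagEnd_basisMonomial α (g c)

end Monomials

section TensorOp
variable {k : Type u} [Field k] (P : LinearOperad k) {C : Type} [Fintype C] [DecidableEq C]
  {ρ : C → ℕ} (p : ∀ c, P.obj (Fin (ρ c)))

/-- The natural map of tensor powers of a `P`-algebra given by a family of operations. -/
noncomputable def tensorOp (A : Type u) [AddCommGroup A] [Module k A] [P.Algebra A] :
    (⨂[k] _ : (Σ c, Fin (ρ c)), A) →ₗ[k] ⨂[k] _ : C, A :=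
  PiTensorProduct.lift
    ((PiTensorProduct.tprod k).compMultilinearMap fun c => Algebra.act (A := A) (p c))

variable {A : Type u} [AddCommGroup A] [Module k A] [P.Algebra A]

theorem tensorOp_tprod (a : (Σ c, Fin (ρ c)) → A) :
    P.tensorOp p A (PiTensorProduct.tprod k a) =
      PiTensorProduct.tprod k fun c => Algebra.act (p c) fun t => a ⟨c, t⟩ := by
  rw [tensorOp, PiTensorProduct.lift.tprod]
  rfl

theorem tensorOp_tensorEnd {δ : Module.End k A} (hδ : P.IsDerivation A δ)
    (t : ⨂[k] _ : (Σ c, Fin (ρ c)), A) :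
    P.tensorOp p A (tensorEnd k _ δ t) = tensorEnd k _ δ (P.tensorOp p A t) := by
  have : P.tensorOp p A ∘ₗ tensorEnd k _ δ = tensorEnd k _ δ ∘ₗ P.tensorOp p A := by
    ext a
    simp only [LinearMap.compMultilinearMap_apply, LinearMap.comp_apply, tensorEnd_tprod, map_sum,
      tensorOp_tprod]
    rw [Fintype.sum_sigma]
    refine Finset.sum_congr rfl fun c _ => ?_
    rw [hδ, MultilinearMap.map_update_sum]
    refine Finset.sum_congr rfl fun t _ => congrArg _ (funext fun c' => ?_)
    by_cases h : c' = c
    · subst h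
      rw [Function.update_self]
      congr 1
      funext t'
      by_cases h' : t' = t
      · subst h'; simp
      · rw [Function.update_of_ne h', Function.update_of_ne (by simpa using h')]
    · rw [Function.update_of_ne h]
      congr 1
      funext t'
      rw [Function.update_of_ne (by simp [h])]
  exact LinearMap.congr_fun this t

theorem map_tensorOp {U U' : Type u} [AddCommGroup U] [Module k U] [AddCommGroup U'] [Module k U']
    (f : U →ₗ[k] U') (t : ⨂[k] _ : (Σ c, Fin (ρ c)), P.Free U) :
    PiTensorProduct.map (fun _ => Free.map f) (P.tensorOp p (P.Free U) t) =
      P.tensorOp p (P.Free U') (PiTensorProduct.map (fun _ => Free.map f) t) := by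
  have : PiTensorProduct.map (fun _ => Free.map f) ∘ₗ P.tensorOp p (P.Free U) =
      P.tensorOp p (P.Free U') ∘ₗ PiTensorProduct.map (fun _ => Free.map f) := by
    refine PiTensorProduct.ext (MultilinearMap.ext fun a => ?_)
    rw [LinearMap.compMultilinearMap_apply, LinearMap.compMultilinearMap_apply,
      LinearMap.comp_apply, LinearMap.comp_apply, tensorOp_tprod, PiTensorProduct.map_tprod,
      PiTensorProduct.map_tprod, tensorOp_tprod]
    exact congrArg (PiTensorProduct.tprod k) (funext fun c => Free.map_act f (p c) _)
  exact LinearMap.congr_fun this t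

theorem tensorOp_map_ι {B : Type} (f : ∀ c, Fin (ρ c) → B) :
    P.tensorOp p (P.Free (B →₀ k)) (PiTensorProduct.map (fun _ => Free.ι)
      (basisTensor k fun x : Σ c, Fin (ρ c) => f x.1 x.2)) =
      P.tensorMonomial fun c => ⟨ρ c, p c, f c⟩ := by
  rw [basisTensor, PiTensorProduct.map_tprod, tensorOp_tprod]
  exact congrArg (PiTensorProduct.tprod k)
    (funext fun c => Free.act_ι (p c) fun t => Finsupp.single (f c t) 1)

end TensorOp
-- For one eigenvector of eigenvalue `c ≠ r`, take `(X - c)/(r - c)`; for sums, multiply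
-- polynomials. The normalization at `r` makes `p(f)` the identity on `r`-eigenvectors. The
-- polynomial depends on `a`, since infinitely many eigenvalues may occur.
theorem exists_aeval_mem {k : Type*} [Field k] [CharZero k] {M : Type*} [AddCommGroup M]
    [Module k M] {f : Module.End k M} {s : Set M} {r : ℕ} {Y : Submodule k M}
    (hY : ∀ y ∈ Y, f y = (r : k) • y)
    (hs : ∀ x ∈ s, ∃ c : ℕ, f x = (c : k) • x ∧ (c = r → x ∈ Y)) {a : M}
    (ha : a ∈ Submodule.span k s) :
    ∃ p : Polynomial k, p.eval (r : k) = 1 ∧ Polynomial.aeval f p a ∈ Y := by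
  have hpY : ∀ (p : Polynomial k), ∀ y ∈ Y, Polynomial.aeval f p y ∈ Y := fun p y hy => by
    rw [aeval_apply_eigenvector (hY y hy)]
    exact Y.smul_mem _ hy
  induction ha using Submodule.span_induction with
  | mem x hx =>
    obtain ⟨c, hc, hcr⟩ := hs x hx
    by_cases h : c = r
    · exact ⟨1, by simp, by simpa using hcr h⟩
    · have h0 : (r : k) - c ≠ 0 := sub_ne_zero.2 fun e => h (Nat.cast_injective e).symm
      refine ⟨Polynomial.C ((r : k) - c)⁻¹ * (Polynomial.X - Polynomial.C (c : k)), ?_, ?_⟩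
      · simp [h0]
      · rw [aeval_apply_eigenvector hc]
        simp
  | zero => exact ⟨1, by simp, by simp⟩
  | add x y _ _ hx hy =>
    obtain ⟨p, hp, hpx⟩ := hx
    obtain ⟨q, hq, hqy⟩ := hy
    refine ⟨p * q, by rw [Polynomial.eval_mul, hp, hq, one_mul], ?_⟩
    rw [map_add]
    refine Y.add_mem ?_ ?_
    · rw [mul_comm, map_mul]
      exact hpY _ _ hpx
    · rw [map_mul]
      exact hpY _ _ hqy
  | smul c x _ hx =>
    obtain ⟨p, hp, hpx⟩ := hx
    exact ⟨p, hp, by rw [map_smul]; exact Y.smul_mem _ hpx⟩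

section DirectSum
variable {k : Type u} [Field k] (P : LinearOperad k) {I : Type u} (d : I → ℕ)

/-- A direct sum of tensor powers. -/
abbrev TensorSum (A : Type u) [AddCommGroup A] [Module k A] : Type u :=
  ⨁ i, ⨂[k] _ : Fin (d i), A

variable {A A' : Type u} [AddCommGroup A] [Module k A] [AddCommGroup A'] [Module k A']

/-- The map of direct sums of tensor powers induced by a linear map. -/
noncomputable def tensorSumMap (f : A →ₗ[k] A') : TensorSum (k := k) d A →ₗ[k] TensorSum (k := k) d A' :=
  DirectSum.lmap fun _ => PiTensorProduct.map fun _ => f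

/-- The action of an endomorphism on a direct sum of tensor powers by the Leibniz rule. -/
noncomputable def tensorSumEnd (f : Module.End k A) : Module.End k (TensorSum (k := k) d A) :=
  DirectSum.lmap fun i => tensorEnd k (Fin (d i)) f

theorem tensorSumMap_tensorSumEnd {f : A →ₗ[k] A'} {a : Module.End k A} {b : Module.End k A'}
    (h : ∀ m, f (a m) = b (f m)) (t : TensorSum (k := k) d A) :
    tensorSumMap d f (tensorSumEnd d a t) = tensorSumEnd d b (tensorSumMap d f t) :=
  DFinsupp.ext fun i => tensorEnd_map (Fin (d i)) f a b h (t i)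

variable {B : Type}

/-- Tensors of monomials, in a direct sum of tensor powers. -/
noncomputable def sumMonomial
    (g : Σ i, Fin (d i) → Σ r, P.obj (Fin r) × (Fin r → B)) :
    TensorSum (k := k) d (P.Free (B →₀ k)) :=
  open Classical in
  DirectSum.lof k I (fun i => ⨂[k] _ : Fin (d i), P.Free (B →₀ k)) g.1 (P.tensorMonomial g.2)

theorem span_sumMonomial :
    Submodule.span k (Set.range (P.sumMonomial d (B := B))) = ⊤ := by
  classical
  rw [eq_top_iff]
  rintro x -
  induction x using DirectSum.induction_on with
  | zero => exact Submodule.zero_mem _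
  | add x y hx hy => exact Submodule.add_mem _ hx hy
  | of i x =>
    have hx : x ∈ Submodule.span k (Set.range (P.tensorMonomial (B := B) (C := Fin (d i)))) := by
      rw [span_tensorMonomial]; trivial
    have := Submodule.mem_map_of_mem
      (f := DirectSum.lof k I (fun i => ⨂[k] _ : Fin (d i), P.Free (B →₀ k)) i) hx
    rw [Submodule.map_span] at this
    refine Submodule.span_mono ?_ this
    rintro _ ⟨_, ⟨g, rfl⟩, rfl⟩
    refine ⟨⟨i, g⟩, ?_⟩
    rw [sumMonomial]

theorem tensorSumEnd_diagEnd_sumMonomial (α : B → k)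
    (g : Σ i, Fin (d i) → Σ r, P.obj (Fin r) × (Fin r → B)) :
    tensorSumEnd d (Free.derivFun (Free.ι ∘ₗ diagEnd k α)) (P.sumMonomial d g) =
      (∑ c, ∑ t, α ((g.2 c).2.2 t)) • P.sumMonomial d g := by
  classical
  rw [sumMonomial, tensorSumEnd, DirectSum.lmap_lof, tensorEnd_diagEnd_tensorMonomial, map_smul]

end DirectSum

/-! ### Natural operations and the lifting of tensors -/

section NaturalOp
variable {k : Type u} [Field k] (P : LinearOperad k) (C : Type) [Fintype C] [DecidableEq C]
  {I : Type u} (d : I → ℕ)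

/-- Natural maps from a tensor power of a free algebra to direct sums of tensor powers, which commute with
derivations. -/
structure NaturalOp where
  app : ∀ (U : Type u) [AddCommGroup U] [Module k U],
    (⨂[k] _ : C, P.Free U) →ₗ[k] TensorSum (k := k) d (P.Free U)
  map_app : ∀ {U U' : Type u} [AddCommGroup U] [Module k U] [AddCommGroup U'] [Module k U']
    (f : U →ₗ[k] U') (t : ⨂[k] _ : C, P.Free U),
    tensorSumMap d (Free.map f) (app U t) = app U' (PiTensorProduct.map (fun _ => Free.map f) t)
  app_tensorEnd : ∀ {U : Type u} [AddCommGroup U] [Module k U] {δ : Module.End k (P.Free U)},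
    P.IsDerivation (P.Free U) δ → ∀ t, app U (tensorEnd k C δ t) = tensorSumEnd d δ (app U t)

variable {P C d}

variable (P C d)

/-- The values of natural operations at a given tensor. -/
noncomputable def naturalValues {U : Type u} [AddCommGroup U] [Module k U]
    (t : ⨂[k] _ : C, P.Free U) : Submodule k (TensorSum (k := k) d (P.Free U)) where
  carrier := {y | ∃ Φ : P.NaturalOp C d, Φ.app U t = y}
  zero_mem' := ⟨{ app := fun _ => 0, map_app := by simp, app_tensorEnd := by simp }, rfl⟩
  add_mem' := by
    rintro _ _ ⟨Φ, rfl⟩ ⟨Ψ, rfl⟩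
    exact ⟨{ app := fun U => Φ.app U + Ψ.app U
             map_app := fun f t => by
               rw [LinearMap.add_apply, map_add, Φ.map_app, Ψ.map_app, LinearMap.add_apply]
             app_tensorEnd := fun hδ t => by
               rw [LinearMap.add_apply, Φ.app_tensorEnd hδ, Ψ.app_tensorEnd hδ,
                 LinearMap.add_apply, map_add] }, rfl⟩
  smul_mem' := by
    rintro c _ ⟨Φ, rfl⟩
    exact ⟨{ app := fun U => c • Φ.app U
             map_app := fun f t => by
               rw [LinearMap.smul_apply, map_smul, Φ.map_app, LinearMap.smul_apply]
             app_tensorEnd := fun hδ t => by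
               rw [LinearMap.smul_apply, Φ.app_tensorEnd hδ, LinearMap.smul_apply, map_smul] }, rfl⟩

variable {C d}

/-- A natural operation preceded by permutations of the factors. -/
noncomputable def NaturalOp.compPerm {P : LinearOperad k} (Φ : P.NaturalOp C d)
    (z : MonoidAlgebra k (Equiv.Perm C)) : P.NaturalOp C d where
  app U := Φ.app U ∘ₗ permAct k C (P.Free U) z
  map_app f t := by
    rw [LinearMap.comp_apply, Φ.map_app, (isPermEquivariant_map _).map_permAct]
    rfl
  app_tensorEnd hδ t := by
    rw [LinearMap.comp_apply, ← (isPermEquivariant_tensorEnd _).map_permAct, Φ.app_tensorEnd hδ]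
    rfl

theorem map_reindex {C' : Type*} {C'' : Type*} {M M' : Type*} [AddCommGroup M] [Module k M] [AddCommGroup M']
    [Module k M'] (e : C' ≃ C'') (f : M →ₗ[k] M') (t : ⨂[k] _ : C', M) :
    PiTensorProduct.map (fun _ => f) (PiTensorProduct.reindex k (fun _ => M) e t) =
      PiTensorProduct.reindex k (fun _ => M') e (PiTensorProduct.map (fun _ => f) t) := by
  have : PiTensorProduct.map (fun _ => f) ∘ₗ
        (PiTensorProduct.reindex k (fun _ => M) e).toLinearMap =
      (PiTensorProduct.reindex k (fun _ => M') e).toLinearMap ∘ₗ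
        PiTensorProduct.map (fun _ => f) := by
    refine PiTensorProduct.ext (MultilinearMap.ext fun a => ?_)
    simp only [LinearMap.compMultilinearMap_apply, LinearMap.comp_apply, LinearEquiv.coe_coe,
      PiTensorProduct.reindex_tprod, PiTensorProduct.map_tprod]
  exact LinearMap.congr_fun this t

theorem tensorEnd_reindex {C' C'' : Type*} [Fintype C'] [DecidableEq C'] [Fintype C'']
    [DecidableEq C''] {M : Type*} [AddCommGroup M] [Module k M]
    (e : C' ≃ C'') (f : Module.End k M) (t : ⨂[k] _ : C', M) :
    tensorEnd k C'' f (PiTensorProduct.reindex k (fun _ => M) e t) =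
      PiTensorProduct.reindex k (fun _ => M) e (tensorEnd k C' f t) := by
  have : tensorEnd k C'' f ∘ₗ (PiTensorProduct.reindex k (fun _ => M) e).toLinearMap =
      (PiTensorProduct.reindex k (fun _ => M) e).toLinearMap ∘ₗ tensorEnd k C' f := by
    refine PiTensorProduct.ext (MultilinearMap.ext fun a => ?_)
    simp only [LinearMap.compMultilinearMap_apply, LinearMap.comp_apply, LinearEquiv.coe_coe,
      PiTensorProduct.reindex_tprod, tensorEnd_tprod, map_sum]
    rw [← Equiv.sum_comp e]
    refine Finset.sum_congr rfl fun c _ => congrArg _ (funext fun c' => ?_)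
    by_cases h : e.symm c' = c
    · subst h; simp
    · rw [Function.update_of_ne h, Function.update_of_ne fun h' => h (by simp [h'])]
  exact LinearMap.congr_fun this t

/-- The natural operation given by a family of operations of the operad. -/
noncomputable def NaturalOp.ofOps (i : I) {ρ : Fin (d i) → ℕ} (e : (Σ c, Fin (ρ c)) ≃ C)
    (p : ∀ c, P.obj (Fin (ρ c))) : P.NaturalOp C d where
  app U := open Classical in
    DirectSum.lof k I (fun i => ⨂[k] _ : Fin (d i), P.Free U) i ∘ₗ P.tensorOp p (P.Free U) ∘ₗ
      (PiTensorProduct.reindex k (fun _ => P.Free U) e.symm).toLinearMap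
  map_app f t := by
    classical
    rw [LinearMap.comp_apply, LinearMap.comp_apply, LinearMap.comp_apply, LinearMap.comp_apply,
      tensorSumMap, DirectSum.lmap_lof, map_tensorOp, LinearEquiv.coe_coe, map_reindex]
    rfl
  app_tensorEnd hδ t := by
    classical
    rw [LinearMap.comp_apply, LinearMap.comp_apply, LinearMap.comp_apply, LinearMap.comp_apply,
      tensorSumEnd, DirectSum.lmap_lof, ← tensorOp_tensorEnd P p hδ, LinearEquiv.coe_coe,
      tensorEnd_reindex]

/-- A tensor of monomials with `|C|` inputs in total separates into its operations, which form a
natural operation, and its labels, which a bijection of the inputs with `C` turns into a basis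
tensor. -/
theorem exists_naturalOp_sumMonomial {B : Type}
    (g : Σ i, Fin (d i) → Σ r, P.obj (Fin r) × (Fin r → B))
    (hg : ∑ c, (g.2 c).1 = Fintype.card C) :
    ∃ (Φ : P.NaturalOp C d) (f : C → B),
      P.sumMonomial d g = Φ.app _ (PiTensorProduct.map (fun _ => Free.ι) (basisTensor k f)) := by
  have e : (Σ c, Fin (g.2 c).1) ≃ C := Fintype.equivOfCardEq (by simpa using hg)
  refine ⟨NaturalOp.ofOps P g.1 e fun c => (g.2 c).2.1,
    fun c => (g.2 (e.symm c).1).2.2 (e.symm c).2, ?_⟩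
  rw [NaturalOp.ofOps, LinearMap.comp_apply, LinearMap.comp_apply, LinearEquiv.coe_coe,
    ← map_reindex, basisTensor, PiTensorProduct.reindex_tprod]
  have h : (fun x => Finsupp.single ((g.2 (e.symm (e.symm.symm x)).1).2.2
      (e.symm (e.symm.symm x)).2) (1 : k)) = fun x => Finsupp.single ((g.2 x.1).2.2 x.2) 1 :=
    funext fun x => by rw [Equiv.symm_symm, Equiv.symm_apply_apply]
  rw [h]
  classical
  exact congrArg (DirectSum.lof k I _ g.1)
    (tensorOp_map_ι P (fun c => (g.2 c).2.1) fun c t => (g.2 c).2.2 t).symm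

theorem NaturalOp.freeAct_app {P : LinearOperad k} {U : Type u} [AddCommGroup U] [Module k U]
    (Φ : P.NaturalOp C d) (w : FreeAlgebra k (Module.End k U)) (t : ⨂[k] _ : C, U) :
    freeAct (fun A => tensorSumEnd d (Free.derivFun (Free.ι ∘ₗ A))) w
        (Φ.app U (PiTensorProduct.map (fun _ => Free.ι) t)) =
      Φ.app U (PiTensorProduct.map (fun _ => Free.ι) (tensorAct k C U w t)) := by
  have h : ∀ (A : Module.End k U) (t : ⨂[k] _ : C, U),
      (Φ.app U ∘ₗ PiTensorProduct.map (fun _ => Free.ι)) (tensorEnd k C A t) =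
        tensorSumEnd d (Free.derivFun (Free.ι ∘ₗ A))
          ((Φ.app U ∘ₗ PiTensorProduct.map (fun _ => Free.ι)) t) := fun A t => by
    have h1 := tensorEnd_map C (Free.ι (P := P)) A (Free.derivFun (Free.ι ∘ₗ A))
        (fun m => (Free.derivFun_ι (Free.ι ∘ₗ A) m).symm) t
    have h2 := Φ.app_tensorEnd (Free.isDerivation_derivFun (Free.ι ∘ₗ A))
      (PiTensorProduct.map (fun _ => Free.ι) t)
    rw [LinearMap.comp_apply, LinearMap.comp_apply, ← h2, ← h1]
  exact (freeAct_map (M := ⨂[k] _ : C, U) (M' := TensorSum (k := k) d (P.Free U))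
    (ρ := tensorEnd k C) (ρ' := fun A => tensorSumEnd d (Free.derivFun (Free.ι ∘ₗ A)))
    (f := Φ.app U ∘ₗ PiTensorProduct.map fun _ => Free.ι) h w t).symm

end NaturalOp

section Core
variable {k : Type u} [Field k] [CharZero k] (P : LinearOperad k) {n : ℕ} {μ : YoungDiagram}
  (hμ : μ.colLen 0 ≤ n) {I : Type u} (d : I → ℕ)

/-- Every element of a direct sum of tensor powers is moved by the action of `gl_n`, through an
operator that fixes the highest weight vector, to the image of the latter under a natural
operation. -/
theorem exists_freeAct_eq_naturalOp (a : TensorSum (k := k) d (P.V n)) :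
    ∃ w, tensorAct k μ.cells (Fin n →₀ k) w (hwTensor k hμ) = hwTensor k hμ ∧
      ∃ Φ : P.NaturalOp μ.cells d,
        freeAct (fun A => tensorSumEnd d (Free.derivFun (Free.ι ∘ₗ A))) w a =
          Φ.app _ (PiTensorProduct.map (fun _ => Free.ι) (hwTensor k hμ)) := by
  set E : Module.End k (TensorSum (k := k) d (P.V n)) :=
    tensorSumEnd d (Free.derivFun (Free.ι ∘ₗ diagEnd k fun _ : Fin n => (1 : k))) with hE
  -- The monomials of total degree `|μ|`, the degree of the highest weight tensor; the Euler
  -- operator `E` has the total degree as eigenvalue.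
  let s := {g : Σ i, Fin (d i) → Σ r, P.obj (Fin r) × (Fin r → Fin n) |
    ∑ c, (g.2 c).1 = Fintype.card μ.cells}
  let Y : Submodule k (TensorSum (k := k) d (P.V n)) := Submodule.span k (P.sumMonomial d '' s)
  have hdeg : ∀ g, E (P.sumMonomial d g) = ((∑ c, (g.2 c).1 : ℕ) : k) • P.sumMonomial d g := by
    intro g
    rw [hE, tensorSumEnd_diagEnd_sumMonomial]
    simp
  have hY : ∀ y ∈ Y, E y = (Fintype.card μ.cells : k) • y := by
    intro y hy
    induction hy using Submodule.span_induction with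
    | mem y hy =>
      obtain ⟨g, hg, rfl⟩ := hy
      rw [hdeg, hg]
    | zero => simp
    | add x y _ _ hx hy => rw [map_add, hx, hy, smul_add]
    | smul c x _ hx => rw [map_smul, hx, smul_comm]
  -- This polynomial in the Euler operator isolates the part of `a` of degree `|μ|` and fixes every
  -- vector of that degree.
  obtain ⟨p, hp, hpa⟩ := exists_aeval_mem (Y := Y) (a := a)
    (s := Set.range (P.sumMonomial d (B := Fin n))) hY
    (by
      rintro _ ⟨g, rfl⟩
      exact ⟨_, hdeg g, fun h => Submodule.subset_span ⟨g, h, rfl⟩⟩)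
    (by rw [span_sumMonomial]; trivial)
  -- On a value of a natural operation, `ε` acts on the argument and makes it `z v` for some `z` in
  -- the group algebra; absorbing `z` into the operation leaves a natural operation evaluated at
  -- `v`.
  obtain ⟨ε, hε, hεt⟩ := exists_freeAct_projection k hμ
  have key : ∀ y ∈ Y, freeAct (fun A => tensorSumEnd d (Free.derivFun (Free.ι ∘ₗ A))) ε y ∈
      P.naturalValues μ.cells d (PiTensorProduct.map (fun _ => Free.ι) (hwTensor k hμ)) := by
    intro y hy
    induction hy using Submodule.span_induction with
    | mem y hy =>
      obtain ⟨g, hg, rfl⟩ := hy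
      obtain ⟨Φ, f, hΦ⟩ := P.exists_naturalOp_sumMonomial g hg
      obtain ⟨z, hz⟩ := hεt (basisTensor k f)
      refine ⟨Φ.compPerm z, ?_⟩
      rw [hΦ, Φ.freeAct_app, hz, (isPermEquivariant_map _).map_permAct]
      rfl
    | zero => rw [map_zero]; exact Submodule.zero_mem _
    | add x y _ _ hx hy => rw [map_add]; exact Submodule.add_mem _ hx hy
    | smul c x _ hx => rw [map_smul]; exact Submodule.smul_mem _ c hx
  have haeval : ∀ {N : Type u} [AddCommGroup N] [Module k N]
      (ρ : Module.End k (Fin n →₀ k) → Module.End k N),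
      freeAct ρ (Polynomial.aeval (FreeAlgebra.ι k (diagEnd k fun _ : Fin n => (1 : k))) p) =
        Polynomial.aeval (ρ (diagEnd k fun _ : Fin n => (1 : k))) p := by
    intro N _ _ ρ
    rw [← Polynomial.aeval_algHom_apply, freeAct_ι]
  refine ⟨ε * Polynomial.aeval (FreeAlgebra.ι k (diagEnd k fun _ : Fin n => (1 : k))) p, ?_, ?_⟩
  · have h2 : tensorEnd k μ.cells (diagEnd k fun _ : Fin n => (1 : k)) (hwTensor k hμ) =
        (Fintype.card μ.cells : k) • hwTensor k hμ := by
      rw [hwTensor_eq, tensorEnd_diagEnd_permAct_rowTensor]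
      simp
    have h3 := aeval_apply_eigenvector (M := ⨂[k] _ : μ.cells, (Fin n →₀ k)) h2 p
    rw [hp, one_smul] at h3
    rw [map_mul, Module.End.mul_apply, tensorAct, haeval]
    exact (congrArg _ h3).trans hε
  · obtain ⟨Φ, hΦ⟩ := key _ hpa
    refine ⟨Φ, ?_⟩
    rw [map_mul, Module.End.mul_apply, haeval, ← hΦ]

end Core
-- Generation by the highest weight vector and the universal property
section Generation
variable {k : Type u} [Field k] {n : ℕ} {μ : YoungDiagram} (hμ : μ.colLen 0 ≤ n)

variable (k) in
/-- The highest weight vector of `S_μ(k^n)`. -/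
noncomputable def hwVector : Schur k μ (Fin n →₀ k) := ⟨hwTensor k hμ, _, rfl⟩

theorem incl_hwVector : Schur.incl k μ (hwVector k hμ) = hwTensor k hμ := rfl

theorem hwVector_ne_zero [CharZero k] : hwVector k hμ ≠ 0 := fun h =>
  hwTensor_ne_zero k hμ (by rw [← incl_hwVector, h, map_zero])

theorem Schur.incl_mem {M : Type*} [AddCommGroup M] [Module k M] (x : Schur k μ M) :
    Schur.incl k μ x ∈ LinearMap.range (youngSymmetrizer k μ M) := x.2

variable [CharZero k] {L V : Type*} [LieRing L] [LieAlgebra k L] [AddCommGroup V] [Module k V]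
  [LieRingModule L V] [LieModule k L V]

theorem eq_top_of_hwVector_mem {j : (Fin n →₀ k) →ₗ[k] V} {D : ((Fin n →₀ k) →ₗ[k] V) → L}
    (hD : ∀ f w, ⁅D f, j w⁆ = f w) {N : LieSubmodule k L (Schur k μ V)}
    (h : Schur.map k μ j (hwVector k hμ) ∈ N) : N = ⊤ := by
  rw [eq_top_iff]
  rintro x -
  have := range_youngSymmetrizer_le hμ (j := j) (D := fun f => LieModule.toEnd k L V (D f))
    (fun f => LinearMap.ext (hD f)) (N.toSubmodule.map (Schur.incl k μ))
    ⟨_, h, rfl⟩ (by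
      rintro f _ ⟨y, hy, rfl⟩
      exact ⟨⁅D f, y⁆, N.lie_mem hy, rfl⟩) (Schur.incl_mem x)
  obtain ⟨y, hy, hyx⟩ := this
  rwa [← Schur.incl_injective k μ hyx]

theorem hom_eq_of_hwVector {j : (Fin n →₀ k) →ₗ[k] V} {D : ((Fin n →₀ k) →ₗ[k] V) → L}
    (hD : ∀ f w, ⁅D f, j w⁆ = f w) {N : Type*} [AddCommGroup N] [Module k N] [LieRingModule L N]
    [LieModule k L N] {F G : Schur k μ V →ₗ⁅k, L⁆ N}
    (h : F (Schur.map k μ j (hwVector k hμ)) = G (Schur.map k μ j (hwVector k hμ))) : F = G := by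
  have : (F - G).ker = ⊤ := eq_top_of_hwVector_mem hμ hD (by
    rw [LieModuleHom.mem_ker, LieModuleHom.sub_apply, h, sub_self])
  ext x
  have hx : x ∈ (F - G).ker := by rw [this]; trivial
  rwa [LieModuleHom.mem_ker, LieModuleHom.sub_apply, sub_eq_zero] at hx

/-- The map `Φ` sends the generator to `w a`, which lies in `A`; the preimage of `A` is a submodule
containing the generator, hence everything, and `π` can be applied. -/
theorem exists_hom_of_subquotient {L V M : Type u} [LieRing L] [LieAlgebra k L] [AddCommGroup V]
    [Module k V] [LieRingModule L V] [LieModule k L V] [AddCommGroup M] [Module k M]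
    [LieRingModule L M] [LieModule k L M]
    {j : (Fin n →₀ k) →ₗ[k] V} {D : ((Fin n →₀ k) →ₗ[k] V) → L}
    (hD : ∀ f w, ⁅D f, j w⁆ = f w) {I : Type u} {d : I → ℕ}
    {A : LieSubmodule k L (⨁ i, ⨂[k] _ : Fin (d i), V)} (π : A →ₗ⁅k, L⁆ M) {G : Type*} (γ : G → L)
    (w : FreeAlgebra k G) (a : A) (Φ : (⨂[k] _ : μ.cells, V) →ₗ[k] TensorSum (k := k) d V)
    (hΦ : ∀ (x : L) t, Φ (tensorEnd k μ.cells (LieModule.toEnd k L V x) t) =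
      tensorSumEnd d (LieModule.toEnd k L V x) (Φ t))
    (h : Φ (PiTensorProduct.map (fun _ => j) (hwTensor k hμ)) =
      freeAct (fun g => tensorSumEnd d (LieModule.toEnd k L V (γ g))) w a.1) :
    ∃ F : Schur k μ V →ₗ⁅k, L⁆ M, F (Schur.map k μ j (hwVector k hμ)) =
      freeAct (fun g => LieModule.toEnd k L M (γ g)) w (π a) := by
  let F : Schur k μ V →ₗ⁅k, L⁆ (⨁ i, ⨂[k] _ : Fin (d i), V) :=
    { toLinearMap := Φ ∘ₗ Schur.incl k μ
      map_lie' := fun {x t} => hΦ x (Schur.incl k μ t) }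
  have hF : F (Schur.map k μ j (hwVector k hμ)) =
      freeAct (fun g => tensorSumEnd d (LieModule.toEnd k L V (γ g))) w a.1 := h
  have hA : A.comap F = ⊤ := eq_top_of_hwVector_mem hμ hD (by
    rw [LieSubmodule.mem_comap, hF]
    exact freeAct_mem (K := A.toSubmodule) (fun g _ hm => A.lie_mem (x := γ g) hm) w a.2)
  refine ⟨π.comp (F.codRestrict A fun x => ?_), ?_⟩
  · rw [← LieSubmodule.mem_comap, hA]; trivial
  · rw [LieModuleHom.comp_apply]
    refine Eq.trans (congrArg π (Subtype.ext ?_)) (freeAct_map (M := A) (M' := M)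
      (ρ := fun g => LieModule.toEnd k L A (γ g)) (ρ' := fun g => LieModule.toEnd k L M (γ g))
      (f := (π : A →ₗ[k] M)) (fun g m => π.map_lie (γ g) m) w a)
    refine hF.trans (freeAct_map (M := A) (M' := TensorSum (k := k) d V)
      (ρ := fun g => LieModule.toEnd k L A (γ g))
      (ρ' := fun g => tensorSumEnd d (LieModule.toEnd k L V (γ g)))
      (f := A.toSubmodule.subtype) (fun _ _ => rfl) w a).symm

end Generation

section GlRep
variable {k : Type u} [Field k] (P : LinearOperad k) (n : ℕ) (M : Type*) [AddCommGroup M]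
  [Module k M] [LieRingModule (P.h n) M] [LieModule k (P.h n) M]

/-- The action of `gl_n` on a representation of `h_n`. -/
noncomputable def glRep : Module.End k (Fin n →₀ k) →ₗ⁅k⁆ Module.End k M :=
  (LieModule.toEnd k (P.h n) M).comp (P.glDeriv (Fin n →₀ k))

variable {M}

theorem glRep_apply (A : Module.End k (Fin n →₀ k)) (m : M) :
    P.glRep n M A m = ⁅P.glDeriv (Fin n →₀ k) A, m⁆ := rfl

variable {n} {M' : Type*} [AddCommGroup M'] [Module k M'] [LieRingModule (P.h n) M']
  [LieModule k (P.h n) M']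

theorem map_freeAct_glRep (f : M →ₗ⁅k, P.h n⁆ M') (w : FreeAlgebra k (Module.End k (Fin n →₀ k)))
    (m : M) : f (freeAct (P.glRep n M) w m) = freeAct (P.glRep n M') w (f m) :=
  freeAct_map (f := (f : M →ₗ[k] M')) (fun A m => f.map_lie (P.glDeriv (Fin n →₀ k) A) m) w m

theorem incl_freeAct (μ : YoungDiagram) {U : Type*} [AddCommGroup U] [Module k U]
    (w : FreeAlgebra k (Module.End k U)) (x : Schur k μ U) :
    Schur.incl k μ (freeAct (LieModule.toEnd k (Module.End k U) (Schur k μ U)) w x) =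
      tensorAct k μ.cells U w (Schur.incl k μ x) :=
  freeAct_map (M := Schur k μ U) (M' := ⨂[k] _ : μ.cells, U)
    (ρ := LieModule.toEnd k (Module.End k U) (Schur k μ U)) (ρ' := tensorEnd k μ.cells)
    (f := Schur.incl k μ) (fun _ _ => rfl) w x

theorem map_freeAct_glHom {μ : YoungDiagram} {N : Type u} [AddCommGroup N] [Module k N]
    [LieRingModule (P.h n) N] [LieModule k (P.h n) N]
    {φ : Schur k μ (Fin n →₀ k) →ₗ[k] N} (hφ : φ ∈ P.glHom (U := Fin n →₀ k) _ N)
    (w : FreeAlgebra k (Module.End k (Fin n →₀ k))) (x : Schur k μ (Fin n →₀ k)) :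
    φ (freeAct (LieModule.toEnd k (Module.End k (Fin n →₀ k)) (Schur k μ (Fin n →₀ k))) w x) =
      freeAct (P.glRep n N) w (φ x) :=
  freeAct_map (M := Schur k μ (Fin n →₀ k)) (M' := N)
    (ρ := LieModule.toEnd k (Module.End k (Fin n →₀ k)) (Schur k μ (Fin n →₀ k)))
    (ρ' := P.glRep n N) (f := φ) hφ w x

theorem map_ι_mem_glHom (μ : YoungDiagram) :
    Schur.map k μ (Free.ι (P := P)) ∈
      P.glHom (U := Fin n →₀ k) (Schur k μ (Fin n →₀ k)) (Schur k μ (P.V n)) :=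
  Schur.map_ι_lie P μ

variable [CharZero k] {μ : YoungDiagram} (hμ : μ.colLen 0 ≤ n)

/-- The generator of `S_μ(V_n)`. -/
noncomputable def generator : Schur k μ (P.V n) := Schur.map k μ Free.ι (hwVector k hμ)

theorem lie_derivFun_ι (f : (Fin n →₀ k) →ₗ[k] P.V n) (w : Fin n →₀ k) :
    ⁅(⟨Free.derivFun f, Free.isDerivation_derivFun f⟩ : P.h n), (Free.ι w : P.V n)⁆ = f w :=
  Free.derivFun_ι f w

theorem eq_top_of_generator_mem {N : LieSubmodule k (P.h n) (Schur k μ (P.V n))}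
    (h : P.generator hμ ∈ N) : N = ⊤ :=
  eq_top_of_hwVector_mem hμ P.lie_derivFun_ι h

theorem hom_eq_of_generator {F G : Schur k μ (P.V n) →ₗ⁅k, P.h n⁆ M}
    (h : F (P.generator hμ) = G (P.generator hμ)) : F = G :=
  hom_eq_of_hwVector hμ P.lie_derivFun_ι h

theorem freeAct_generator {w : FreeAlgebra k (Module.End k (Fin n →₀ k))}
    (hw : tensorAct k μ.cells (Fin n →₀ k) w (hwTensor k hμ) = hwTensor k hμ) :
    freeAct (P.glRep n (Schur k μ (P.V n))) w (P.generator hμ) = P.generator hμ := by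
  rw [generator, ← map_freeAct_glHom P (P.map_ι_mem_glHom μ)]
  refine congrArg _ (Schur.incl_injective k μ ?_)
  rw [incl_freeAct, incl_hwVector, hw]

theorem exists_freeAct_eq_hwVector {x : Schur k μ (Fin n →₀ k)} (hx : x ≠ 0) :
    ∃ w, freeAct (LieModule.toEnd k (Module.End k (Fin n →₀ k)) (Schur k μ (Fin n →₀ k))) w x =
      hwVector k hμ := by
  obtain ⟨w, hw⟩ := exists_freeAct_eq_hwTensor hμ (Schur.incl_mem x) fun h =>
    hx (Schur.incl_injective k μ (h.trans (map_zero _).symm))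
  exact ⟨w, Schur.incl_injective k μ (by rw [incl_freeAct, hw, incl_hwVector])⟩

theorem exists_freeAct_hwVector_eq (x : Schur k μ (Fin n →₀ k)) :
    ∃ w, freeAct (LieModule.toEnd k (Module.End k (Fin n →₀ k)) (Schur k μ (Fin n →₀ k))) w
      (hwVector k hμ) = x := by
  obtain ⟨w, hw⟩ := exists_freeAct_hwTensor_eq hμ (Schur.incl_mem x)
  exact ⟨w, Schur.incl_injective k μ (by rw [incl_freeAct, ← hw, incl_hwVector])⟩

end GlRep

section Lift
variable {k : Type u} [Field k] [CharZero k] (P : LinearOperad k) {n : ℕ} {μ : YoungDiagram}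
  (hμ : μ.colLen 0 ≤ n)

/-- The basic source of homomorphisms. In general the generator does not go to `m` itself, but the
correction `w` fixes the highest weight tensor, so it is invisible whenever `m` transforms like that
tensor. -/
theorem exists_hom_generator {M : Type u} [AddCommGroup M] [Module k M] [LieRingModule (P.h n) M]
    [LieModule k (P.h n) M] (hM : IsPolynomialRep k (P.h n) (P.V n) M) (m : M) :
    ∃ w, tensorAct k μ.cells (Fin n →₀ k) w (hwTensor k hμ) = hwTensor k hμ ∧
      ∃ F : Schur k μ (P.V n) →ₗ⁅k, P.h n⁆ M,
        F (P.generator hμ) = freeAct (P.glRep n M) w m := by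
  obtain ⟨I, d, A, π, hπ⟩ := hM
  obtain ⟨a, rfl⟩ := hπ m
  obtain ⟨w, hw, Φ, hΦ⟩ := P.exists_freeAct_eq_naturalOp hμ d a.1
  exact ⟨w, hw, exists_hom_of_subquotient hμ P.lie_derivFun_ι π (P.glDeriv (Fin n →₀ k)) w a
    (Φ.app _) (fun x t => Φ.app_tensorEnd x.2 t) hΦ.symm⟩

theorem lieSpan_range_map_ι (hμ : μ.colLen 0 ≤ n) : LieSubmodule.lieSpan k (P.h n)
    (Set.range (Schur.map k μ (Free.ι : (Fin n →₀ k) →ₗ[k] P.V n))) = ⊤ :=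
  P.eq_top_of_generator_mem hμ (LieSubmodule.subset_lieSpan ⟨_, rfl⟩)

/-- Injectivity is generation. For surjectivity, the lift of `φ(v)` has value `w φ(v) = φ(w v) =
φ(v)` at the generator, and the action of `gl_n` transports the equality from `v` to all of
`S_μ(W_n)`. -/
theorem restrictHom_bijective (hμ : μ.colLen 0 ≤ n) {M : Type u} [AddCommGroup M] [Module k M]
    [LieRingModule (P.h n) M] [LieModule k (P.h n) M]
    (hM : IsPolynomialRep k (P.h n) (P.V n) M) : Function.Bijective (P.restrictHom n μ M) := by
  refine ⟨fun F G h => P.hom_eq_of_generator hμ ?_, fun φ => ?_⟩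
  · exact LinearMap.congr_fun (congrArg Subtype.val h) (hwVector k hμ)
  · obtain ⟨w, hw, F, hF⟩ := P.exists_hom_generator hμ hM (φ.1 (hwVector k hμ))
    have h0 : freeAct (LieModule.toEnd k (Module.End k (Fin n →₀ k)) (Schur k μ (Fin n →₀ k))) w
        (hwVector k hμ) = hwVector k hμ :=
      Schur.incl_injective k μ (by rw [incl_freeAct, incl_hwVector, hw])
    rw [← map_freeAct_glHom P φ.2, h0] at hF
    refine ⟨F, Subtype.ext (LinearMap.ext fun x => ?_)⟩
    obtain ⟨w', rfl⟩ := exists_freeAct_hwVector_eq hμ x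
    rw [map_freeAct_glHom P φ.2, map_freeAct_glHom P (P.restrictHom n μ M F).2]
    exact congrArg _ hF

end Lift
-- Specialization to invariants of `gl_{∞-n}`
section SchurToSum
variable (k : Type u) [Field k] (μ : YoungDiagram) (V : Type u) [AddCommGroup V] [Module k V]
  {V' : Type u} [AddCommGroup V'] [Module k V']

/-- The Schur functor embedded in a tensor power. -/
noncomputable def schurToSum :
    Schur k μ V →ₗ[k] TensorSum (k := k) (fun _ : PUnit.{u+1} => Fintype.card μ.cells) V :=
  DirectSum.lof k PUnit.{u+1} (fun _ => ⨂[k] _ : Fin (Fintype.card μ.cells), V) PUnit.unit ∘ₗ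
    (PiTensorProduct.reindex k (fun _ => V) (Fintype.equivFin μ.cells)).toLinearMap ∘ₗ
      Schur.incl k μ

theorem schurToSum_injective : Function.Injective (schurToSum k μ V) :=
  (DirectSum.of_injective PUnit.unit).comp
    ((PiTensorProduct.reindex k (fun _ => V) (Fintype.equivFin μ.cells)).injective.comp
      (Schur.incl_injective k μ))

variable {V}

theorem tensorSumMap_schurToSum (f : V →ₗ[k] V') (x : Schur k μ V) :
    tensorSumMap _ f (schurToSum k μ V x) = schurToSum k μ V' (Schur.map k μ f x) := by
  rw [schurToSum, LinearMap.comp_apply, LinearMap.comp_apply, tensorSumMap, DirectSum.lmap_lof,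
    LinearEquiv.coe_coe, map_reindex, ← Schur.incl_map]
  rfl

theorem schurToSum_lie {L : Type*} [LieRing L] [LieAlgebra k L] [LieRingModule L V]
    [LieModule k L V] (x : L) (t : Schur k μ V) :
    schurToSum k μ V ⁅x, t⁆ = tensorSumEnd _ (LieModule.toEnd k L V x) (schurToSum k μ V t) := by
  conv_rhs => rw [schurToSum, LinearMap.comp_apply, LinearMap.comp_apply, tensorSumEnd,
    DirectSum.lmap_lof, LinearEquiv.coe_coe, tensorEnd_reindex]
  rfl

theorem Schur.map_map {V'' : Type*} [AddCommGroup V''] [Module k V''] (f : V →ₗ[k] V')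
    (g : V' →ₗ[k] V'') (x : Schur k μ V) :
    Schur.map k μ g (Schur.map k μ f x) = Schur.map k μ (g ∘ₗ f) x :=
  Schur.incl_injective k μ (by
    rw [Schur.incl_map, Schur.incl_map, Schur.incl_map, PiTensorProduct.map_comp]
    rfl)

theorem Schur.map_id (x : Schur k μ V) : Schur.map k μ LinearMap.id x = x :=
  Schur.incl_injective k μ (by rw [Schur.incl_map, PiTensorProduct.map_id]; rfl)

end SchurToSum

section Cutoff
variable {k : Type u} [Field k] (P : LinearOperad k) {n : ℕ} {I : Type u} (d : I → ℕ)

theorem exists_mem_span_of_iUnion {M : Type*} [AddCommGroup M] [Module k M] {s : ℕ → Set M}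
    (hs : Monotone s) (h : Submodule.span k (⋃ m, s m) = ⊤) (x : M) :
    ∃ m, x ∈ Submodule.span k (s m) := by
  have hx : x ∈ ⨆ m, Submodule.span k (s m) := by
    rw [← Submodule.span_iUnion, h]; trivial
  exact (Submodule.mem_iSup_of_directed _
    (Monotone.directed_le fun _ _ hab => Submodule.span_mono (hs hab))).1 hx

/-- The monomials in the first `m` variables. -/
def boundedMonomials (m : ℕ) : Set (TensorSum (k := k) d P.VInf) :=
  P.sumMonomial d '' {g | ∀ c t, (g.2 c).2.2 t < m}

theorem exists_mem_span_boundedMonomials (z : TensorSum (k := k) d P.VInf) :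
    ∃ m, z ∈ Submodule.span k (P.boundedMonomials d m) := by
  refine exists_mem_span_of_iUnion (fun a b hab => Set.image_mono fun g hg c t =>
    (hg c t).trans_le hab) ?_ z
  rw [eq_top_iff, ← P.span_sumMonomial d]
  refine Submodule.span_mono ?_
  rintro _ ⟨g, rfl⟩
  -- A crude bound: the sum of all indices that occur, each increased by one, exceeds every one of
  -- them.
  refine Set.mem_iUnion.2 ⟨∑ c, ∑ t, ((g.2 c).2.2 t + 1), g, fun c t => ?_, rfl⟩
  have h1 := Finset.single_le_sum (f := fun c => ∑ t, ((g.2 c).2.2 t + 1))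
    (fun _ _ => Nat.zero_le _) (Finset.mem_univ c)
  have h2 := Finset.single_le_sum (f := fun t => ((g.2 c).2.2 t + 1))
    (fun _ _ => Nat.zero_le _) (Finset.mem_univ t)
  exact (Nat.lt_succ_self _).trans_le (h2.trans h1)

theorem boundedMonomials_subset :
    P.boundedMonomials d n ⊆ LinearMap.range (tensorSumMap d (P.inclV n)) := by
  classical
  rintro _ ⟨g, hg, rfl⟩
  refine ⟨P.sumMonomial d ⟨g.1, fun c => ⟨(g.2 c).1, (g.2 c).2.1,
    fun t => ⟨(g.2 c).2.2 t, hg c t⟩⟩⟩, ?_⟩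
  rw [sumMonomial, tensorSumMap, DirectSum.lmap_lof, sumMonomial, tensorMonomial,
    PiTensorProduct.map_tprod]
  refine congrArg (DirectSum.lof k I _ g.1) (congrArg (PiTensorProduct.tprod k) (funext fun c => ?_))
  rw [basisMonomial, inclV, Free.map_mk]
  simp only [inclW_single]
  rfl

variable (k n) in
/-- The diagonal matrix unit of the block of indices `n ≤ j < m`. -/
noncomputable def cutoff (m : ℕ) : glCompl k n :=
  ⟨diagEnd k fun j => if n ≤ j ∧ j < m then 1 else 0, by
    refine ⟨fun i hi => ?_, fun i j hj => ?_, (Set.finite_lt_nat m).subset fun i hi => ?_⟩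
    · rw [diagEnd_single, if_neg (by omega), zero_smul]
    · rw [diagEnd_single]
      by_cases h : i = j
      · rw [if_neg (by omega), zero_smul]; rfl
      · rw [Finsupp.smul_apply, Finsupp.single_eq_of_ne' h, smul_zero]
    · by_contra h
      refine hi ?_
      rw [diagEnd_single, if_neg (fun h' => h h'.2), zero_smul]⟩

variable [CharZero k]

/-- Let `m` bound the variables occurring in `z`. The matrix `cutoff k n m` counts the variables of
index at least `n` in each monomial of `z`, and eigenvalue `0` leaves the monomials over `V_n`. The
condition `p(0) = 1` makes the operator the identity on invariants. -/
theorem exists_aeval_mem_range (z : TensorSum (k := k) d P.VInf) :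
    ∃ (A : glCompl k n) (p : Polynomial k), p.eval 0 = 1 ∧
      Polynomial.aeval (tensorSumEnd d (LieModule.toEnd k P.hInf P.VInf (P.glComplDeriv n A))) p z ∈
        LinearMap.range (tensorSumMap d (P.inclV n)) := by
  obtain ⟨m, hm⟩ := P.exists_mem_span_boundedMonomials d z
  have hf : ∀ g, tensorSumEnd d
      (LieModule.toEnd k P.hInf P.VInf (P.glComplDeriv n (cutoff k n m))) (P.sumMonomial d g) =
      ((∑ c, ∑ t, if n ≤ (g.2 c).2.2 t ∧ (g.2 c).2.2 t < m then 1 else 0 : ℕ) : k) •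
        P.sumMonomial d g := fun g => by
    refine (P.tensorSumEnd_diagEnd_sumMonomial d _ g).trans ?_
    push_cast
    rfl
  obtain ⟨p, hp, hpz⟩ := exists_aeval_mem (r := 0) (Y := Submodule.span k (P.boundedMonomials d n))
    (f := tensorSumEnd d (LieModule.toEnd k P.hInf P.VInf (P.glComplDeriv n (cutoff k n m))))
    (fun y hy => by
      rw [Nat.cast_zero, zero_smul]
      induction hy using Submodule.span_induction with
      | mem y hy =>
        obtain ⟨g, hg, rfl⟩ := hy
        rw [hf, Finset.sum_eq_zero, Nat.cast_zero, zero_smul]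
        exact fun c _ => Finset.sum_eq_zero fun t _ => if_neg fun h => (hg c t).not_ge h.1
      | zero => rw [map_zero]
      | add x y _ _ hx hy => rw [map_add, hx, hy, add_zero]
      | smul c x _ hx => rw [map_smul, hx, smul_zero])
    (by
      rintro _ ⟨g, hg, rfl⟩
      refine ⟨_, hf g, fun h => Submodule.subset_span ⟨g, fun c t => ?_, rfl⟩⟩
      by_contra hn
      have := Finset.sum_eq_zero_iff.1 (Finset.sum_eq_zero_iff.1 h c (Finset.mem_univ c)) t
        (Finset.mem_univ t)
      rw [if_pos ⟨not_lt.1 hn, hg c t⟩] at this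
      exact one_ne_zero this) hm
  refine ⟨cutoff k n m, p, by simpa using hp, ?_⟩
  exact Submodule.span_le.2 (P.boundedMonomials_subset d) hpz

end Cutoff

section Specialization
variable {k : Type u} [Field k] [CharZero k] (P : LinearOperad k) {n : ℕ} {μ : YoungDiagram}

theorem projV_inclV (x : P.V n) : Free.map (projW n) (P.inclV n x) = x := by
  have : Free.map (projW n) ∘ₗ P.inclV n = LinearMap.id := Free.hom_ext fun r p v => by
    rw [LinearMap.comp_apply, inclV, Free.map_mk, Free.map_mk]
    simp only [projW_inclW]
    rfl
  exact LinearMap.congr_fun this x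

/-- The projection `W → W_n` gives a left inverse. An invariant is fixed by the polynomial of
`exists_aeval_mem_range`, so it already consists of tensors on `V_n`, and its projection is a
preimage. -/
theorem schurToGamma_bijective (n : ℕ) (μ : YoungDiagram) :
    Function.Bijective (P.SchurToGamma n μ) := by
  have hinv : (Free.map (projW n)) ∘ₗ P.inclV n = LinearMap.id := LinearMap.ext P.projV_inclV
  refine ⟨fun x y h => ?_, fun y => ?_⟩
  · have h1 := congrArg (Schur.map k μ (Free.map (P := P) (projW n))) (congrArg Subtype.val h)
    change Schur.map k μ _ (Schur.map k μ _ x) = Schur.map k μ _ (Schur.map k μ _ y) at h1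
    rwa [Schur.map_map, Schur.map_map, hinv, Schur.map_id, Schur.map_id] at h1
  · obtain ⟨A, p, hp, b, hb⟩ := P.exists_aeval_mem_range (n := n) _ (schurToSum k μ P.VInf y.1)
    have h0 : tensorSumEnd _ (LieModule.toEnd k P.hInf P.VInf (P.glComplDeriv n A))
        (schurToSum k μ P.VInf y.1) = (0 : k) • schurToSum k μ P.VInf y.1 := by
      rw [← schurToSum_lie, zero_smul]
      exact (congrArg _ (y.2 A)).trans (map_zero _)
    rw [aeval_apply_eigenvector h0, hp, one_smul] at hb
    refine ⟨Schur.map k μ (Free.map (projW n)) y.1, Subtype.ext (schurToSum_injective k μ _ ?_)⟩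
    change schurToSum k μ _ (Schur.map k μ _ (Schur.map k μ _ y.1)) = _
    rw [← tensorSumMap_schurToSum, ← tensorSumMap_schurToSum, ← hb]
    refine congrArg _ (DFinsupp.ext fun i => ?_)
    change PiTensorProduct.map _ (PiTensorProduct.map _ (b i)) = b i
    rw [← LinearMap.comp_apply, ← PiTensorProduct.map_comp]
    simp only [hinv, PiTensorProduct.map_id]
    rfl

theorem lie_derivFun_inclV_ι (f : (Fin n →₀ k) →ₗ[k] P.VInf) (w : Fin n →₀ k) :
    ⁅(⟨Free.derivFun (f ∘ₗ projW n), Free.isDerivation_derivFun _,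
      (Set.finite_lt_nat n).subset fun i hi => by
        by_contra h
        refine hi ?_
        rw [Free.derivFun_ι, LinearMap.comp_apply, projW_single_of_le n (not_lt.1 h), map_zero]⟩ :
          P.hInf), (P.inclV n ∘ₗ Free.ι) w⁆ = f w := by
  change Free.derivFun (f ∘ₗ projW n) (P.inclV n (Free.ι w)) = f w
  rw [inclV, Free.map_ι, Free.derivFun_ι, LinearMap.comp_apply, projW_inclW]

/-- Injectivity holds because the highest weight vector of `S_μ(W_n)` already generates `S_μ(V)`
over `h`. For surjectivity, the invariant `g(v)` lifts to tensors on `V_n`, where a natural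
operation is available; that operation is then used over `V`. -/
theorem gammaHom_bijective (hμ : μ.colLen 0 ≤ n) {N : Type u} [AddCommGroup N] [Module k N]
    [LieRingModule P.hInf N] [LieModule k P.hInf N]
    (hN : IsPolynomialRep k P.hInf P.VInf N) : Function.Bijective (P.GammaHom n μ N) := by
  refine ⟨fun F G h => ?_, fun g => ?_⟩
  · refine hom_eq_of_hwVector hμ P.lie_derivFun_inclV_ι ?_
    rw [← Schur.map_map]
    exact congrArg Subtype.val (LieModuleHom.congr_fun h (P.generator hμ))
  · obtain ⟨I, d, A, π, hπ⟩ := hN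
    obtain ⟨a, ha⟩ := hπ (g (P.generator hμ)).1
    obtain ⟨B, p, hp, b, hb⟩ := P.exists_aeval_mem_range (n := n) d a.1
    -- The new lift comes from tensors on `V_n` and has the same image in `N`, because `p(0) = 1`
    -- and the image is invariant.
    set a' : A := Polynomial.aeval (LieModule.toEnd k P.hInf A (P.glComplDeriv n B)) p a with ha'
    have hb' : a'.1 = tensorSumMap d (P.inclV n) b := by
      rw [hb]
      exact aeval_map_apply (M := A) (M' := TensorSum (k := k) d P.VInf)
        (f := LieModule.toEnd k P.hInf A (P.glComplDeriv n B))
        (f' := tensorSumEnd d (LieModule.toEnd k P.hInf P.VInf (P.glComplDeriv n B)))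
        (g := A.toSubmodule.subtype) (fun _ => rfl) p a
    have hy : π a' = (g (P.generator hμ)).1 := by
      have h1 := aeval_map_apply (f := LieModule.toEnd k P.hInf A (P.glComplDeriv n B))
        (f' := LieModule.toEnd k P.hInf N (P.glComplDeriv n B)) (g := (π : A →ₗ[k] N))
        (fun m => π.map_lie _ m) p a
      refine h1.trans ?_
      change Polynomial.aeval (LieModule.toEnd k P.hInf N (P.glComplDeriv n B)) p (π a) = _
      have h0 : LieModule.toEnd k P.hInf N (P.glComplDeriv n B) (π a) = (0 : k) • π a := by
        rw [zero_smul, ha]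
        exact (g (P.generator hμ)).2 B
      rw [aeval_apply_eigenvector h0, hp, one_smul, ha]
    -- The operation is found over `V_n`; naturality along `V_n ⊂ V` identifies its value at `v`
    -- over `V` with `w a'`.
    obtain ⟨w, hw, Φ, hΦ⟩ := P.exists_freeAct_eq_naturalOp hμ d b
    obtain ⟨F, hF⟩ := exists_hom_of_subquotient hμ P.lie_derivFun_inclV_ι π
      (fun A => P.extend n (P.glDeriv (Fin n →₀ k) A)) w a' (Φ.app _)
      (fun x t => Φ.app_tensorEnd x.2.1 t) (by
        rw [PiTensorProduct.map_comp, LinearMap.comp_apply, hb', inclV, ← Φ.map_app, ← hΦ]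
        exact freeAct_map (f := tensorSumMap d (P.inclV n)) (fun A m =>
          tensorSumMap_tensorSumEnd d (fun m =>
            (P.extendDeriv_inclV n (P.glDeriv (Fin n →₀ k) A).2 m).symm) m) w b)
    refine ⟨F, P.hom_eq_of_generator hμ (Subtype.ext ?_)⟩
    rw [← Schur.map_map] at hF
    refine hF.trans ?_
    rw [hy]
    -- The correction `w` acts on `Γ_n(N)` as it does inside `N`, and `g` carries it to the
    -- generator, which `w` fixes.
    have h2 := freeAct_map (M := P.Gamma n N) (f := (P.Gamma n N).subtype)
      (ρ := P.glRep n (P.Gamma n N))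
      (ρ' := fun A => LieModule.toEnd k P.hInf N (P.extend n (P.glDeriv (Fin n →₀ k) A)))
      (fun _ _ => rfl) w (g (P.generator hμ))
    rw [← map_freeAct_glRep, P.freeAct_generator hμ hw] at h2
    exact h2.symm

end Specialization
-- Polynomial modules as quotients; projectivity
section LieSum
variable {k : Type*} [Field k] {L : Type*} [LieRing L] [LieAlgebra k L] {I : Type*} [DecidableEq I]
  {M : I → Type*}
  [∀ i, AddCommGroup (M i)] [∀ i, Module k (M i)] [∀ i, LieRingModule L (M i)]
  {N : Type*} [AddCommGroup N] [Module k N] [LieRingModule L N] [LieModule k L N]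

/-- The map out of a direct sum of representations given by maps out of the summands. -/
noncomputable def lieSumLift (F : ∀ i, M i →ₗ⁅k, L⁆ N) : (⨁ i, M i) →ₗ⁅k, L⁆ N :=
  { toLinearMap := DirectSum.toModule k I N fun i => (F i : M i →ₗ[k] N)
    map_lie' := fun {x m} => by
      change DirectSum.toModule k I N (fun i => (F i : M i →ₗ[k] N)) ⁅x, m⁆ =
        ⁅x, DirectSum.toModule k I N (fun i => (F i : M i →ₗ[k] N)) m⁆
      induction m using DirectSum.induction_on with
      | zero => rw [lie_zero, map_zero, lie_zero]
      | add a b ha hb => rw [lie_add, map_add, ha, hb, map_add, lie_add]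
      | of i t =>
        change DirectSum.toModule k I N _ ⁅x, DirectSum.lieModuleOf k I L M i t⁆ =
          ⁅x, DirectSum.toModule k I N _ (DirectSum.lof k I M i t)⁆
        rw [← LieModuleHom.map_lie]
        change DirectSum.toModule k I N _ (DirectSum.lof k I M i ⁅x, t⁆) = _
        rw [DirectSum.toModule_lof, DirectSum.toModule_lof]
        exact (F i).map_lie x t }

theorem lieSumLift_lof (F : ∀ i, M i →ₗ⁅k, L⁆ N) (i : I) (m : M i) :
    lieSumLift F (DirectSum.lof k I M i m) = F i m :=
  DirectSum.toModule_lof k i m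

theorem lieSumLift_eq_sum [∀ i (x : M i), Decidable (x ≠ 0)]
    (F : ∀ i, M i →ₗ⁅k, L⁆ N) (m : ⨁ i, M i) :
    lieSumLift F m = ∑ i ∈ DFinsupp.support m, F i (m i) := by
  conv_lhs => rw [← DirectSum.sum_support_of m]
  rw [← LieModuleHom.coe_toLinearMap, map_sum]
  exact Finset.sum_congr rfl fun i _ => lieSumLift_lof F i (m i)

theorem lieSumLift_surjective [∀ i, LieModule k L (M i)]
    (F : ∀ i, M i →ₗ⁅k, L⁆ N)
    (h : ∀ K : LieSubmodule k L N, K ≠ ⊤ → ∃ i x, F i x ∉ K) :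
    Function.Surjective (lieSumLift F) := by
  rw [← LieModuleHom.range_eq_top]
  by_contra hne
  obtain ⟨i, x, hx⟩ := h _ hne
  exact hx ((LieModuleHom.mem_range _ _).2 ⟨DirectSum.lof k I M i x, lieSumLift_lof F i x⟩)

end LieSum

section Polynomial
variable {k : Type u} [Field k] {L V : Type u} [LieRing L] [LieAlgebra k L]
  [AddCommGroup V] [Module k V] [LieRingModule L V] [LieModule k L V]

theorem IsPolynomialRep.of_surjective {M N : Type u} [AddCommGroup M] [Module k M]
    [LieRingModule L M] [LieModule k L M] [AddCommGroup N] [Module k N] [LieRingModule L N]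
    [LieModule k L N] (hM : IsPolynomialRep k L V M) (f : M →ₗ⁅k, L⁆ N)
    (hf : Function.Surjective f) : IsPolynomialRep k L V N := by
  obtain ⟨I, d, A, π, hπ⟩ := hM
  exact ⟨I, d, A, f.comp π, hf.comp hπ⟩

theorem IsPolynomialRep.of_injective {M : Type u} [AddCommGroup M] [Module k M]
    [LieRingModule L M] [LieModule k L M] {I : Type u} {d : I → ℕ}
    (f : M →ₗ⁅k, L⁆ ⨁ i, ⨂[k] _ : Fin (d i), V) (hf : Function.Injective f) :
    IsPolynomialRep k L V M := by
  let g : M →ₗ⁅k, L⁆ f.range := f.codRestrict f.range fun m => (f.mem_range _).2 ⟨m, rfl⟩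
  let e : M ≃ₗ[k] f.range := LinearEquiv.ofBijective (g : M →ₗ[k] f.range)
    ⟨fun x y h => hf (congrArg Subtype.val h), fun ⟨y, hy⟩ => by
      obtain ⟨x, rfl⟩ := (f.mem_range y).1 hy
      exact ⟨x, rfl⟩⟩
  have he : ∀ m, (e m : ⨁ i, ⨂[k] _ : Fin (d i), V) = f m := fun _ => rfl
  refine ⟨I, d, f.range, { toLinearMap := e.symm.toLinearMap, map_lie' := fun {x m} => ?_ },
    e.symm.surjective⟩
  change e.symm ⁅x, m⁆ = ⁅x, e.symm m⁆
  rw [LinearEquiv.symm_apply_eq]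
  refine Subtype.ext ?_
  rw [he, f.map_lie, ← he, LinearEquiv.apply_symm_apply]
  rfl

theorem isPolynomialRep_schurSum {I : Type u} (ν : I → YoungDiagram) :
    IsPolynomialRep k L V (⨁ i, Schur k (ν i) V) := by
  refine IsPolynomialRep.of_injective (d := fun i => Fintype.card (ν i).cells)
    { toLinearMap := DirectSum.lmap fun i =>
        (PiTensorProduct.reindex k (fun _ => V) (Fintype.equivFin (ν i).cells)).toLinearMap ∘ₗ
          Schur.incl k (ν i)
      map_lie' := fun {x m} => DFinsupp.ext fun i =>
        (tensorEnd_reindex (Fintype.equivFin (ν i).cells) (LieModule.toEnd k L V x)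
          (Schur.incl k (ν i) (m i))).symm }
    ((DirectSum.lmap_injective _).2 fun i =>
      (PiTensorProduct.reindex k (fun _ => V) _).injective.comp (Schur.incl_injective k (ν i)))

theorem isPolynomialRep_schur (ν : YoungDiagram) : IsPolynomialRep k L V (Schur k ν V) :=
  (isPolynomialRep_schurSum fun _ : PUnit.{u+1} => ν).of_surjective
    (DirectSum.lieModuleComponent k PUnit L (fun _ => Schur k ν V) PUnit.unit)
    fun x => ⟨DirectSum.lof k PUnit (fun _ => Schur k ν V) PUnit.unit x,
      DirectSum.lof_apply (M := fun _ : PUnit.{u+1} => Schur k ν V) k PUnit.unit x⟩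

end Polynomial

section HighestWeightPair
variable {k : Type*} [Field k] [CharZero k] {n : ℕ} {M M' : Type*} [AddCommGroup M] [Module k M]
  [AddCommGroup M'] [Module k M'] {ρ : Module.End k (Fin n →₀ k) →ₗ⁅k⁆ Module.End k M}
  {ρ' : Module.End k (Fin n →₀ k) →ₗ⁅k⁆ Module.End k M'} {κ : Fin n → k} {v : M} {v' : M'}

/-- Highest weight vectors of the same weight are annihilated by the same elements, as far as those
elements preserve the weight. -/
theorem IsHighestWeight.eq_zero_of_freeAct_eq_zero (hv : IsHighestWeight ρ κ v)
    (hv' : IsHighestWeight ρ' κ v') (h0 : v' ≠ 0)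
    {w : FreeAlgebra k (Module.End k (Fin n →₀ k))} (h : freeAct ρ w v = 0)
    (h' : freeAct ρ' w v' = v') : v = 0 := by
  let σ : Module.End k (Fin n →₀ k) →ₗ⁅k⁆ Module.End k (M × M') :=
    { toFun := fun A => (ρ A).prodMap (ρ' A)
      map_add' := fun A B => by rw [map_add, map_add]; rfl
      map_smul' := fun c A => by rw [map_smul, map_smul]; rfl
      map_lie' := fun {A B} => by
        refine LinearMap.ext fun x => ?_
        rw [LieHom.map_lie, LieHom.map_lie]
        rfl }
  -- The pair is a highest weight vector of the product, and `w` sends it to `(0, v')`, of the same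
  -- weight. By multiplicity one this is `c (v, v')`; the second component gives `c = 1` and the
  -- first gives `v = 0`.
  have hp : IsHighestWeight σ κ (v, v') :=
    ⟨fun i => Prod.ext (hv.weight i) (hv'.weight i),
      fun i j hij => Prod.ext (hv.raise i j hij) (hv'.raise i j hij)⟩
  have hw : freeAct σ w (v, v') = (0, v') := (freeAct_prod _ _ w _ _).trans (Prod.ext h h')
  obtain ⟨c, hc⟩ := hp.eq_smul w fun i => by
    rw [hw]
    refine Prod.ext ?_ (hv'.weight i)
    change ρ _ 0 = _ • 0
    rw [map_zero, smul_zero]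
  rw [hw] at hc
  have h3 : (1 : k) • v' = c • v' := (one_smul k v').trans (congrArg Prod.snd hc)
  have h4 : 0 = c • v := congrArg Prod.fst hc
  rw [← smul_left_injective k h0 h3, one_smul] at h4
  exact h4.symm

end HighestWeightPair

section GlWeights
variable {k : Type u} [Field k] [CharZero k] (P : LinearOperad k) {n : ℕ}

/-- Tensors of monomials are eigenvectors with natural eigenvalues, and the property passes to
submodules and quotients. -/
theorem locallyNatSplit_glRep_diagEnd {M : Type u} [AddCommGroup M] [Module k M]
    [LieRingModule (P.h n) M] [LieModule k (P.h n) M]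
    (hM : IsPolynomialRep k (P.h n) (P.V n) M) (α : Fin n → ℕ) :
    LocallyNatSplit (P.glRep n M (diagEnd k fun i => (α i : k))) := by
  obtain ⟨I, d, A, π, hπ⟩ := hM
  have h1 : LocallyNatSplit
      (tensorSumEnd d (Free.derivFun (P := P) (Free.ι ∘ₗ diagEnd k fun i => (α i : k)))) := by
    refine locallyNatSplit_of_span (P.span_sumMonomial d) ?_
    rintro _ ⟨g, rfl⟩
    refine ⟨∑ c, ∑ t, α ((g.2 c).2.2 t), ?_⟩
    rw [tensorSumEnd_diagEnd_sumMonomial]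
    push_cast
    rfl
  have h2 : LocallyNatSplit
      (LieModule.toEnd k (P.h n) A (P.glDeriv _ (diagEnd k fun i => (α i : k)))) :=
    h1.of_injective A.toSubmodule.subtype Subtype.val_injective fun _ => rfl
  exact h2.of_surjective (π : A →ₗ[k] M) hπ fun m => π.map_lie _ m

theorem locallyNatSplit_glRep_elemEnd {M : Type u} [AddCommGroup M] [Module k M]
    [LieRingModule (P.h n) M] [LieModule k (P.h n) M]
    (hM : IsPolynomialRep k (P.h n) (P.V n) M) (i : Fin n) :
    LocallyNatSplit (P.glRep n M (elemEnd k i i)) := by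
  have h := P.locallyNatSplit_glRep_diagEnd hM (Pi.single i 1)
  have : (fun j => ((Pi.single i 1 : Fin n → ℕ) j : k)) = Pi.single i 1 := by
    funext j
    by_cases h : j = i
    · subst h; simp
    · simp [h]
  rwa [this, ← elemEnd_self] at h

/-- Lift a highest weight vector of `M'` to `m`, and map the Schur module whose diagram has that
weight to `M` by `exists_hom_generator`. The composite sends the generator to `w` applied to the
highest weight vector, which is nonzero because `w` fixes a highest weight tensor of the same
weight. -/
theorem exists_ne_zero_hom {M M' : Type u} [AddCommGroup M] [Module k M]
    [LieRingModule (P.h n) M] [LieModule k (P.h n) M] [AddCommGroup M'] [Module k M']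
    [LieRingModule (P.h n) M'] [LieModule k (P.h n) M']
    (hM : IsPolynomialRep k (P.h n) (P.V n) M) (f : M →ₗ⁅k, P.h n⁆ M')
    (hf : Function.Surjective f) [Nontrivial M'] :
    ∃ (ν : YoungDiagram) (_ : ν.colLen 0 ≤ n) (F : Schur k ν (P.V n) →ₗ⁅k, P.h n⁆ M),
      f.comp F ≠ 0 := by
  have hs := P.locallyNatSplit_glRep_elemEnd (hM.of_surjective f hf)
  obtain ⟨κ, v, hv, hκ⟩ := exists_isHighestWeight hs
  have hanti := hκ.antitone hv hs
  obtain ⟨m, rfl⟩ := hf v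
  have hν := colLen_diagramOfWeight κ hanti
  obtain ⟨w, hw, F, hF⟩ := P.exists_hom_generator hν hM m
  refine ⟨_, hν, F, fun h0 => hv ?_⟩
  have h1 : freeAct (P.glRep n M') w (f m) = 0 := by
    rw [← map_freeAct_glRep, ← hF]
    exact LieModuleHom.congr_fun h0 _
  have hx := isHighestWeight_hwTensor k hν
  simp only [rowWeight_diagramOfWeight] at hx
  exact hκ.eq_zero_of_freeAct_eq_zero hx (hwTensor_ne_zero k hν) h1 hw

theorem exists_hom_notMem {M : Type u} [AddCommGroup M] [Module k M]
    [LieRingModule (P.h n) M] [LieModule k (P.h n) M]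
    (hM : IsPolynomialRep k (P.h n) (P.V n) M) {K : LieSubmodule k (P.h n) M} (hK : K ≠ ⊤) :
    ∃ (ν : YoungDiagram) (_ : ν.colLen 0 ≤ n) (F : Schur k ν (P.V n) →ₗ⁅k, P.h n⁆ M)
      (x : Schur k ν (P.V n)), F x ∉ K := by
  have hnt : Nontrivial (M ⧸ K) :=
    Submodule.Quotient.nontrivial_iff.2 fun h => hK ((LieSubmodule.toSubmodule_inj _ _).1 h)
  obtain ⟨ν, hν, F, hF⟩ := P.exists_ne_zero_hom hM (LieSubmodule.Quotient.mk' K)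
    (LieSubmodule.Quotient.surjective_mk' K)
  refine ⟨ν, hν, F, ?_⟩
  by_contra! h
  exact hF (LieModuleHom.ext fun x => LieSubmodule.Quotient.mk_eq_zero'.2 (h x))

theorem exists_surjective_schurSum {M : Type u} [AddCommGroup M] [Module k M]
    [LieRingModule (P.h n) M] [LieModule k (P.h n) M]
    (hM : IsPolynomialRep k (P.h n) (P.V n) M) :
    ∃ (I : Type u) (_ : DecidableEq I) (ν : I → YoungDiagram)
      (F : ∀ i, Schur k (ν i) (P.V n) →ₗ⁅k, P.h n⁆ M),
      (∀ i, (ν i).colLen 0 ≤ n) ∧ Function.Surjective (lieSumLift F) := by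
  classical
  -- The sum runs over all homomorphisms from all admissible Schur modules; a proper submodule
  -- containing every image would contradict `exists_hom_notMem`.
  refine ⟨Σ ν : {ν : YoungDiagram // ν.colLen 0 ≤ n}, (Schur k ν.1 (P.V n) →ₗ⁅k, P.h n⁆ M),
    inferInstance, fun i => i.1.1, fun i => i.2, fun i => i.1.2,
    lieSumLift_surjective _ fun K hK => ?_⟩
  obtain ⟨ν, hν, F, x, hx⟩ := P.exists_hom_notMem hM hK
  exact ⟨⟨⟨ν, hν⟩, F⟩, x, hx⟩

/-- A preimage `m` of `g(v)` need not be the value of a homomorphism, but `w m` is, and its image is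
`w g(v) = g(w v) = g(v)`. -/
theorem isProjectiveRep_schur {μ : YoungDiagram} (hμ : μ.colLen 0 ≤ n) :
    IsProjectiveRep k (P.h n) (P.V n) (Schur k μ (P.V n)) := by
  refine ⟨isPolynomialRep_schur μ, fun M N _ _ _ _ _ _ _ _ hM hN f g hf => ?_⟩
  obtain ⟨m, hm⟩ := hf (g (P.generator hμ))
  obtain ⟨w, hw, F, hF⟩ := P.exists_hom_generator hμ hM m
  refine ⟨F, P.hom_eq_of_generator hμ ?_⟩
  rw [LieModuleHom.comp_apply, hF, map_freeAct_glRep, hm, ← map_freeAct_glRep,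
    P.freeAct_generator hμ hw]

end GlWeights
-- Retracts of projective and indecomposable modules
section Retract
variable {k : Type u} [Field k] {L V Q : Type u} [LieRing L] [LieAlgebra k L]
  [AddCommGroup V] [Module k V] [LieRingModule L V] [LieModule k L V]
  [AddCommGroup Q] [Module k Q] [LieRingModule L Q] [LieModule k L Q]

/-- A splitting of the surjection writes `q = ∑ F_i(s_i(q))`, so some term is nonzero. -/
theorem IsProjectiveRep.exists_components (hQ : IsProjectiveRep k L V Q) {I : Type u}
    [DecidableEq I] {ν : I → YoungDiagram} {F : ∀ i, Schur k (ν i) V →ₗ⁅k, L⁆ Q}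
    (hF : Function.Surjective (lieSumLift F)) :
    ∃ s : ∀ i, Q →ₗ⁅k, L⁆ Schur k (ν i) V, ∀ q, q ≠ 0 → ∃ i, F i (s i q) ≠ 0 := by
  classical
  obtain ⟨s, hs⟩ := hQ.2 _ _ (isPolynomialRep_schurSum ν) hQ.1 (lieSumLift F) LieModuleHom.id hF
  refine ⟨fun i => (DirectSum.lieModuleComponent k I L _ i).comp s, fun q hq => ?_⟩
  by_contra! h
  refine hq ?_
  rw [← LieModuleHom.id_apply (R := k) (L := L) q, ← hs, LieModuleHom.comp_apply, lieSumLift_eq_sum]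
  exact Finset.sum_eq_zero fun i _ => h i

/-- The retraction splits `Q` as the image of `g` plus the kernel of `f`; the image is nonzero, so
the kernel vanishes. -/
theorem IsIndecomposableRep.nonempty_equiv {S : Type u} [AddCommGroup S] [Module k S]
    [LieRingModule L S] [LieModule k L S] [Nontrivial S] (hQ : IsIndecomposableRep k L Q)
    (f : Q →ₗ⁅k, L⁆ S) (g : S →ₗ⁅k, L⁆ Q) (h : f.comp g = LieModuleHom.id) :
    Nonempty (Q ≃ₗ⁅k, L⁆ S) := by
  have hfg : ∀ x, f (g x) = x := LieModuleHom.congr_fun h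
  have hc : IsCompl g.range f.ker := by
    refine ⟨disjoint_iff.2 ((LieSubmodule.eq_bot_iff _).2 fun q hq => ?_),
      codisjoint_iff.2 (eq_top_iff.2 fun q _ => ?_)⟩
    · obtain ⟨h1, h2⟩ := (LieSubmodule.mem_inf _ _ _).1 hq
      obtain ⟨x, rfl⟩ := (LieModuleHom.mem_range _ _).1 h1
      rw [LieModuleHom.mem_ker, hfg] at h2
      rw [h2]
      exact map_zero (g : S →ₗ[k] Q)
    · refine (LieSubmodule.mem_sup _ _ _).2 ⟨g (f q), (LieModuleHom.mem_range _ _).2 ⟨_, rfl⟩,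
        q - g (f q), ?_, add_sub_cancel _ _⟩
      rw [LieModuleHom.mem_ker]
      exact (map_sub (f : Q →ₗ[k] S) q (g (f q))).trans (sub_eq_zero.2 (hfg (f q)).symm)
  rcases hQ.2 _ _ hc with h1 | h1
  · exfalso
    obtain ⟨x, hx⟩ := exists_ne (0 : S)
    refine hx ?_
    have : g x = 0 := (LieSubmodule.eq_bot_iff _).1 h1 _ ((LieModuleHom.mem_range _ _).2 ⟨x, rfl⟩)
    rw [← hfg x, this]
    exact map_zero (f : Q →ₗ[k] S)
  · have hinj : Function.Injective f := fun x y hxy => sub_eq_zero.1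
      ((LieSubmodule.eq_bot_iff _).1 h1 _ ((LieModuleHom.mem_ker).2
        ((map_sub (f : Q →ₗ[k] S) x y).trans (sub_eq_zero.2 hxy))))
    exact ⟨{ f with
      invFun := g
      left_inv := fun q => hinj (hfg (f q))
      right_inv := hfg }⟩

end Retract

/-! ### Operads with `P([0]) = 0` and `P([1])` a line -/

section Reduced
variable {k : Type u} [Field k] (P : LinearOperad k)

/-- The identity operation as an element of `P([1])`. -/
noncomputable def one' : P.obj (Fin 1) := P.map (Equiv.equivPUnit (Fin 1)).symm P.one

/-- If the identity operation were zero, the unit law would express every unary operation as a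
composite with a zero argument. -/
theorem one'_ne_zero (h : Module.finrank k (P.obj (Fin 1)) = 1) : P.one' ≠ 0 := by
  intro h1
  have h2 : P.one = 0 := by
    rw [← P.map_refl P.one, ← Equiv.symm_trans_self (Equiv.equivPUnit (Fin 1)), P.map_trans]
    exact (congrArg _ h1).trans (map_zero _)
  have : Nontrivial (P.obj (Fin 1)) := Module.nontrivial_of_finrank_eq_succ h
  obtain ⟨p, hp⟩ := exists_ne (0 : P.obj (Fin 1))
  refine hp ?_
  rw [← P.comp_one p, h2]
  exact (congrArg _ ((P.comp p).map_zero)).trans (map_zero _)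

theorem mk_one' {U : Type u} [AddCommGroup U] [Module k U] (v : Fin 1 → U) :
    Free.mk P.one' v = Free.ι (v 0) := by
  rw [one', Free.mk_map]
  rfl

theorem exists_leftInverse_ι (h : Module.finrank k (P.obj (Fin 1)) = 1) (U : Type u)
    [AddCommGroup U] [Module k U] : ∃ π : P.Free U →ₗ[k] U, π ∘ₗ Free.ι = LinearMap.id := by
  obtain ⟨l, hl⟩ := LinearMap.exists_leftInverse_of_injective
    (LinearMap.toSpanSingleton k _ P.one') (LinearMap.ker_toSpanSingleton k (P.one'_ne_zero h))
  -- Projection to arity one, followed by the functional `l` with value `1` at the identity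
  -- operation.
  let φ : ∀ r, P.obj (Fin r) →ₗ[k] MultilinearMap k (fun _ : Fin r => U) U
    | 1 => LinearMap.toSpanSingleton k _
        (MultilinearMap.ofSubsingleton k U U (0 : Fin 1) LinearMap.id) ∘ₗ l
    | _ => 0
  refine ⟨Free.lift φ fun r σ p v => ?_, LinearMap.ext fun u => ?_⟩
  · match r with
    | 0 => rfl
    | 1 =>
      obtain rfl : σ = Equiv.refl _ := Subsingleton.elim _ _
      rw [P.map_refl]
      rfl
    | r + 2 => rfl
  · rw [LinearMap.comp_apply, ← P.mk_one' fun _ => u, Free.lift_mk_fin]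
    have h1 : l P.one' = 1 := by simpa using LinearMap.congr_fun hl 1
    simp [φ, h1]

theorem schurMap_ι_injective (h : Module.finrank k (P.obj (Fin 1)) = 1) (μ : YoungDiagram)
    {U : Type u} [AddCommGroup U] [Module k U] :
    Function.Injective (Schur.map k μ (Free.ι : U →ₗ[k] P.Free U)) := by
  obtain ⟨π, hπ⟩ := P.exists_leftInverse_ι h U
  intro x y hxy
  have := congrArg (Schur.map k μ π) hxy
  rwa [Schur.map_map, Schur.map_map, hπ, Schur.map_id, Schur.map_id] at this

variable {B C : Type} [Fintype C] [DecidableEq C]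

theorem basisMonomial_eq_zero (h0 : Subsingleton (P.obj (Fin 0)))
    {g : Σ r, P.obj (Fin r) × (Fin r → B)} (hg : g.1 = 0) : P.basisMonomial g = 0 := by
  obtain ⟨r, p, f⟩ := g
  obtain rfl : r = 0 := hg
  rw [basisMonomial, Subsingleton.elim p 0, map_zero]
  rfl

theorem exists_basisMonomial_eq_ι (h1 : Module.finrank k (P.obj (Fin 1)) = 1)
    {g : Σ r, P.obj (Fin r) × (Fin r → B)} (hg : g.1 = 1) :
    ∃ u : B →₀ k, P.basisMonomial g = Free.ι u := by
  obtain ⟨r, p, f⟩ := g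
  obtain rfl : r = 1 := hg
  obtain ⟨a, rfl⟩ := (finrank_eq_one_iff_of_nonzero' _ (P.one'_ne_zero h1)).1 h1 p
  refine ⟨a • Finsupp.single (f 0) 1, ?_⟩
  rw [basisMonomial, map_smul, map_smul, ← P.mk_one' fun t => Finsupp.single (f t) 1]
  rfl

/-- Without operations of arity zero every factor has degree at least one, so a total of at most
`|C|` leaves exactly one for each factor. -/
theorem fst_eq_one_of_tensorMonomial_ne_zero (h0 : Subsingleton (P.obj (Fin 0)))
    {g : C → Σ r, P.obj (Fin r) × (Fin r → B)} (hg : P.tensorMonomial g ≠ 0)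
    (hle : ∑ c, (g c).1 ≤ Fintype.card C) (c : C) : (g c).1 = 1 := by
  have hpos : ∀ c, 1 ≤ (g c).1 := by
    intro c
    by_contra hc
    refine hg ((PiTensorProduct.tprod k).map_coord_zero c ?_)
    exact P.basisMonomial_eq_zero h0 (by omega)
  have h1 : ∑ c : C, 1 = ∑ c, (g c).1 :=
    le_antisymm (Finset.sum_le_sum fun c _ => hpos c) (by simpa using hle)
  exact ((Finset.sum_eq_sum_iff_of_le fun c _ => hpos c).1 h1 c (Finset.mem_univ c)).symm

theorem tensorMonomial_mem_range (h1 : Module.finrank k (P.obj (Fin 1)) = 1)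
    {g : C → Σ r, P.obj (Fin r) × (Fin r → B)} (hg : ∀ c, (g c).1 = 1) :
    P.tensorMonomial g ∈ LinearMap.range (PiTensorProduct.map (R := k) (ι := C)
      fun _ => (Free.ι : (B →₀ k) →ₗ[k] P.Free (B →₀ k))) := by
  choose u hu using fun c => P.exists_basisMonomial_eq_ι h1 (hg c)
  exact ⟨PiTensorProduct.tprod k u, by
    rw [PiTensorProduct.map_tprod, tensorMonomial]
    exact congrArg _ (funext fun c => (hu c).symm)⟩

variable [CharZero k]

theorem mem_span_tensorMonomial_of_degree {r : ℕ} {t : ⨂[k] _ : C, P.Free (B →₀ k)}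
    (ht : tensorEnd k C (Free.derivFun (Free.ι ∘ₗ diagEnd k fun _ => (1 : k))) t = (r : k) • t) :
    t ∈ Submodule.span k (P.tensorMonomial '' {g : C → Σ r, P.obj (Fin r) × (Fin r → B) |
      ∑ c, (g c).1 = r}) := by
  have hdeg : ∀ g : C → Σ r, P.obj (Fin r) × (Fin r → B),
      tensorEnd k C (Free.derivFun (Free.ι ∘ₗ diagEnd k fun _ => (1 : k))) (P.tensorMonomial g) =
      ((∑ c, (g c).1 : ℕ) : k) • P.tensorMonomial g := by
    intro g
    rw [tensorEnd_diagEnd_tensorMonomial]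
    simp
  obtain ⟨p, hp, hpt⟩ := exists_aeval_mem (M := ⨂[k] _ : C, P.Free (B →₀ k)) (r := r) (a := t)
    (f := tensorEnd k C (Free.derivFun (Free.ι ∘ₗ diagEnd k fun _ => (1 : k))))
    (Y := Submodule.span k (P.tensorMonomial '' {g : C → Σ r, P.obj (Fin r) × (Fin r → B) |
      ∑ c, (g c).1 = r})) (s := Set.range P.tensorMonomial)
    (fun y hy => by
      induction hy using Submodule.span_induction with
      | mem y hy =>
        obtain ⟨g, hg, rfl⟩ := hy
        rw [hdeg, hg]
      | zero => rw [map_zero, smul_zero]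
      | add x y _ _ hx hy => rw [map_add, hx, hy, smul_add]
      | smul c x _ hx => rw [map_smul, hx, smul_comm])
    (by
      rintro _ ⟨g, rfl⟩
      exact ⟨_, hdeg g, fun h => Submodule.subset_span ⟨g, h, rfl⟩⟩)
    (by rw [span_tensorMonomial]; trivial)
  have h1 := aeval_apply_eigenvector (M := ⨂[k] _ : C, P.Free (B →₀ k)) ht p
  rw [hp, one_smul] at h1
  rwa [h1] at hpt

theorem card_le_of_degree (h0 : Subsingleton (P.obj (Fin 0))) {r : ℕ}
    {t : ⨂[k] _ : C, P.Free (B →₀ k)} (ht0 : t ≠ 0)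
    (ht : tensorEnd k C (Free.derivFun (Free.ι ∘ₗ diagEnd k fun _ => (1 : k))) t = (r : k) • t) :
    Fintype.card C ≤ r := by
  by_contra hlt
  refine ht0 ((Submodule.mem_bot k).1
    (Submodule.span_le.2 ?_ (P.mem_span_tensorMonomial_of_degree ht)))
  rintro _ ⟨g, hg, rfl⟩
  by_contra hne
  have h1 := P.fst_eq_one_of_tensorMonomial_ne_zero h0 hne (by rw [hg]; omega)
  rw [Set.mem_ofPred_eq, Finset.sum_congr rfl fun c _ => h1 c] at hg
  simp at hg
  omega

theorem mem_range_map_ι_of_degree (h0 : Subsingleton (P.obj (Fin 0)))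
    (h1 : Module.finrank k (P.obj (Fin 1)) = 1) {t : ⨂[k] _ : C, P.Free (B →₀ k)}
    (ht : tensorEnd k C (Free.derivFun (Free.ι ∘ₗ diagEnd k fun _ => (1 : k))) t =
      (Fintype.card C : k) • t) :
    t ∈ LinearMap.range (PiTensorProduct.map (R := k) (ι := C)
      fun _ => (Free.ι : (B →₀ k) →ₗ[k] P.Free (B →₀ k))) := by
  refine Submodule.span_le.2 ?_ (P.mem_span_tensorMonomial_of_degree ht)
  rintro _ ⟨g, hg, rfl⟩
  by_cases hne : P.tensorMonomial g = 0
  · rw [hne]; exact Submodule.zero_mem _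
  · exact P.tensorMonomial_mem_range h1
      (P.fst_eq_one_of_tensorMonomial_ne_zero h0 hne (le_of_eq hg))

variable {n : ℕ} {μ : YoungDiagram}

/-- In degree `|μ|` every factor is linear in the generators, so the tensor lies in the tensor power
of `W_n`; a linear retraction `V_n → W_n` then recovers a preimage in the Schur functor. -/
theorem exists_eq_schurMap_ι (h0 : Subsingleton (P.obj (Fin 0)))
    (h1 : Module.finrank k (P.obj (Fin 1)) = 1) {x : Schur k μ (P.V n)}
    (hx : P.glRep n _ (diagEnd k fun _ => 1) x = (Fintype.card μ.cells : k) • x) :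
    ∃ y, x = Schur.map k μ Free.ι y := by
  obtain ⟨π, hπ⟩ := P.exists_leftInverse_ι h1 (Fin n →₀ k)
  refine ⟨Schur.map k μ π x, Schur.incl_injective k μ ?_⟩
  obtain ⟨t, ht⟩ := P.mem_range_map_ι_of_degree h0 h1 (t := Schur.incl k μ x)
    ((congrArg (Schur.incl k μ) hx).trans (map_smul _ _ _))
  rw [Schur.incl_map, Schur.incl_map, ← ht, ← LinearMap.comp_apply (PiTensorProduct.map fun _ => π),
    ← PiTensorProduct.map_comp]
  simp only [hπ, PiTensorProduct.map_id]
  rfl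

variable (hμ : μ.colLen 0 ≤ n)

theorem glRep_diagEnd_generator (α : Fin n → k) :
    P.glRep n _ (diagEnd k α) (P.generator hμ) = (∑ c, α (rowIdx hμ c)) • P.generator hμ := by
  have h := (P.map_ι_mem_glHom μ (n := n)) (diagEnd k α) (hwVector k hμ)
  have h2 : ⁅diagEnd k α, hwVector k hμ⁆ = (∑ c, α (rowIdx hμ c)) • hwVector k hμ :=
    Schur.incl_injective k μ (by
      rw [map_smul, incl_hwVector, hwTensor_eq, ← tensorEnd_diagEnd_permAct_rowTensor,
        ← hwTensor_eq]
      rfl)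
  rw [h2, map_smul] at h
  exact h.symm

theorem generator_ne_zero (h1 : Module.finrank k (P.obj (Fin 1)) = 1) : P.generator hμ ≠ 0 :=
  fun h => hwVector_ne_zero (k := k) hμ
    (P.schurMap_ι_injective h1 μ (h.trans (map_zero _).symm))

/-- The total degree places the vector in `S_μ(W_n)`, where the highest weight has multiplicity one.
-/
theorem exists_eq_smul_generator (h0 : Subsingleton (P.obj (Fin 0)))
    (h1 : Module.finrank k (P.obj (Fin 1)) = 1) {x : Schur k μ (P.V n)}
    (hx : ∀ α : Fin n → k, P.glRep n _ (diagEnd k α) x = (∑ c, α (rowIdx hμ c)) • x) :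
    ∃ c : k, x = c • P.generator hμ := by
  obtain ⟨y, rfl⟩ := P.exists_eq_schurMap_ι h0 h1 ((hx fun _ => 1).trans (by simp))
  obtain ⟨c, hc⟩ := exists_smul_hwTensor_of_weight hμ (Schur.incl_mem y) fun i => by
    have h := hx (Pi.single i 1)
    rw [← elemEnd_self, glRep_apply, ← (P.map_ι_mem_glHom μ (n := n)) (elemEnd k i i) y,
      ← map_smul] at h
    have h2 := congrArg (Schur.incl k μ) (P.schurMap_ι_injective h1 μ h)
    rw [map_smul] at h2
    refine Eq.trans h2 ?_
    rw [rowWeight]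
    simp [Pi.single_apply, Finset.sum_boole]
  refine ⟨c, ?_⟩
  rw [generator, ← map_smul]
  exact congrArg _ (Schur.incl_injective k μ (hc.trans (map_smul (Schur.incl k μ) c (hwVector k hμ)).symm))

/-- The components of the generator in a decomposition have its weight, so they are multiples of it;
a nonzero one puts the generator into its summand, which is then everything. -/
theorem isIndecomposableRep_schur (hμ : μ.colLen 0 ≤ n) (h0 : Subsingleton (P.obj (Fin 0)))
    (h1 : Module.finrank k (P.obj (Fin 1)) = 1) :
    IsIndecomposableRep k (P.h n) (Schur k μ (P.V n)) := by
  refine ⟨⟨_, _, P.generator_ne_zero hμ h1⟩, fun A B hAB => ?_⟩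
  have htop : P.generator hμ ∈ A ⊔ B := by rw [hAB.sup_eq_top]; trivial
  obtain ⟨a, ha, b, hb, hab⟩ := (LieSubmodule.mem_sup _ _ _).1 htop
  obtain ⟨c, hc⟩ := P.exists_eq_smul_generator hμ h0 h1 (x := a) fun α => by
    set s := ∑ c, α (rowIdx hμ c)
    have h2 : P.glRep n _ (diagEnd k α) a - s • a = s • b - P.glRep n _ (diagEnd k α) b := by
      have := P.glRep_diagEnd_generator hμ α
      rw [← hab, map_add, smul_add] at this
      rw [sub_eq_sub_iff_add_eq_add, this, add_comm]
    -- The weight equation holds for `a + b`, so the defect of `a` is minus the defect of `b` and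
    -- lies in both summands.
    have h3 : P.glRep n _ (diagEnd k α) a - s • a ∈ A ⊓ B := by
      refine (LieSubmodule.mem_inf _ _ _).2 ⟨A.sub_mem (A.lie_mem ha) (A.smul_mem s ha), ?_⟩
      rw [h2]
      exact B.sub_mem (B.smul_mem s hb) (B.lie_mem hb)
    rw [hAB.inf_eq_bot] at h3
    exact sub_eq_zero.1 ((LieSubmodule.mem_bot _).1 h3)
  by_cases hc0 : c = 0
  · left
    have : B = ⊤ := P.eq_top_of_generator_mem hμ (by
      rw [← hab, hc, hc0, zero_smul, zero_add]; exact hb)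
    rw [← hAB.inf_eq_bot, this, inf_top_eq]
  · right
    have : A = ⊤ := P.eq_top_of_generator_mem hμ (by
      have h4 := A.smul_mem c⁻¹ ha
      rwa [hc, smul_smul, inv_mul_cancel₀ hc0, one_smul] at h4)
    rw [← hAB.inf_eq_bot, this, top_inf_eq]

/-- Let `q` have least degree among the nonzero homogeneous vectors of `Q`, and let `S_ν(V_n)`
detect it. Comparing degrees both ways shows that `q` has degree `|ν|`, so its component lies in the
simple module `S_ν(W_n)` and generates. Hence `Q` maps onto a projective module, and
indecomposability makes this an isomorphism. -/
theorem exists_equiv_schur (h0 : Subsingleton (P.obj (Fin 0)))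
    (h1 : Module.finrank k (P.obj (Fin 1)) = 1) {Q : Type u} [AddCommGroup Q] [Module k Q]
    [LieRingModule (P.h n) Q] [LieModule k (P.h n) Q]
    (hQ : IsProjectiveRep k (P.h n) (P.V n) Q) (hQ' : IsIndecomposableRep k (P.h n) Q) :
    ∃ ν : YoungDiagram, ν.colLen 0 ≤ n ∧ Nonempty (Q ≃ₗ⁅k, P.h n⁆ Schur k ν (P.V n)) := by
  classical
  obtain ⟨I, _, ν, F, hν, hF⟩ := P.exists_surjective_schurSum hQ.1
  obtain ⟨s, hs⟩ := hQ.exists_components hF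
  have hex : ∃ d : ℕ, ∃ q : Q, q ≠ 0 ∧ P.glRep n Q (diagEnd k fun _ => 1) q = (d : k) • q := by
    have hE := P.locallyNatSplit_glRep_diagEnd hQ.1 fun _ => 1
    simp only [Nat.cast_one] at hE
    have := hQ'.1
    obtain ⟨m, hm⟩ := exists_ne (0 : Q)
    obtain ⟨p, d, h, h'⟩ := hE.exists_eigenvector hm
    exact ⟨d, _, h, h'⟩
  obtain ⟨q, hq, hqd⟩ := Nat.find_spec hex
  obtain ⟨i, hi⟩ := hs q hq
  have hFi : F i (P.generator (hν i)) ≠ 0 := fun h => hi (by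
    rw [P.hom_eq_of_generator (hν i) (F := F i) (G := 0) h]
    rfl)
  -- The image of the generator under `F i` is a nonzero vector of `Q` of degree `|ν i|`, so the
  -- least degree is at most `|ν i|`. The opposite bound holds because `S_ν(V_n)` vanishes in
  -- degrees below `|ν|`.
  have hle : Nat.find hex ≤ Fintype.card (ν i).cells := Nat.find_min' hex ⟨_, hFi, by
    have h2 := congrArg (F i) (P.glRep_diagEnd_generator (hν i) fun _ => 1)
    refine ((F i).map_lie _ _).symm.trans (h2.trans ?_)
    refine ((F i).toLinearMap.map_smul _ _).trans ?_
    simp⟩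
  have hx0 : s i q ≠ 0 := fun h => hi (by rw [h]; exact (F i).toLinearMap.map_zero)
  have hx : P.glRep n _ (diagEnd k fun _ => 1) (s i q) = (Nat.find hex : k) • s i q :=
    ((s i).map_lie _ _).symm.trans ((congrArg (s i) hqd).trans ((s i).toLinearMap.map_smul _ _))
  have hge := P.card_le_of_degree h0 (t := Schur.incl k (ν i) (s i q))
    (fun h => hx0 (Schur.incl_injective k (ν i) (h.trans (map_zero _).symm)))
    ((congrArg (Schur.incl k (ν i)) hx).trans (map_smul _ _ _))
  rw [le_antisymm hle hge] at hx
  obtain ⟨y, hy⟩ := P.exists_eq_schurMap_ι h0 h1 hx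
  -- Simplicity of `S_ν(W_n)` moves the component of `q` to the highest weight vector; the same `w`
  -- applied to `q` gives a preimage of the generator.
  obtain ⟨w, hw⟩ := exists_freeAct_eq_hwVector (hν i) (x := y) fun h => hx0 (by
    rw [hy, h, map_zero])
  have hgen : s i (freeAct (P.glRep n Q) w q) = P.generator (hν i) := by
    rw [map_freeAct_glRep, hy]
    exact (map_freeAct_glHom P (P.map_ι_mem_glHom (ν i)) w y).symm.trans (congrArg _ hw)
  have hsurj : Function.Surjective (s i) := by
    rw [← LieModuleHom.range_eq_top]
    exact P.eq_top_of_generator_mem (hν i) ((LieModuleHom.mem_range _ _).2 ⟨_, hgen⟩)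
  have hS := P.isProjectiveRep_schur (hν i)
  obtain ⟨σ, hσ⟩ := hS.2 _ _ hQ.1 hS.1 (s i) LieModuleHom.id hsurj
  have : Nontrivial (Schur k (ν i) (P.V n)) := ⟨_, _, P.generator_ne_zero (hν i) h1⟩
  exact ⟨ν i, hν i, hQ'.nonempty_equiv (s i) σ hσ⟩

end Reduced
end LinearOperad

theorem mainTheorem8 {k : Type u} [Field k] [CharZero k] (P : LinearOperad k) (n : ℕ)
    (μ : YoungDiagram) (hμ : μ.colLen 0 ≤ n) :
    LieSubmodule.lieSpan k (P.h n)
        (Set.range (LinearOperad.Schur.map k μ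
          (LinearOperad.Free.ι : (Fin n →₀ k) →ₗ[k] P.V n))) = ⊤ ∧
    (∀ (M : Type u) [AddCommGroup M] [Module k M] [LieRingModule (P.h n) M]
      [LieModule k (P.h n) M], LinearOperad.IsPolynomialRep k (P.h n) (P.V n) M →
        Function.Bijective (P.restrictHom n μ M)) ∧
    (Function.Bijective (P.SchurToGamma n μ) ∧
      ∀ (N : Type u) [AddCommGroup N] [Module k N] [LieRingModule P.hInf N]
        [LieModule k P.hInf N], LinearOperad.IsPolynomialRep k P.hInf P.VInf N →
          Function.Bijective (P.GammaHom n μ N)) ∧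
    (LinearOperad.IsProjectiveRep k (P.h n) (P.V n) (LinearOperad.Schur k μ (P.V n)) ∧
      (Subsingleton (P.obj (Fin 0)) → Module.finrank k (P.obj (Fin 1)) = 1 →
        LinearOperad.IsIndecomposableRep k (P.h n) (LinearOperad.Schur k μ (P.V n)) ∧
        ∀ (Q : Type u) [AddCommGroup Q] [Module k Q] [LieRingModule (P.h n) Q]
          [LieModule k (P.h n) Q], LinearOperad.IsProjectiveRep k (P.h n) (P.V n) Q →
            LinearOperad.IsIndecomposableRep k (P.h n) Q →
              ∃ ν : YoungDiagram, ν.colLen 0 ≤ n ∧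
                Nonempty (Q ≃ₗ⁅k, P.h n⁆ LinearOperad.Schur k ν (P.V n)))) ∧
    (∀ (M : Type u) [AddCommGroup M] [Module k M] [LieRingModule (P.h n) M]
      [LieModule k (P.h n) M], LinearOperad.IsPolynomialRep k (P.h n) (P.V n) M →
        ∃ (I : Type u) (ν : I → YoungDiagram)
          (π : (⨁ i, LinearOperad.Schur k (ν i) (P.V n)) →ₗ⁅k, P.h n⁆ M),
          (∀ i, (ν i).colLen 0 ≤ n) ∧ Function.Surjective π) := by
  refine ⟨P.lieSpan_range_map_ι hμ, fun M _ _ _ _ hM => P.restrictHom_bijective hμ hM,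
    ⟨P.schurToGamma_bijective n μ, fun N _ _ _ _ hN => P.gammaHom_bijective hμ hN⟩,
    ⟨P.isProjectiveRep_schur hμ, fun h0 h1 => ⟨P.isIndecomposableRep_schur hμ h0 h1,
      fun Q _ _ _ _ hQ hQ' => P.exists_equiv_schur h0 h1 hQ hQ'⟩⟩, fun M _ _ _ _ hM => ?_⟩
  obtain ⟨I, _, ν, F, hν, hF⟩ := P.exists_surjective_schurSum hM
  exact ⟨I, ν, LinearOperad.lieSumLift F, hν, hF⟩
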